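/- **Setting.** Let $\omega=e^{2\pi i/3}$, $\Lambda=\omega\mathbb Z\oplus\mathbb Z$, $z=x_1+ix_2$, $2D_{\bar z}=\frac1i(\partial_{x_1}+i\partial_{x_2})$, and let $V:\mathbb C\to\mathbb C$ be a real analytic potential with $$V(-z)=V(z),\quad V(z+\gamma)=V(z)\ (\gamma\in\Lambda),\quad V(\omega z)=\omega^2V(z),\quad \overline{V(\bar z)}=V(z).$$ For $\alpha,k\in\mathbb C$ put $$P(\alpha,k)=(2D_{\bar z}+k)^2-\alpha^2V:H^2(\mathbb C/\Lambda;\mathbb C)\to L^2(\mathbb C/\Lambda;\mathbb C),$$ $$D_S(\alpha)=\begin{pmatrix}2D_{\bar z}&\alpha V\\ \alpha&2D_{\bar z}\end{pmatrix}:H^1(\mathbb C/\Lambda;\mathbb C^2)\to L^2(\mathbb C/\Lambda;\mathbb C^2),$$ $$H(\alpha,k)=\begin{pmatrix}0&D_S(\alpha)+k\\(D_S(\alpha)+k)^*&0\end{pmatrix}:H^1(\mathbb C/\Lambda;\mathbb C^4)\to L^2(\mathbb C/\Lambda;\mathbb C^4).$$ The set of magic parameters is $\mathcal A=\{\alpha\in\mathbb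 C:\ker P(\alpha,k)\neq\{0\}\text{ for all }k\in\mathbb C\}$. The spectrum of $H(\alpha,k)$ is discrete and symmetric about $0$; its eigenvalues, with multiplicity, are listed as $$\cdots\le-E_2(\alpha,k)\le-E_1(\alpha,k)\le E_1(\alpha,k)\le E_2(\alpha,k)\le\cdots,\qquad E_{-j}:=-E_j,$$ and a flat band at $0$ is an index $j\in\mathbb Z\setminus\{0\}$ with $E_j(\alpha,k)=0$ for all $k\in\mathbb C$. For a smooth $\Lambda$-periodic $u$ with $P(\alpha,0)u=0$, $u\not\equiv0$, put $\mathbf u=(2D_{\bar z}u,u)^t$ and let $$M_{\mathbf u}(z_0)=\max\{m\ge0:\ (\partial_z^j\mathbf u)(z_0)=0\ \text{ for all } 0\le j<m\}$$ be the multiplicity of $z_0$ as a zero of $\mathbf u$ (so $M_{\mathbf u}(z_0)=0$ if $\mathbf u(z_0)\ne0$). **Proposition.** Let $\alpha\in\mathcal A$. Every nonzero $u\in\ker_{H^2}P(\alpha,0)$ is (represented by) a smooth function, and the total number of zeros of $\mathbf u$ $$m(\alpha):=\sum_{z\in\mathbb C/\Lambda}M_{\mathbf u}(z)$$ is finite and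 does not depend on the choice of $u$; in particular, $u$ may be the protected state $u(\alpha)$, that is, the value at $\alpha$ of a holomorphic family $\beta\mapsto u(\beta)\in\ker P(\beta,0)\setminus\{0\}$ with $u(\beta)(e^{-\pi i/3}z)=u(\beta)(z)$. Moreover $$\dim\ker D_S(\alpha)=m(\alpha),$$ $$\dim\ker H(\alpha,k)=2m(\alpha)\quad\text{for all }k\in\mathbb C,$$ and the number of flat bands at $0$ is $2m(\alpha)$. -/

import Mathlib

open MeasureTheory Set
open scoped ContDiff ComplexConjugate

noncomputable section

namespace ScalarModel

/-! ### The torus `ℂ/Λ`, with `Λ = ωℤ ⊕ ℤ` and `ω = exp(2πi/3)` -/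

/-- `ω = e^{2πi/3}`. -/
def omega : ℂ := Complex.exp (2 * Real.pi * Complex.I / 3)

/-- `Λ`-periodic functions on `ℂ`, that is, functions on `ℂ/Λ`, where `Λ = ℤ + ωℤ`. -/
def IsPeriodic {E : Type*} (f : ℂ → E) : Prop :=
  ∀ (m n : ℤ) (z : ℂ), f (z + (m + n * omega)) = f z

/-- The half-open fundamental parallelogram of `Λ`: it contains exactly one representative of each
point of `ℂ/Λ`. -/
def cell : Set ℂ :=
  {z | ∃ s ∈ Ico (0 : ℝ) 1, ∃ t ∈ Ico (0 : ℝ) 1, z = s + t * omega}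

/-- Lebesgue measure on `ℂ/Λ`. -/
abbrev cellMeasure : Measure ℂ := volume.restrict cell

/-- The Hilbert space `L²(ℂ/Λ; ℂ)`. -/
abbrev L2 : Type := Lp ℂ 2 cellMeasure

lemma omega_im_pos : 0 < omega.im := by
  have h : omega = Complex.exp (((2 * Real.pi / 3 : ℝ) : ℂ) * Complex.I) := by
    unfold omega; congr 1; push_cast; ring
  rw [h, Complex.exp_ofReal_mul_I_im]
  apply Real.sin_pos_of_pos_of_lt_pi <;> nlinarith [Real.pi_pos]

/-- The coordinate `t` of `z = s + t ω`. -/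
def coordT : ℂ →L[ℝ] ℝ := (omega.im)⁻¹ • Complex.imCLM

/-- The coordinate `s` of `z = s + t ω`. -/
def coordS : ℂ →L[ℝ] ℝ := Complex.reCLM - omega.re • coordT

lemma coordT_apply (z : ℂ) : coordT z = (omega.im)⁻¹ * z.im := by simp [coordT]

lemma coordS_apply (z : ℂ) : coordS z = z.re - omega.re * coordT z := by simp [coordS]

lemma coord_eq (z : ℂ) : z = coordS z + coordT z * omega := by
  have h := omega_im_pos.ne'
  apply Complex.ext
  · simp [coordS_apply]; ring
  · simp [coordT_apply]; field_simp

lemma coordT_mk (s t : ℝ) : coordT (s + t * omega) = t := by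
  have h := omega_im_pos.ne'
  simp [coordT_apply]; field_simp

lemma coordS_mk (s t : ℝ) : coordS (s + t * omega) = s := by
  rw [coordS_apply, coordT_mk]; simp; ring

lemma mem_cell_iff (z : ℂ) : z ∈ cell ↔ coordS z ∈ Ico (0 : ℝ) 1 ∧ coordT z ∈ Ico (0 : ℝ) 1 := by
  constructor
  · rintro ⟨s, hs, t, ht, rfl⟩
    rw [coordS_mk, coordT_mk]; exact ⟨hs, ht⟩
  · rintro ⟨hs, ht⟩
    exact ⟨_, hs, _, ht, coord_eq z⟩

lemma measurableSet_cell : MeasurableSet cell := by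
  have : cell = coordS ⁻¹' Ico (0 : ℝ) 1 ∩ coordT ⁻¹' Ico (0 : ℝ) 1 := by
    ext z; exact mem_cell_iff z
  rw [this]
  exact (coordS.continuous.measurable measurableSet_Ico).inter
    (coordT.continuous.measurable measurableSet_Ico)

lemma norm_omega : ‖omega‖ = 1 := by
  have h : omega = Complex.exp (((2 * Real.pi / 3 : ℝ) : ℂ) * Complex.I) := by
    unfold omega; congr 1; push_cast; ring
  rw [h, Complex.norm_exp_ofReal_mul_I]

lemma cell_subset : cell ⊆ Metric.closedBall 0 2 := by
  rintro z ⟨s, hs, t, ht, rfl⟩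
  rw [mem_closedBall_zero_iff]
  calc ‖(s : ℂ) + t * omega‖ ≤ ‖(s : ℂ)‖ + ‖(t : ℂ) * omega‖ := norm_add_le _ _
    _ ≤ 1 + 1 := by
      rw [norm_mul, norm_omega, Complex.norm_of_nonneg hs.1, Complex.norm_of_nonneg ht.1]
      linarith [hs.2, ht.2]
    _ = 2 := by norm_num

instance : IsFiniteMeasure cellMeasure :=
  ⟨by
    rw [Measure.restrict_apply_univ]
    exact lt_of_le_of_lt (measure_mono cell_subset) measure_closedBall_lt_top⟩

/-- A continuous function is bounded on the fundamental parallelogram. -/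
lemma memLp_top_of_continuous {g : ℂ → ℂ} (hg : Continuous g) : MemLp g ⊤ cellMeasure := by
  obtain ⟨C, hC⟩ := (isCompact_closedBall (0 : ℂ) 2).exists_bound_of_continuousOn hg.continuousOn
  refine memLp_top_of_bound hg.aestronglyMeasurable C ?_
  exact (ae_restrict_mem measurableSet_cell).mono fun z hz => hC z (cell_subset hz)

lemma memLp_mul {g : ℂ → ℂ} (hg : Continuous g) (f : L2) :
    MemLp (fun z => g z * f z) 2 cellMeasure :=
  (Lp.memLp f).mul' (memLp_top_of_continuous hg)

lemma integrable_mul (f : L2) {g : ℂ → ℂ} (hg : Continuous g) :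
    Integrable (fun z => f z * g z) cellMeasure := by
  have := (memLp_mul hg f).integrable (by norm_num)
  simpa only [mul_comm] using this

/-- Multiplication by a continuous function on `L²(ℂ/Λ)`. -/
def mulOp (g : C(ℂ, ℂ)) : L2 →ₗ[ℂ] L2 where
  toFun f := (memLp_mul g.continuous f).toLp _
  map_add' f₁ f₂ := by
    rw [← MemLp.toLp_add, MemLp.toLp_eq_toLp_iff]
    filter_upwards [Lp.coeFn_add f₁ f₂] with z hz
    simp only [Pi.add_apply, hz, mul_add]
  map_smul' c f := by
    rw [RingHom.id_apply, ← MemLp.toLp_const_smul, MemLp.toLp_eq_toLp_iff]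
    filter_upwards [Lp.coeFn_smul c f] with z hz
    simp only [Pi.smul_apply, hz, smul_eq_mul]
    ring

/-! ### Weak derivatives and Sobolev spaces on `ℂ/Λ` -/

/-- Test functions: `C^∞(ℂ/Λ)`. -/
def IsTest (φ : ℂ → ℂ) : Prop := ContDiff ℝ ∞ φ ∧ IsPeriodic φ

/-- `g` is the weak derivative of `f` on `ℂ/Λ` in the direction `v ∈ ℂ = ℝ²`. -/
def IsWeakDeriv (v : ℂ) (f g : L2) : Prop :=
  ∀ φ : ℂ → ℂ, IsTest φ →
    ∫ z, f z * fderiv ℝ φ z v ∂cellMeasure = - ∫ z, g z * φ z ∂cellMeasure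

lemma IsTest.continuous_fderiv {φ : ℂ → ℂ} (hφ : IsTest φ) (v : ℂ) :
    Continuous fun z => fderiv ℝ φ z v :=
  (hφ.1.continuous_fderiv (by simp)).clm_apply continuous_const

lemma IsWeakDeriv.add {v : ℂ} {f₁ f₂ g₁ g₂ : L2} (h₁ : IsWeakDeriv v f₁ g₁)
    (h₂ : IsWeakDeriv v f₂ g₂) : IsWeakDeriv v (f₁ + f₂) (g₁ + g₂) := by
  intro φ hφ
  have e₁ : ∫ z, (f₁ + f₂ : L2) z * fderiv ℝ φ z v ∂cellMeasure
      = ∫ z, (f₁ z * fderiv ℝ φ z v + f₂ z * fderiv ℝ φ z v) ∂cellMeasure := by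
    refine integral_congr_ae ?_
    filter_upwards [Lp.coeFn_add f₁ f₂] with z hz
    rw [hz, Pi.add_apply, add_mul]
  have e₂ : ∫ z, (g₁ + g₂ : L2) z * φ z ∂cellMeasure
      = ∫ z, (g₁ z * φ z + g₂ z * φ z) ∂cellMeasure := by
    refine integral_congr_ae ?_
    filter_upwards [Lp.coeFn_add g₁ g₂] with z hz
    rw [hz, Pi.add_apply, add_mul]
  rw [e₁, e₂, integral_add (integrable_mul _ (hφ.continuous_fderiv v))
    (integrable_mul _ (hφ.continuous_fderiv v)), integral_add (integrable_mul _ hφ.1.continuous)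
    (integrable_mul _ hφ.1.continuous), h₁ φ hφ, h₂ φ hφ]
  ring

lemma IsWeakDeriv.smul {v : ℂ} {f g : L2} (c : ℂ) (h : IsWeakDeriv v f g) :
    IsWeakDeriv v (c • f) (c • g) := by
  intro φ hφ
  have e₁ : ∫ z, (c • f : L2) z * fderiv ℝ φ z v ∂cellMeasure
      = ∫ z, c * (f z * fderiv ℝ φ z v) ∂cellMeasure := by
    refine integral_congr_ae ?_
    filter_upwards [Lp.coeFn_smul c f] with z hz
    rw [hz, Pi.smul_apply, smul_eq_mul, mul_assoc]
  have e₂ : ∫ z, (c • g : L2) z * φ z ∂cellMeasure = ∫ z, c * (g z * φ z) ∂cellMeasure := by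
    refine integral_congr_ae ?_
    filter_upwards [Lp.coeFn_smul c g] with z hz
    rw [hz, Pi.smul_apply, smul_eq_mul, mul_assoc]
  rw [e₁, e₂, integral_const_mul, integral_const_mul, h φ hφ]
  ring

lemma isWeakDeriv_zero (v : ℂ) : IsWeakDeriv v 0 0 := by
  have h : ∀ ψ : ℂ → ℂ, ∫ z, (0 : L2) z * ψ z ∂cellMeasure = 0 := by
    intro ψ
    rw [← integral_zero ℂ ℂ (μ := cellMeasure)]
    refine integral_congr_ae ?_
    filter_upwards [Lp.coeFn_zero ℂ 2 cellMeasure] with z hz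
    rw [hz, Pi.zero_apply, zero_mul]
  intro φ _
  rw [h, h, neg_zero]

/-- The Sobolev spaces `H^n(ℂ/Λ; ℂ)`: all weak derivatives up to order `n` are in `L²`. -/
def sobolev : ℕ → Submodule ℂ L2
  | 0 => ⊤
  | n + 1 =>
    { carrier := {f | ∀ v : ℂ, ∃ g ∈ sobolev n, IsWeakDeriv v f g}
      zero_mem' := fun v => ⟨0, Submodule.zero_mem _, isWeakDeriv_zero v⟩
      add_mem' := by
        intro f₁ f₂ h₁ h₂ v
        obtain ⟨g₁, hg₁, hd₁⟩ := h₁ v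
        obtain ⟨g₂, hg₂, hd₂⟩ := h₂ v
        exact ⟨g₁ + g₂, Submodule.add_mem _ hg₁ hg₂, hd₁.add hd₂⟩
      smul_mem' := by
        intro c f h v
        obtain ⟨g, hg, hd⟩ := h v
        exact ⟨c • g, Submodule.smul_mem _ c hg, hd.smul c⟩ }

lemma sobolev_succ_le (n : ℕ) : sobolev (n + 1) ≤ sobolev n := by
  induction n with
  | zero => exact le_top
  | succ n ih =>
    intro f hf v
    obtain ⟨g, hg, hd⟩ := hf v
    exact ⟨g, ih hg, hd⟩

/-- Periodization of a function. -/
def periodize (g : ℂ → ℝ) (z : ℂ) : ℂ :=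
  ∑ᶠ p : ℤ × ℤ, (g (z + (p.1 + p.2 * omega)) : ℂ)

lemma coord_add (z : ℂ) (m n : ℤ) :
    coordS (z + (m + n * omega)) = coordS z + m ∧ coordT (z + (m + n * omega)) = coordT z + n := by
  have h₁ := coordS_mk m n
  have h₂ := coordT_mk m n
  push_cast at h₁ h₂
  rw [map_add coordS z, map_add coordT z, h₁, h₂]
  exact ⟨rfl, rfl⟩

lemma periodize_eq {g : ℂ → ℝ} (hg : Function.support g ⊆ cell) {z : ℂ} (hz : z ∈ cell) :
    periodize g z = g z := by
  unfold periodize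
  rw [finsum_eq_single _ (0 : ℤ × ℤ)]
  · simp
  · rintro ⟨m, n⟩ hmn
    by_contra hne
    have hmem : z + (m + n * omega) ∈ cell := hg fun h0 => hne (by simp [h0])
    rw [mem_cell_iff] at hz hmem
    obtain ⟨h₁, h₂⟩ := coord_add z m n
    rw [h₁, h₂] at hmem
    obtain ⟨⟨a1, a2⟩, b1, b2⟩ := hz
    obtain ⟨⟨c1, c2⟩, d1, d2⟩ := hmem
    have e1 : (-1 : ℝ) < m := by linarith
    have e2 : (m : ℝ) < 1 := by linarith
    have e3 : (-1 : ℝ) < n := by linarith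
    have e4 : (n : ℝ) < 1 := by linarith
    have f1 : -1 < m := by exact_mod_cast e1
    have f2 : m < 1 := by exact_mod_cast e2
    have f3 : -1 < n := by exact_mod_cast e3
    have f4 : n < 1 := by exact_mod_cast e4
    exact hmn (Prod.ext (by simp; omega) (by simp; omega))

lemma isTest_periodize {g : ℂ → ℝ} (hg : Function.support g ⊆ cell) (hs : ContDiff ℝ ∞ g) :
    IsTest (periodize g) := by
  constructor
  · rw [contDiff_iff_contDiffAt]
    intro z₀
    obtain ⟨N, hN⟩ := exists_nat_gt (|coordS z₀| + |coordT z₀| + 3)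
    set B : Finset (ℤ × ℤ) := Finset.Icc (-(N : ℤ)) N ×ˢ Finset.Icc (-(N : ℤ)) N with hB
    have hloc : ∀ᶠ z in nhds z₀, periodize g z
        = ∑ p ∈ B, (g (z + ((p.1 : ℂ) + p.2 * omega)) : ℂ) := by
      have hS : ∀ᶠ z in nhds z₀, |coordS z| < |coordS z₀| + 1 :=
        (coordS.continuous.abs.tendsto z₀).eventually (gt_mem_nhds (by linarith))
      have hT : ∀ᶠ z in nhds z₀, |coordT z| < |coordT z₀| + 1 :=
        (coordT.continuous.abs.tendsto z₀).eventually (gt_mem_nhds (by linarith))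
      filter_upwards [hS, hT] with z hzS hzT
      refine finsum_eq_sum_of_support_subset _ ?_
      rintro ⟨m, n⟩ hmn
      have hmem : z + (m + n * omega) ∈ cell := by
        refine hg fun h0 => hmn ?_
        simp [h0]
      rw [mem_cell_iff] at hmem
      obtain ⟨h₁, h₂⟩ := coord_add z m n
      rw [h₁, h₂] at hmem
      obtain ⟨⟨c1, c2⟩, d1, d2⟩ := hmem
      rw [abs_lt] at hzS hzT
      have p1 := abs_nonneg (coordS z₀)
      have p2 := abs_nonneg (coordT z₀)
      have e1 : (-(N : ℤ) : ℝ) < m := by push_cast; linarith [hzS.1, hzS.2]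
      have e2 : (m : ℝ) < N := by linarith [hzS.1, hzS.2]
      have e3 : (-(N : ℤ) : ℝ) < n := by push_cast; linarith [hzT.1, hzT.2]
      have e4 : (n : ℝ) < N := by linarith [hzT.1, hzT.2]
      have f1 : -(N : ℤ) < m := by exact_mod_cast e1
      have f2 : m < (N : ℤ) := by exact_mod_cast e2
      have f3 : -(N : ℤ) < n := by exact_mod_cast e3
      have f4 : n < (N : ℤ) := by exact_mod_cast e4
      simp only [hB, Finset.coe_product, Finset.coe_Icc, mem_prod, mem_Icc]
      omega
    refine ContDiffAt.congr_of_eventuallyEq ?_ hloc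
    refine ContDiffAt.sum fun p _ => ?_
    exact (Complex.ofRealCLM.contDiff.comp (hs.comp (contDiff_id.add contDiff_const))).contDiffAt
  · intro m n z
    unfold periodize
    rw [← finsum_comp_equiv (Equiv.addRight ((m, n) : ℤ × ℤ))
      (f := fun p : ℤ × ℤ => (g (z + (p.1 + p.2 * omega)) : ℂ))]
    refine finsum_congr fun p => ?_
    simp only [Equiv.coe_addRight, Prod.fst_add, Prod.snd_add]
    push_cast
    congr 2
    ring

/-- An element of `L²(ℂ/Λ)` orthogonal to all test functions vanishes. -/
lemma eq_zero_of_forall_test {h : L2}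
    (hh : ∀ φ : ℂ → ℂ, IsTest φ → ∫ z, h z * φ z ∂cellMeasure = 0) : h = 0 := by
  set U : Set ℂ := coordS ⁻¹' Ioo (0 : ℝ) 1 ∩ coordT ⁻¹' Ioo (0 : ℝ) 1 with hU
  have hUo : IsOpen U := (isOpen_Ioo.preimage coordS.continuous).inter
    (isOpen_Ioo.preimage coordT.continuous)
  have hUc : U ⊆ cell := fun z hz =>
    (mem_cell_iff z).2 ⟨Ioo_subset_Ico_self hz.1, Ioo_subset_Ico_self hz.2⟩
  have hint : Integrable (fun z => h z) cellMeasure := (Lp.memLp h).integrable (by norm_num)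
  have key : ∀ᵐ z ∂cellMeasure, z ∈ U → h z = 0 := by
    refine hUo.ae_eq_zero_of_integral_contDiff_smul_eq_zero
      (hint.locallyIntegrable.locallyIntegrableOn U) ?_
    intro g hg _ hgU
    have hsub : Function.support g ⊆ cell := (subset_tsupport g).trans (hgU.trans hUc)
    rw [← hh _ (isTest_periodize hsub hg)]
    refine integral_congr_ae ?_
    filter_upwards [ae_restrict_mem measurableSet_cell] with z hz
    rw [periodize_eq hsub hz, Complex.real_smul, mul_comm]
  have hker : ∀ L : ℂ →L[ℝ] ℝ, (∃ z, L z ≠ 0) → ∀ᵐ z ∂cellMeasure, L z ≠ 0 := by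
    rintro L ⟨w, hw⟩
    refine ae_restrict_of_ae ?_
    have : (volume : Measure ℂ) (LinearMap.ker L.toLinearMap : Submodule ℝ ℂ) = 0 := by
      refine Measure.addHaar_submodule _ _ fun htop => hw ?_
      have : w ∈ LinearMap.ker L.toLinearMap := by rw [htop]; trivial
      exact this
    rw [ae_iff]
    convert this using 2
    ext z
    simp
  have hS := hker coordS ⟨1, by
    have : coordS 1 = 1 := by simpa using coordS_mk 1 0
    simp [this]⟩
  have hT := hker coordT ⟨omega, by
    have : coordT omega = 1 := by simpa using coordT_mk 0 1
    simp [this]⟩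
  rw [Lp.eq_zero_iff_ae_eq_zero]
  filter_upwards [key, hS, hT, ae_restrict_mem measurableSet_cell] with z hz hzS hzT hzc
  rw [mem_cell_iff] at hzc
  exact hz ⟨⟨lt_of_le_of_ne hzc.1.1 hzS.symm, hzc.1.2⟩, lt_of_le_of_ne hzc.2.1 hzT.symm, hzc.2.2⟩

/-- Weak derivatives are unique. -/
lemma IsWeakDeriv.unique {v : ℂ} {f g₁ g₂ : L2} (h₁ : IsWeakDeriv v f g₁)
    (h₂ : IsWeakDeriv v f g₂) : g₁ = g₂ := by
  rw [← sub_eq_zero]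
  refine eq_zero_of_forall_test fun φ hφ => ?_
  have e : ∫ z, (g₁ - g₂ : L2) z * φ z ∂cellMeasure
      = ∫ z, (g₁ z * φ z - g₂ z * φ z) ∂cellMeasure := by
    refine integral_congr_ae ?_
    filter_upwards [Lp.coeFn_sub g₁ g₂] with z hz
    rw [hz, Pi.sub_apply, sub_mul]
  rw [e, integral_sub (integrable_mul _ hφ.1.continuous) (integrable_mul _ hφ.1.continuous)]
  have a := h₁ φ hφ
  have b := h₂ φ hφ
  rw [a, neg_inj] at b
  rw [b, sub_self]

/-- The weak derivative in the direction `v`, as a map `H^{n+1}(ℂ/Λ) → H^n(ℂ/Λ)`. -/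
def weakDeriv (n : ℕ) (v : ℂ) : sobolev (n + 1) →ₗ[ℂ] sobolev n where
  toFun f := ⟨(f.2 v).choose, (f.2 v).choose_spec.1⟩
  map_add' f₁ f₂ := Subtype.ext <| ((f₁ + f₂).2 v).choose_spec.2.unique
    ((f₁.2 v).choose_spec.2.add (f₂.2 v).choose_spec.2)
  map_smul' c f := Subtype.ext <| ((c • f).2 v).choose_spec.2.unique
    ((f.2 v).choose_spec.2.smul c)

/-! ### The operators of the scalar model -/

/-- `2 D_{z̄} = (1/i)(∂_{x₁} + i ∂_{x₂}) : H^{n+1}(ℂ/Λ) → H^n(ℂ/Λ)`. -/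
def twoDbar (n : ℕ) : sobolev (n + 1) →ₗ[ℂ] sobolev n :=
  (1 / Complex.I) • (weakDeriv n 1 + Complex.I • weakDeriv n Complex.I)

/-- `2 D_z = (1/i)(∂_{x₁} - i ∂_{x₂}) : H^{n+1}(ℂ/Λ) → H^n(ℂ/Λ)`. -/
def twoDz (n : ℕ) : sobolev (n + 1) →ₗ[ℂ] sobolev n :=
  (1 / Complex.I) • (weakDeriv n 1 - Complex.I • weakDeriv n Complex.I)

/-- The inclusion `H^{n+1}(ℂ/Λ) ⊆ H^n(ℂ/Λ)`. -/
def incl (n : ℕ) : sobolev (n + 1) →ₗ[ℂ] sobolev n :=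
  Submodule.inclusion (sobolev_succ_le n)

/-- The potentials of the scalar model: real analytic `V : ℂ → ℂ` with
`V(z) = V(-z)`, `V(z + γ) = V(z)` for `γ ∈ Λ`, `V(ωz) = ω² V(z)`, and `V(z) = conj V(z̄)`. -/
structure Potential where
  toFun : ℂ → ℂ
  analytic : AnalyticOnNhd ℝ toFun univ
  even : ∀ z, toFun (-z) = toFun z
  periodic : IsPeriodic toFun
  rotation : ∀ z, toFun (omega * z) = omega ^ 2 * toFun z
  reflection : ∀ z, conj (toFun (conj z)) = toFun z

/-- `V` as a continuous function. -/
def Potential.cont (V : Potential) : C(ℂ, ℂ) :=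
  ⟨V.toFun, continuousOn_univ.1 V.analytic.continuousOn⟩

/-- The complex conjugate of `V` as a continuous function. -/
def Potential.conjCont (V : Potential) : C(ℂ, ℂ) :=
  ⟨fun z => conj (V.toFun z), Complex.continuous_conj.comp V.cont.continuous⟩

/-- `P(α,k) = (2 D_{z̄} + k)² - α² V : H²(ℂ/Λ; ℂ) → L²(ℂ/Λ; ℂ)`. -/
def opP (V : Potential) (α k : ℂ) : sobolev 2 →ₗ[ℂ] L2 :=
  (sobolev 0).subtype ∘ₗ (twoDbar 0 + k • incl 0) ∘ₗ (twoDbar 1 + k • incl 1)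
    - α ^ 2 • (mulOp V.cont ∘ₗ (sobolev 2).subtype)

/-- The set `𝒜` of magic parameters: `ker_{H²} P(α,k) ≠ {0}` for all `k ∈ ℂ`. -/
def magicSet (V : Potential) : Set ℂ :=
  {α | ∀ k : ℂ, LinearMap.ker (opP V α k) ≠ ⊥}

/-- `H¹(ℂ/Λ; ℂ²)`. -/
abbrev H1sq : Type := sobolev 1 × sobolev 1

/-- `D_S(α) + k : H¹(ℂ/Λ; ℂ²) → L²(ℂ/Λ; ℂ²)`, where
`D_S(α) = [[2 D_{z̄}, α V], [α, 2 D_{z̄}]]`. -/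
def opDS (V : Potential) (α k : ℂ) : H1sq →ₗ[ℂ] L2 × L2 :=
  let u₁ : H1sq →ₗ[ℂ] sobolev 1 := LinearMap.fst ℂ _ _
  let u₂ : H1sq →ₗ[ℂ] sobolev 1 := LinearMap.snd ℂ _ _
  let d : sobolev 1 →ₗ[ℂ] L2 := (sobolev 0).subtype ∘ₗ (twoDbar 0 + k • incl 0)
  let j : sobolev 1 →ₗ[ℂ] L2 := (sobolev 1).subtype
  LinearMap.prod (d ∘ₗ u₁ + α • (mulOp V.cont ∘ₗ j ∘ₗ u₂)) (α • (j ∘ₗ u₁) + d ∘ₗ u₂)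

/-- The adjoint `(D_S(α) + k)^* : H¹(ℂ/Λ; ℂ²) → L²(ℂ/Λ; ℂ²)`, that is,
`[[2 D_z + k̄, ᾱ], [ᾱ V̄, 2 D_z + k̄]]`. -/
def opDSadj (V : Potential) (α k : ℂ) : H1sq →ₗ[ℂ] L2 × L2 :=
  let u₁ : H1sq →ₗ[ℂ] sobolev 1 := LinearMap.fst ℂ _ _
  let u₂ : H1sq →ₗ[ℂ] sobolev 1 := LinearMap.snd ℂ _ _
  let d : sobolev 1 →ₗ[ℂ] L2 := (sobolev 0).subtype ∘ₗ (twoDz 0 + conj k • incl 0)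
  let j : sobolev 1 →ₗ[ℂ] L2 := (sobolev 1).subtype
  LinearMap.prod (d ∘ₗ u₁ + conj α • (j ∘ₗ u₂))
    (conj α • (mulOp V.conjCont ∘ₗ j ∘ₗ u₁) + d ∘ₗ u₂)

/-- The Bloch Hamiltonian `H(α,k) = [[0, D_S(α) + k], [(D_S(α) + k)^*, 0]]`
from `H¹(ℂ/Λ; ℂ⁴)` to `L²(ℂ/Λ; ℂ⁴)`. -/
def opH (V : Potential) (α k : ℂ) : H1sq × H1sq →ₗ[ℂ] (L2 × L2) × (L2 × L2) :=
  LinearMap.prod (opDS V α k ∘ₗ LinearMap.snd ℂ _ _) (opDSadj V α k ∘ₗ LinearMap.fst ℂ _ _)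

/-- The inclusion `H¹(ℂ/Λ; ℂ⁴) ⊆ L²(ℂ/Λ; ℂ⁴)`. -/
def inclH : H1sq × H1sq →ₗ[ℂ] (L2 × L2) × (L2 × L2) :=
  let j : sobolev 1 →ₗ[ℂ] L2 := (sobolev 1).subtype
  (j.prodMap j).prodMap (j.prodMap j)

/-- The eigenspace of `H(α,k)` for the real number `μ`. -/
def eigenspaceH (V : Potential) (α k : ℂ) (μ : ℝ) : Submodule ℂ (H1sq × H1sq) :=
  LinearMap.ker (opH V α k - (μ : ℂ) • inclH)

/-- `E_j(α,k)` for `j ≥ 1`. The spectrum of `H(α,k)` is symmetric about `0`, so the number of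
eigenvalues in `[-r, r]`, counted with multiplicity, is twice the number of `j ≥ 1` with
`E_j(α,k) ≤ r`; thus `E_j(α,k)` is the least `r ≥ 0` for which `[-r, r]` contains at
least `2j` eigenvalues. -/
def bandPos (V : Potential) (α k : ℂ) (j : ℕ) : EReal :=
  ⨅ r ∈ {r : ℝ | 0 ≤ r ∧
    (2 * j : Cardinal) ≤ Module.rank ℂ ↥(⨆ μ ∈ Icc (-r) r, eigenspaceH V α k μ)}, (r : EReal)

/-- The bands `⋯ ≤ -E_2 ≤ -E_1 ≤ E_1 ≤ E_2 ≤ ⋯`, that is, the eigenvalues of `H(α,k)`, indexed by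
the nonzero integers, with `E_{-j} = -E_j`. -/
def band (V : Potential) (α k : ℂ) (j : ℤ) : EReal :=
  if 0 < j then bandPos V α k j.natAbs else -bandPos V α k j.natAbs

/-- The (indices of the) flat bands at energy `0`: the `j ≠ 0` with `E_j(α,k) = 0` for all `k`. -/
def flatBands (V : Potential) (α : ℂ) : Set ℤ :=
  {j | j ≠ 0 ∧ ∀ k : ℂ, band V α k j = 0}

/-! ### Zeros -/

/-- `∂_z = ½(∂_{x₁} - i ∂_{x₂})` on differentiable functions. -/
def dz {E : Type*} [NormedAddCommGroup E] [NormedSpace ℂ E] (f : ℂ → E) (z : ℂ) : E :=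
  (1 / 2 : ℂ) • (fderiv ℝ f z 1 - Complex.I • fderiv ℝ f z Complex.I)

/-- The vector `𝐮 = [2 D_{z̄} u, u]` attached to a differentiable function `u`. -/
def vec (u : ℂ → ℂ) (z : ℂ) : ℂ × ℂ :=
  ((1 / Complex.I) * (fderiv ℝ u z 1 + Complex.I * fderiv ℝ u z Complex.I), u z)

/-- The multiplicity of `z₀` as a zero of `𝐮`: the largest `m` with `∂_z^j 𝐮(z₀) = 0` for all
`j < m` (`∞` if there is no largest one); it is `0` if `𝐮(z₀) ≠ 0`. -/
def zeroMult (w : ℂ → ℂ × ℂ) (z₀ : ℂ) : ℕ∞ :=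
  ⨆ m ∈ {m : ℕ | ∀ j < m, dz^[j] w z₀ = 0}, (m : ℕ∞)

/-- The number of zeros of `𝐮` on `ℂ/Λ`, counted with multiplicity. -/
def zeroCount (w : ℂ → ℂ × ℂ) : ℕ∞ := ∑' z : cell, zeroMult w z

end ScalarModel

end

/-! Since `α ≠ 0`, the kernel of `D_S(α) + k` is identified, by elliptic regularity and a rescaling
of the first component, with the smooth periodic solutions `w` of `(2D_{z̄}+k)w₁ = α²V w₂`,
`(2D_{z̄}+k)w₂ = w₁` (`bijective_solToKer`). At `k = 0` these are exactly the vectors `𝐮` with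
`P(α,0)u = 0`. The factor `e^{ikz̄/2}` removes `k` and turns periodicity into constant multipliers
(`gaugeEquiv`). So everything happens in the spaces `QSol` of solutions at `k = 0` with multipliers
`a` and `b e^{2πiNz}` along `1` and `ω`. These solutions may be multiplied by entire functions, and
a scalar entire function with such multipliers has `-N` zeros per cell: `N = -1` for `theta`.

A solution vanishing at a point has a Taylor series without pure powers of `z̄`, hence is divisible
by `z - z₁` in the smooth category (`exists_eq_mul_of_dbar_system`), and globally by `θ(z - P)`,
which raises `N` by one. Start from a periodic `u ≠ 0` and divide out zeros. The procedure stops: a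
nonzero solution of index `N`, multiplied by the `N`-dimensional space of theta functions with `N`
zeros, gives `N` independent periodic solutions, and that space is finite-dimensional. What remains
is a nowhere vanishing `s` of index `m`, where `m` is the number of zeros of `u`
(`exists_nowhere_zero_solution`).

The Wronskian of two solutions is holomorphic. For `m ≥ 1` the Wronskian of `s` with a solution of
index `0` would have `-m` zeros per cell, so it is `0` and the solution is `g s` with `g` a theta
function. Hence every space of solutions of index `0` has dimension exactly `m`, whatever the
multipliers (`finrank_QSol_zero`); this gives both the independence of `u` and the dimension at
every `k`. The case `m = 0` is excluded by magicity at a `k` whose multipliers are not those of an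
exponential: there the Wronskian and the ratio `g` both vanish (`solutions_structure`).

The evenness of `V` makes `f ↦ conj f(-z)` followed by a swap of components exchange `D_S(α)+k` with
its adjoint (`rank_ker_opDSadj`), so `ker H(α,k)` has dimension `2m`. As nonzero eigenvalues stay
away from `0` (`exists_spectral_gap`), precisely `E_{±1}, …, E_{±m}` vanish at each `k`. -/

noncomputable section

namespace ScalarModel

/-! ### The theta function of `Λ` -/

/-- The nome `q = e^{2πiω}`. -/
def nome : ℂ := Complex.exp (2 * Real.pi * Complex.I * omega)

lemma norm_nome_lt_one : ‖nome‖ < 1 := by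
  rw [nome, Complex.norm_exp]
  have : (2 * (Real.pi : ℂ) * Complex.I * omega).re = -(2 * Real.pi * omega.im) := by simp
  rw [this, Real.exp_lt_one_iff]
  have := mul_pos Real.two_pi_pos omega_im_pos
  linarith

lemma nome_ne_zero : nome ≠ 0 := Complex.exp_ne_zero _

/-- The infinite product `∏_{n ≥ 0} (1 - q^n x)`. -/
def qPoch (x : ℂ) : ℂ := ∏' n : ℕ, (1 + -(nome ^ n * x))

lemma summable_norm_nome_pow_mul (x : ℂ) : Summable fun n : ℕ => ‖-(nome ^ n * x)‖ := by
  simp only [norm_neg, norm_mul, norm_pow]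
  exact (summable_geometric_of_lt_one (norm_nonneg _) norm_nome_lt_one).mul_right _

lemma multipliable_qPoch (x : ℂ) : Multipliable fun n : ℕ => 1 + -(nome ^ n * x) :=
  multipliable_one_add_of_summable (summable_norm_nome_pow_mul x)

lemma differentiable_qPoch : Differentiable ℂ qPoch := by
  have h : HasProdLocallyUniformlyOn (fun (n : ℕ) (x : ℂ) => 1 + -(nome ^ n * x)) qPoch univ := by
    apply hasProdLocallyUniformlyOn_of_forall_compact isOpen_univ
    intro K _ hcK
    obtain ⟨C, hC⟩ := hcK.exists_bound_of_continuousOn (f := fun x : ℂ => x) continuousOn_id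
    refine ((summable_geometric_of_lt_one (norm_nonneg _) norm_nome_lt_one).mul_right
      C).hasProdUniformlyOn_nat_one_add hcK (.of_forall fun n x hx => ?_) (fun _ => by fun_prop)
    rw [norm_neg, norm_mul, norm_pow]
    exact mul_le_mul_of_nonneg_left (hC x hx) (by positivity)
  rw [← differentiableOn_univ]
  exact h.differentiableOn (.of_forall fun _ => by
    simpa [Finset.prod_fn] using DifferentiableOn.finsetProd (fun _ _ => by fun_prop)) isOpen_univ

/-- Splitting off the factor `n = 0`. This functional equation under `x ↦ q x` is the source of the
quasi-periodicity of `theta` in the direction `ω`. -/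
lemma qPoch_eq (x : ℂ) : qPoch x = (1 - x) * qPoch (nome * x) := by
  unfold qPoch
  rw [tprod_eq_zero_mul' (f := fun n : ℕ => 1 + -(nome ^ n * x))]
  · simp only [pow_zero, one_mul, pow_succ, mul_assoc]; ring_nf
  · simpa only [pow_succ, mul_assoc] using multipliable_qPoch (nome * x)

lemma qPoch_ne_zero {x : ℂ} (hx : ∀ n : ℕ, nome ^ n * x ≠ 1) : qPoch x ≠ 0 :=
  tprod_one_add_ne_zero_of_summable
    (fun n h => hx n (by linear_combination -h)) (summable_norm_nome_pow_mul x)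

/-- The theta function with simple zeros exactly on `Λ`. -/
def theta (z : ℂ) : ℂ :=
  qPoch (Complex.exp (2 * Real.pi * Complex.I * z)) *
    qPoch (nome * Complex.exp (-(2 * Real.pi * Complex.I * z)))

lemma differentiable_theta : Differentiable ℂ theta := by
  unfold theta
  exact (differentiable_qPoch.comp (by fun_prop)).mul (differentiable_qPoch.comp (by fun_prop))

lemma theta_add_one (z : ℂ) : theta (z + 1) = theta z := by
  have h : Complex.exp (2 * Real.pi * Complex.I * (z + 1)) =
      Complex.exp (2 * Real.pi * Complex.I * z) := by
    rw [mul_add, Complex.exp_add, mul_one, Complex.exp_two_pi_mul_I, mul_one]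
  unfold theta
  rw [Complex.exp_neg, Complex.exp_neg, h]

/-- With `x = e^{2πiz}`, the translation by `ω` is `x ↦ q x`; the first product loses the factor `1
- x`, the second gains `1 - x⁻¹`, and the ratio of the two is `-x⁻¹`. -/
lemma theta_add_omega (z : ℂ) :
    theta (z + omega) = -Complex.exp (-(2 * Real.pi * Complex.I * z)) * theta z := by
  have h : Complex.exp (2 * Real.pi * Complex.I * (z + omega)) =
      nome * Complex.exp (2 * Real.pi * Complex.I * z) := by
    rw [mul_add, Complex.exp_add, nome, mul_comm]
  unfold theta
  rw [Complex.exp_neg, Complex.exp_neg, h]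
  have hx : Complex.exp (2 * Real.pi * Complex.I * z) ≠ 0 := Complex.exp_ne_zero _
  set x := Complex.exp (2 * Real.pi * Complex.I * z)
  have hq := nome_ne_zero
  have e : nome * (nome * x)⁻¹ = x⁻¹ := by field_simp
  rw [e, qPoch_eq x, qPoch_eq x⁻¹]
  field_simp
  ring

lemma theta_zero : theta 0 = 0 := by
  simp [theta, qPoch_eq 1]

lemma theta_eq_zero {z : ℂ} (h : theta z = 0) : ∃ m n : ℤ, z = m + n * omega := by
  have key : ∃ n : ℤ, Complex.exp (2 * Real.pi * Complex.I * (z + n * omega)) = 1 := by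
    have e : ∀ n : ℤ, Complex.exp (2 * Real.pi * Complex.I * (z + n * omega)) =
        nome ^ n * Complex.exp (2 * Real.pi * Complex.I * z) := by
      intro n
      rw [nome, ← Complex.exp_int_mul, ← Complex.exp_add]
      congr 1; ring
    rcases mul_eq_zero.1 h with h | h
    · by_contra! hn
      exact qPoch_ne_zero (fun n => by rw [← zpow_natCast, ← e]; exact hn n) h
    · by_contra! hn
      refine qPoch_ne_zero (fun n hc => ?_) h
      -- The second product is evaluated at `q x⁻¹`, so its `n`-th factor vanishes when `x =
      -- q^{n+1}`.
      refine hn (-(n + 1 : ℤ)) ?_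
      have hx : Complex.exp (2 * Real.pi * Complex.I * z) ≠ 0 := Complex.exp_ne_zero _
      have hq := nome_ne_zero
      rw [e, zpow_neg, ← Nat.cast_succ, zpow_natCast, pow_succ]
      rw [Complex.exp_neg] at hc
      field_simp at hc ⊢
      exact hc.symm
  obtain ⟨n, hn⟩ := key
  obtain ⟨m, hm⟩ := Complex.exp_eq_one_iff.1 hn
  refine ⟨m, -n, ?_⟩
  have : z + n * omega = m := by
    have h2 : (2 * Real.pi * Complex.I : ℂ) ≠ 0 := Complex.two_pi_I_ne_zero
    apply mul_left_cancel₀ h2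
    rw [hm]; ring
  push_cast
  linear_combination this

/-- The zero at `0` comes from the single factor `1 - x`; at `x = 1` the remaining product is `qPoch
nome ^ 2`, nonzero because `|q^{n+1}| < 1`. -/
lemma deriv_theta_zero : deriv theta 0 ≠ 0 := by
  have h : ∀ z, theta z = (1 - Complex.exp (2 * Real.pi * Complex.I * z)) *
      (qPoch (nome * Complex.exp (2 * Real.pi * Complex.I * z)) *
    qPoch (nome * Complex.exp (-(2 * Real.pi * Complex.I * z)))) := by
    intro z
    unfold theta
    rw [qPoch_eq (Complex.exp _)]; ring
  have hd : HasDerivAt (fun z : ℂ => 1 - Complex.exp (2 * Real.pi * Complex.I * z))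
      (-(2 * Real.pi * Complex.I)) 0 := by
    have := ((hasDerivAt_id (0 : ℂ)).const_mul (2 * Real.pi * Complex.I)).cexp.const_sub 1
    simpa using this
  have hg : DifferentiableAt ℂ (fun z : ℂ =>
      qPoch (nome * Complex.exp (2 * Real.pi * Complex.I * z)) *
      qPoch (nome * Complex.exp (-(2 * Real.pi * Complex.I * z)))) 0 :=
    ((differentiable_qPoch.comp (by fun_prop)).mul
      (differentiable_qPoch.comp (by fun_prop))) 0
  have := hd.mul hg.hasDerivAt
  rw [funext h, show (fun z => (1 - Complex.exp (2 * Real.pi * Complex.I * z)) *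
      (qPoch (nome * Complex.exp (2 * Real.pi * Complex.I * z)) *
    qPoch (nome * Complex.exp (-(2 * Real.pi * Complex.I * z))))) = _ from rfl]
  erw [this.deriv]
  have hne : qPoch nome ≠ 0 := by
    refine qPoch_ne_zero fun n hn => ?_
    have h1 : ‖nome ^ n * nome‖ < 1 := by
      rw [← pow_succ, norm_pow]
      exact pow_lt_one₀ (norm_nonneg _) norm_nome_lt_one (by simp)
    rw [hn, norm_one] at h1
    exact lt_irrefl _ h1
  simp [hne, Real.pi_ne_zero]

/-! ### Quasi-periodicity -/

/-- A property of pairs of lattice translations follows from the generators. -/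
lemma lattice_induction {p : ℂ → Prop} (h0 : p 0) (h1 : ∀ γ, p γ → p (γ + 1))
    (h1' : ∀ γ, p γ → p (γ - 1)) (h2 : ∀ γ, p γ → p (γ + omega))
    (h2' : ∀ γ, p γ → p (γ - omega)) (m n : ℤ) : p (m + n * omega) := by
  have hm : ∀ m : ℤ, p m := by
    intro m
    induction m using Int.induction_on with
    | zero => simpa using h0
    | succ i ih => simpa using h1 _ ih
    | pred i ih => simpa using h1' _ ih
  induction n using Int.induction_on with
  | zero => simpa using hm m
  | succ i ih =>
    have := h2 _ ih
    push_cast at this ⊢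
    rwa [show (m : ℂ) + (i + 1) * omega = m + i * omega + omega by ring]
  | pred i ih =>
    have := h2' _ ih
    push_cast at this ⊢
    rwa [show (m : ℂ) + (-i - 1) * omega = m + -i * omega - omega by ring]

/-- `f` is multiplied by `a` under `z ↦ z + 1` and by `b e^{2πiNz}` under `z ↦ z + ω`. -/
def IsQuasiPeriodic {E : Type*} [SMul ℂ E] (N : ℤ) (a b : ℂ) (f : ℂ → E) : Prop :=
  (∀ z, f (z + 1) = a • f z) ∧
    ∀ z, f (z + omega) = (b * Complex.exp (2 * Real.pi * Complex.I * N * z)) • f z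

/-- The multiplier of an arbitrary lattice translation is the exponential of an affine function,
hence never zero; this carries zeros and their orders from one point to its whole class modulo `Λ`.
-/
lemma IsQuasiPeriodic.exists_exp {E : Type*} [AddCommGroup E] [Module ℂ E] {N : ℤ} {a b : ℂ}
    (ha : a ≠ 0) (hb : b ≠ 0) {f : ℂ → E} (hf : IsQuasiPeriodic N a b f) (m n : ℤ) :
    ∃ A B : ℂ, ∀ z, f (z + (m + n * omega)) = Complex.exp (A * z + B) • f z := by
  obtain ⟨a', rfl⟩ : ∃ a', a = Complex.exp a' := ⟨_, (Complex.exp_log ha).symm⟩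
  obtain ⟨b', rfl⟩ : ∃ b', b = Complex.exp b' := ⟨_, (Complex.exp_log hb).symm⟩
  obtain ⟨h1, h2⟩ := hf
  refine lattice_induction
    (p := fun γ => ∃ A B : ℂ, ∀ z, f (z + γ) = Complex.exp (A * z + B) • f z) ?_ ?_ ?_ ?_ ?_ m n
  · exact ⟨0, 0, fun z => by simp⟩
  · rintro γ ⟨A, B, h⟩
    refine ⟨A, B + a', fun z => ?_⟩
    rw [← add_assoc, h1, h, smul_smul, ← Complex.exp_add]
    congr 2; ring
  · rintro γ ⟨A, B, h⟩
    refine ⟨A, B - a', fun z => ?_⟩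
    have := h1 (z + (γ - 1))
    rw [show z + (γ - 1) + 1 = z + γ by ring, h] at this
    rw [← sub_eq_zero]
    have e := congrArg (fun x => Complex.exp (-a') • x) this
    simp only [smul_smul, ← Complex.exp_add] at e
    rw [neg_add_cancel, Complex.exp_zero, one_smul] at e
    rw [← e, sub_eq_zero]
    congr 2; ring
  · rintro γ ⟨A, B, h⟩
    refine ⟨A + 2 * Real.pi * Complex.I * N, B + b' + 2 * Real.pi * Complex.I * N * γ,
      fun z => ?_⟩
    rw [← add_assoc, h2, h, smul_smul, ← Complex.exp_add, ← Complex.exp_add]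
    congr 2; ring
  · rintro γ ⟨A, B, h⟩
    refine ⟨A - 2 * Real.pi * Complex.I * N, B - b' - 2 * Real.pi * Complex.I * N * (γ - omega),
      fun z => ?_⟩
    have := h2 (z + (γ - omega))
    rw [show z + (γ - omega) + omega = z + γ by ring, h] at this
    have e := congrArg (fun x => Complex.exp
      (-(b' + 2 * Real.pi * Complex.I * N * (z + (γ - omega)))) • x) this
    simp only [smul_smul, ← Complex.exp_add] at e
    rw [neg_add_cancel, Complex.exp_zero, one_smul] at e
    rw [← e]
    congr 2; ring

lemma IsQuasiPeriodic.eq_zero_of_eq_zero {E : Type*} [AddCommGroup E] [Module ℂ E] {N : ℤ}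
    {a b : ℂ} (ha : a ≠ 0) (hb : b ≠ 0) {f : ℂ → E} (hf : IsQuasiPeriodic N a b f) {z : ℂ}
    (hz : f z = 0) (m n : ℤ) : f (z + (m + n * omega)) = 0 := by
  obtain ⟨A, B, h⟩ := hf.exists_exp ha hb m n
  rw [h, hz, smul_zero]

lemma IsQuasiPeriodic.smul {E : Type*} [AddCommGroup E] [Module ℂ E] {N N' : ℤ}
    {a b a' b' : ℂ} {h : ℂ → ℂ} {f : ℂ → E} (hh : IsQuasiPeriodic N a b h)
    (hf : IsQuasiPeriodic N' a' b' f) :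
    IsQuasiPeriodic (N + N') (a * a') (b * b') fun z => h z • f z := by
  refine ⟨fun z => ?_, fun z => ?_⟩
  · simp only [hh.1, hf.1, smul_eq_mul, smul_smul]; congr 1; ring
  · simp only [hh.2, hf.2, smul_eq_mul, smul_smul]; congr 1
    push_cast
    rw [mul_add (2 * (Real.pi : ℂ) * Complex.I) (N : ℂ) N', add_mul, Complex.exp_add]
    ring

lemma isQuasiPeriodic_exp (c : ℂ) : IsQuasiPeriodic 0 (Complex.exp c) (Complex.exp (c * omega))
    fun z => Complex.exp (c * z) := by
  refine ⟨fun z => ?_, fun z => ?_⟩ <;> simp [mul_add, Complex.exp_add, mul_comm]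

lemma isQuasiPeriodic_theta (P : ℂ) :
    IsQuasiPeriodic (-1) 1 (-Complex.exp (2 * Real.pi * Complex.I * P)) fun z => theta (z - P) := by
  refine ⟨fun z => ?_, fun z => ?_⟩
  · simp only []
    rw [one_smul, ← theta_add_one (z - P)]; congr 1; ring
  · simp only []
    rw [show z + omega - P = z - P + omega by ring, theta_add_omega, smul_eq_mul,
      neg_mul (Complex.exp (2 * Real.pi * Complex.I * P)), ← Complex.exp_add]
    congr 3; push_cast; ring

lemma deriv_theta_ne_zero {z : ℂ} (h : theta z = 0) : deriv theta z ≠ 0 := by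
  obtain ⟨m, n, rfl⟩ := theta_eq_zero h
  have hq := isQuasiPeriodic_theta 0
  simp only [sub_zero] at hq
  obtain ⟨A, B, hAB⟩ := hq.exists_exp one_ne_zero (by simp) m n
  have e : deriv theta (m + n * omega) = deriv (fun z => theta (z + (m + n * omega))) 0 := by
    rw [deriv_comp_add_const, zero_add]
  rw [e, funext hAB]
  have h1 : HasDerivAt (fun z : ℂ => Complex.exp (A * z + B))
      (Complex.exp (A * 0 + B) * (A * 1)) 0 :=
    (((hasDerivAt_id (0 : ℂ)).const_mul A).add_const B).cexp
  have := h1.smul (differentiable_theta 0).hasDerivAt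
  erw [this.deriv]
  simp [theta_zero, deriv_theta_zero]

/-- Near each point, `θ(z - P)` is nonzero or has a simple zero. -/
lemma theta_factor (P z₁ : ℂ) : theta (z₁ - P) ≠ 0 ∨ (theta (z₁ - P) = 0 ∧
    ∃ κ : ℂ → ℂ, Differentiable ℂ κ ∧ κ z₁ ≠ 0 ∧ ∀ z, theta (z - P) = (z - z₁) * κ z) := by
  by_cases h : theta (z₁ - P) = 0
  · refine Or.inr ⟨h, dslope (fun z => theta (z - P)) z₁, ?_, ?_, fun z => ?_⟩
    · have hd : Differentiable ℂ fun z => theta (z - P) := differentiable_theta.comp (by fun_prop)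
      rw [← differentiableOn_univ] at hd ⊢
      exact (Complex.differentiableOn_dslope Filter.univ_mem).2 hd
    · rw [dslope_same, deriv_comp_sub_const]
      exact deriv_theta_ne_zero h
    · have := sub_smul_dslope (fun z => theta (z - P)) z₁ z
      simp only [h, sub_zero, smul_eq_mul] at this
      exact this.symm
  · exact Or.inl h

lemma eventually_theta_ne_zero (P z₁ : ℂ) : ∀ᶠ z in nhdsWithin z₁ {z₁}ᶜ, theta (z - P) ≠ 0 := by
  rcases theta_factor P z₁ with h | ⟨-, κ, hκ, h0, h⟩
  · refine Filter.Eventually.filter_mono nhdsWithin_le_nhds ?_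
    have : ContinuousAt (fun z => theta (z - P)) z₁ :=
      (differentiable_theta.continuous.comp (by fun_prop)).continuousAt
    exact this.eventually_ne h
  · filter_upwards [nhdsWithin_le_nhds (hκ.continuous.continuousAt.eventually_ne h0),
      self_mem_nhdsWithin] with z hz hzz
    rw [h]
    exact mul_ne_zero (sub_ne_zero.2 hzz) hz

/-- Identities obtained by cancelling `θ(z - P)` hold off its zeros; this density extends them
everywhere by continuity. -/
lemma dense_theta_ne_zero (P : ℂ) : Dense {z | theta (z - P) ≠ 0} := by
  intro z₁
  rw [mem_closure_iff_frequently]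
  have : ∃ᶠ z in nhdsWithin z₁ {z₁}ᶜ, theta (z - P) ≠ 0 :=
    (eventually_theta_ne_zero P z₁).frequently
  exact this.filter_mono nhdsWithin_le_nhds

/-- Gluing of local quotients by a function with isolated zeros. -/
lemma exists_glued_quotient {E : Type*} [AddCommGroup E] [Module ℂ E] (D : (ℂ → E) → ℂ → Prop)
    {t : ℂ → ℂ} {h : ℂ → E} (ht : ∀ z₁, ∀ᶠ z in nhdsWithin z₁ {z₁}ᶜ, t z ≠ 0)
    (hloc : ∀ z₁, ∃ ρ : ℂ → E, D ρ z₁ ∧ ∀ᶠ z in nhds z₁, h z = t z • ρ z) :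
    ∃ g : ℂ → E, (∀ z₁, ∃ ρ, D ρ z₁ ∧ g =ᶠ[nhds z₁] ρ) ∧ ∀ z, h z = t z • g z := by
  choose ρ hD hρ using hloc
  -- The value at `z` is taken from the local quotient centred at `z`; near `z₁` it agrees with `ρ
  -- z₁`, since `t ≠ 0` there except perhaps at `z₁` itself.
  refine ⟨fun z => ρ z z, fun z₁ => ⟨ρ z₁, hD z₁, ?_⟩, fun z => (hρ z).self_of_nhds⟩
  have := ht z₁
  rw [eventually_nhdsWithin_iff] at this
  filter_upwards [this, hρ z₁] with z h1 h2
  by_cases hz : z = z₁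
  · rw [hz]
  · have h3 := (hρ z).self_of_nhds
    rw [h2] at h3
    have h4 := congrArg (fun x => (t z)⁻¹ • x) h3
    simpa [smul_smul, h1 hz] using h4.symm

/-! ### Spaces of theta functions -/

/-- Entire functions with `h(z+1) = a h(z)` and `h(z+ω) = b e^{2πiNz} h(z)`. -/
def Theta (N : ℤ) (a b : ℂ) : Submodule ℂ (ℂ → ℂ) where
  carrier := {h | Differentiable ℂ h ∧ IsQuasiPeriodic N a b h}
  zero_mem' := ⟨differentiable_const _, fun z => by simp, fun z => by simp⟩
  add_mem' := by
    rintro f g ⟨hf, hf1, hf2⟩ ⟨hg, hg1, hg2⟩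
    exact ⟨hf.add hg, fun z => by simp [hf1, hg1, mul_add], fun z => by simp [hf2, hg2, mul_add]⟩
  smul_mem' := by
    rintro c f ⟨hf, hf1, hf2⟩
    exact ⟨hf.const_smul c, fun z => by simp [hf1, mul_left_comm],
      fun z => by simp [hf2, mul_left_comm]⟩

/-- Every point is equivalent to one of the fundamental parallelogram. -/
lemma exists_add_mem_cell (z : ℂ) : ∃ m n : ℤ, z + (m + n * omega) ∈ cell := by
  refine ⟨-⌊coordS z⌋, -⌊coordT z⌋, ?_⟩
  rw [mem_cell_iff, (coord_add _ _ _).1, (coord_add _ _ _).2]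
  push_cast
  refine ⟨⟨?_, ?_⟩, ?_, ?_⟩
  · linarith [Int.floor_le (coordS z)]
  · linarith [Int.lt_floor_add_one (coordS z)]
  · linarith [Int.floor_le (coordT z)]
  · linarith [Int.lt_floor_add_one (coordT z)]

lemma IsPeriodic.exists_bound {E : Type*} [SeminormedAddCommGroup E] {f : ℂ → E}
    (hf : IsPeriodic f) (hc : Continuous f) : ∃ C, ∀ z, ‖f z‖ ≤ C := by
  obtain ⟨C, hC⟩ := (isCompact_closedBall (0 : ℂ) 2).exists_bound_of_continuousOn hc.continuousOn
  refine ⟨C, fun z => ?_⟩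
  obtain ⟨m, n, h⟩ := exists_add_mem_cell z
  rw [← hf m n z]
  exact hC _ (cell_subset h)

lemma isPeriodic_of_generators {E : Type*} {f : ℂ → E} (h1 : ∀ z, f (z + 1) = f z)
    (h2 : ∀ z, f (z + omega) = f z) : IsPeriodic f := by
  intro m n
  refine lattice_induction (p := fun γ => ∀ z, f (z + γ) = f z) ?_ ?_ ?_ ?_ ?_ m n
  · simp
  · intro γ h z; rw [← add_assoc, h1, h]
  · intro γ h z; rw [← h1, show z + (γ - 1) + 1 = z + γ by ring, h]
  · intro γ h z; rw [← add_assoc, h2, h]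
  · intro γ h z; rw [← h2, show z + (γ - omega) + omega = z + γ by ring, h]

/-- Theta functions of degree `0` are exponentials. -/
lemma Theta_zero_eq_exp {a b : ℂ} (ha : a ≠ 0) (hb : b ≠ 0) {h : ℂ → ℂ} (hh : h ∈ Theta 0 a b) :
    ∃ c C : ℂ, ∀ z, h z = C * Complex.exp (c * z) := by
  obtain ⟨hd, h1, h2⟩ := hh
  -- `c` is chosen so that `|e^c| = |a|` and `|e^{cω}| = |b|`. Then `|h e^{-cz}|` is periodic, hence
  -- bounded, and Liouville's theorem applies.
  set y : ℝ := (Real.log ‖b‖ - Real.log ‖a‖ * omega.re) / omega.im with hy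
  set c : ℂ := Real.log ‖a‖ - y * Complex.I with hc
  have hp := omega_im_pos.ne'
  have c1 : (c * 1).re = Real.log ‖a‖ := by simp [hc]
  have c2 : (c * omega).re = Real.log ‖b‖ := by
    simp [hc, hy]; field_simp; ring
  set g : ℂ → ℂ := fun z => h z * Complex.exp (-(c * z)) with hg
  have hper : IsPeriodic fun z => ‖g z‖ := by
    apply isPeriodic_of_generators
    · intro z
      simp only [hg, h1, mul_add, neg_add, Complex.exp_add, norm_mul, smul_eq_mul,
        Complex.norm_exp (-(c * 1)), Complex.neg_re, c1, Real.exp_neg,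
        Real.exp_log (norm_pos_iff.2 ha)]
      have := norm_ne_zero_iff.2 ha
      field_simp
    · intro z
      simp only [hg, h2, mul_add, neg_add, Complex.exp_add, norm_mul, smul_eq_mul,
        Complex.norm_exp (-(c * omega)), Complex.neg_re, c2, Real.exp_neg,
        Real.exp_log (norm_pos_iff.2 hb)]
      have := norm_ne_zero_iff.2 hb
      simp
      field_simp
  have hgd : Differentiable ℂ g := hd.mul (by fun_prop)
  obtain ⟨C, hC⟩ := hper.exists_bound hgd.continuous.norm
  refine ⟨c, g 0, fun z => ?_⟩
  have hb : Bornology.IsBounded (range g) := by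
    rw [isBounded_iff_forall_norm_le]
    exact ⟨C, by rintro _ ⟨z, rfl⟩; simpa using hC z⟩
  rw [← hgd.apply_eq_apply_of_bounded hb z 0, hg]
  simp only []
  rw [mul_assoc, ← Complex.exp_add]
  simp

/-- A nonzero such function would be `C e^{cz}`, whose multipliers are `e^c` and `e^{cω}`. -/
lemma Theta_zero_eq_zero {a b : ℂ} (ha : a ≠ 0) (hb : b ≠ 0)
    (hab : ∀ c, a = Complex.exp c → b ≠ Complex.exp (c * omega)) {h : ℂ → ℂ}
    (hh : h ∈ Theta 0 a b) : h = 0 := by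
  obtain ⟨c, C, hcC⟩ := Theta_zero_eq_exp ha hb hh
  by_cases hC : C = 0
  · ext z; simp [hcC, hC]
  exfalso
  have h1 := hh.2.1 0
  have h2 := hh.2.2 0
  simp [hcC] at h1 h2
  refine hab c ?_ ?_
  · exact mul_left_cancel₀ hC (by rw [h1]; ring)
  · exact mul_left_cancel₀ hC (by rw [h2]; ring)

lemma Theta_congr {N N' : ℤ} {a b a' b' : ℂ} (hN : N = N') (ha : a = a') (hb : b = b')
    {h : ℂ → ℂ} (hh : h ∈ Theta N a b) : h ∈ Theta N' a' b' := by
  subst hN ha hb; exact hh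

lemma mul_mem_Theta {N N' : ℤ} {a b a' b' : ℂ} {h h' : ℂ → ℂ} (hh : h ∈ Theta N a b)
    (hh' : h' ∈ Theta N' a' b') : (fun z => h z * h' z) ∈ Theta (N + N') (a * a') (b * b') :=
  ⟨hh.1.mul hh'.1, hh.2.smul hh'.2⟩

lemma theta_mem_Theta (P : ℂ) :
    (fun z => theta (z - P)) ∈ Theta (-1) 1 (-Complex.exp (2 * Real.pi * Complex.I * P)) :=
  ⟨differentiable_theta.comp (by fun_prop), isQuasiPeriodic_theta P⟩

lemma one_mem_Theta : (fun _ => 1 : ℂ → ℂ) ∈ Theta 0 1 1 :=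
  ⟨differentiable_const _, fun z => by simp, fun z => by simp⟩

lemma exists_theta_pow (P : ℂ) (n : ℕ) : ∃ b : ℂ, b ≠ 0 ∧
    (fun z => theta (z - P) ^ n) ∈ Theta (-n) 1 b := by
  induction n with
  | zero => exact ⟨1, one_ne_zero, by simpa using one_mem_Theta⟩
  | succ n ih =>
    obtain ⟨b, hb, h⟩ := ih
    refine ⟨_, mul_ne_zero hb (neg_ne_zero.2 (Complex.exp_ne_zero (2 * Real.pi * Complex.I * P))),
      ?_⟩
    have := mul_mem_Theta h (theta_mem_Theta P)
    simpa [pow_succ, add_comm] using this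

/-- There are no theta functions of negative degree. -/
lemma Theta_eq_zero_of_neg {a b : ℂ} (ha : a ≠ 0) (hb : b ≠ 0) {m : ℕ} (hm : m ≠ 0) {h : ℂ → ℂ}
    (hh : h ∈ Theta m a b) : h = 0 := by
  obtain ⟨b', hb', ht⟩ := exists_theta_pow 0 m
  -- `h θ^m` has index `0`, so it is `C e^{cz}`; the zero of `θ` at `0` forces `C = 0`.
  have := mul_mem_Theta hh ht
  rw [add_neg_cancel, mul_one] at this
  obtain ⟨c, C, hcC⟩ := Theta_zero_eq_exp ha (mul_ne_zero hb hb') this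
  have hC : C = 0 := by
    have := hcC 0
    simpa [theta_zero, hm] using this.symm
  apply hh.1.continuous.ext_on (dense_theta_ne_zero 0) continuous_const
  intro z hz
  have h2 := hcC z
  rw [hC, zero_mul, mul_eq_zero] at h2
  exact h2.resolve_right (pow_ne_zero _ hz)

/-- Division of a quasi-periodic function by a theta function. -/
lemma IsQuasiPeriodic.of_theta_smul {E : Type*} [NormedAddCommGroup E] [NormedSpace ℂ E] {N : ℤ}
    {a b P : ℂ} {f g : ℂ → E} (hf : IsQuasiPeriodic N a b f) (hg : Continuous g)
    (hfg : ∀ z, f z = theta (z - P) • g z) :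
    IsQuasiPeriodic (N + 1) a (-(b * Complex.exp (-(2 * Real.pi * Complex.I * P)))) g := by
  constructor
  · refine congrFun (Continuous.ext_on (dense_theta_ne_zero P) (by fun_prop) (by fun_prop) ?_)
    intro z hz
    have h1 := hf.1 z
    have h2 := (isQuasiPeriodic_theta P).1 z
    simp only [one_smul] at h2
    rw [hfg, hfg, h2, smul_comm] at h1
    exact smul_right_injective E hz h1
  · refine congrFun (Continuous.ext_on (dense_theta_ne_zero P) (by fun_prop) (by fun_prop) ?_)
    intro z hz
    have h1 := hf.2 z
    have h2 := (isQuasiPeriodic_theta P).2 z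
    simp only [] at h2
    have hE := Complex.exp_ne_zero (2 * Real.pi * Complex.I * P)
    have hE2 := Complex.exp_ne_zero (2 * Real.pi * Complex.I * ((-1 : ℤ) : ℂ) * z)
    have hne : -Complex.exp (2 * Real.pi * Complex.I * P) *
        Complex.exp (2 * Real.pi * Complex.I * ((-1 : ℤ) : ℂ) * z) * theta (z - P) ≠ 0 :=
      mul_ne_zero (mul_ne_zero (neg_ne_zero.2 hE) hE2) hz
    rw [hfg, hfg, h2, smul_smul, smul_eq_mul] at h1
    apply smul_right_injective E hne
    simp only []
    rw [h1, smul_smul]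
    congr 1
    have e : Complex.exp (2 * Real.pi * Complex.I * N * z) =
        Complex.exp (2 * Real.pi * Complex.I * ((-1 : ℤ) : ℂ) * z) *
          Complex.exp (2 * Real.pi * Complex.I * ((N + 1 : ℤ) : ℂ) * z) := by
      rw [← Complex.exp_add]; congr 1; push_cast; ring
    rw [e, Complex.exp_neg]
    field_simp

/-- A theta function vanishing at `P` is divisible by `θ(z - P)`. -/
lemma exists_theta_quotient {N : ℤ} {a b P : ℂ} (ha : a ≠ 0) (hb : b ≠ 0) {h : ℂ → ℂ}
    (hh : h ∈ Theta N a b) (hP : h P = 0) :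
    ∃ g ∈ Theta (N + 1) a (-(b * Complex.exp (-(2 * Real.pi * Complex.I * P)))),
      ∀ z, h z = theta (z - P) * g z := by
  obtain ⟨g, hg, hgh⟩ := exists_glued_quotient (t := fun z => theta (z - P)) (h := h)
    (fun ρ z₁ => DifferentiableAt ℂ ρ z₁) (eventually_theta_ne_zero P) (by
      intro z₁
      rcases theta_factor P z₁ with h0 | ⟨h0, κ, hκ, hκ0, hfac⟩
      · have hcont : Continuous fun z => theta (z - P) :=
          differentiable_theta.continuous.comp (by fun_prop)
        refine ⟨fun z => h z / theta (z - P), (hh.1 z₁).div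
          ((differentiable_theta.comp (by fun_prop)) z₁) h0, ?_⟩
        filter_upwards [hcont.continuousAt.eventually_ne h0] with z hz
        rw [smul_eq_mul]; field_simp
      · obtain ⟨m, n, hmn⟩ := theta_eq_zero h0
        have hz₁ : h z₁ = 0 := by
          have := hh.2.eq_zero_of_eq_zero ha hb hP m n
          rwa [← hmn, add_sub_cancel] at this
        have hdd : Differentiable ℂ (dslope h z₁) := by
          have hd := hh.1
          rw [← differentiableOn_univ] at hd ⊢
          exact (Complex.differentiableOn_dslope Filter.univ_mem).2 hd
        refine ⟨fun z => dslope h z₁ z / κ z, (hdd z₁).div (hκ z₁) hκ0, ?_⟩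
        filter_upwards [hκ.continuous.continuousAt.eventually_ne hκ0] with z hz
        have := sub_smul_dslope h z₁ z
        rw [hz₁, sub_zero] at this
        rw [← this, hfac, smul_eq_mul, smul_eq_mul]
        field_simp)
  have hgd : Differentiable ℂ g := fun z₁ => by
    obtain ⟨ρ, hρ, he⟩ := hg z₁
    exact hρ.congr_of_eventuallyEq he
  exact ⟨g, ⟨hgd, hh.2.of_theta_smul hgd.continuous hgh⟩, hgh⟩

/-- There are nonzero theta functions of each positive degree. -/
lemma exists_ne_zero_mem_Theta {a b : ℂ} (ha : a ≠ 0) (hb : b ≠ 0) {n : ℕ} (hn : n ≠ 0) :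
    ∃ h ∈ Theta (-n) a b, h ≠ 0 := by
  obtain ⟨n, rfl⟩ : ∃ k, n = k + 1 := ⟨n - 1, by omega⟩
  obtain ⟨b', hb', ht⟩ := exists_theta_pow 0 n
  obtain ⟨c, rfl⟩ : ∃ a', a = Complex.exp a' := ⟨_, (Complex.exp_log ha).symm⟩
  -- The candidate is `e^{cz} θ(z - R) θ(z)^n`. Its multiplier along `1` is `a`, and along `ω` it
  -- has the constant `-e^{2πiR} e^{cω} b'`; the free parameter `R` is solved for so that this
  -- equals `b`.
  set d := b / (b' * -Complex.exp (c * omega)) with hd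
  have hE := Complex.exp_ne_zero (c * omega)
  have hd0 : d ≠ 0 := div_ne_zero hb (mul_ne_zero hb' (neg_ne_zero.2 hE))
  set R := Complex.log d / (2 * Real.pi * Complex.I) with hR
  have hR' : Complex.exp (2 * Real.pi * Complex.I * R) = d := by
    rw [hR, mul_div_cancel₀ _ Complex.two_pi_I_ne_zero, Complex.exp_log hd0]
  have hexp : (fun z => Complex.exp (c * z)) ∈ Theta 0 (Complex.exp c) (Complex.exp (c * omega)) :=
    ⟨by fun_prop, isQuasiPeriodic_exp c⟩
  have := mul_mem_Theta (mul_mem_Theta hexp (theta_mem_Theta R)) ht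
  refine ⟨_, Theta_congr ?_ ?_ ?_ this, ?_⟩
  · push_cast; ring
  · ring
  · rw [hR', hd]; field_simp
  · intro h0
    obtain ⟨z, hz⟩ : ∃ z, theta (z - 0) ≠ 0 ∧ theta (z - R) ≠ 0 := by
      have h1 := eventually_theta_ne_zero 0 0
      have h2 := eventually_theta_ne_zero R 0
      exact (h1.and h2).exists
    have := congrFun h0 z
    simp [hz.2] at this
    exact (by simpa using hz.1 : theta z ≠ 0) this.1

/-- One of two multipliers differing by a sign has no theta function of degree `0`. -/
lemma exists_sign_generic (a b : ℂ) : ∃ P : ℂ, ∀ c, a = Complex.exp c →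
    -(b * Complex.exp (-(2 * Real.pi * Complex.I * P))) ≠ Complex.exp (c * omega) := by
  by_contra! hcon
  obtain ⟨c, hc, h1⟩ := hcon 0
  obtain ⟨c', hc', h2⟩ := hcon (1 / 2)
  rw [hc, Complex.exp_eq_exp_iff_exists_int] at hc'
  obtain ⟨n, hn⟩ := hc'
  have e : Complex.exp (-(2 * Real.pi * Complex.I * (1 / 2))) = -1 := by
    rw [show (-(2 * Real.pi * Complex.I * (1 / 2)) : ℂ) = -(Real.pi * Complex.I) by ring,
      Complex.exp_neg, Complex.exp_pi_mul_I]; norm_num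
  rw [e] at h2
  simp only [mul_zero, neg_zero, Complex.exp_zero, mul_one, mul_neg, neg_neg] at h1 h2
  have h3 : Complex.exp (c * omega) = -Complex.exp (c' * omega) := by rw [← h1, ← h2]
  -- The two exponents differ by `2πi n`, so the opposite signs give `e^{2πi n ω} = -1`. Taking
  -- moduli gives `n = 0`, as `ω` is not real, and then `1 = -1`.
  have h4 : Complex.exp (n * (2 * Real.pi * Complex.I) * omega) = -1 := by
    have : Complex.exp (c * omega) =
        Complex.exp (c' * omega) * Complex.exp (n * (2 * Real.pi * Complex.I) * omega) := by
      rw [← Complex.exp_add, hn]; congr 1; ring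
    rw [h3] at this
    exact mul_left_cancel₀ (Complex.exp_ne_zero (c' * omega)) (by rw [← this]; ring)
  have h5 := congrArg norm h4
  rw [Complex.norm_exp, norm_neg, norm_one, Real.exp_eq_one_iff] at h5
  simp [omega_im_pos.ne', Real.pi_ne_zero] at h5
  rw [h5] at h4
  norm_num at h4

/-- The space of theta functions of degree `n ≥ 1` has dimension `n`. -/
lemma finrank_Theta {a b : ℂ} (ha : a ≠ 0) (hb : b ≠ 0) {n : ℕ} (hn : n ≠ 0) :
    Module.Finite ℂ (Theta (-n) a b) ∧ Module.finrank ℂ (Theta (-n) a b) = n := by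
  suffices H : Module.rank ℂ (Theta (-n) a b) = n by
    have hfin : Module.Finite ℂ (Theta (-n) a b) := by
      rw [← Module.rank_lt_aleph0_iff, H]; exact Cardinal.natCast_lt_aleph0
    exact ⟨hfin, by rw [Module.finrank, H, Cardinal.toNat_natCast]⟩
  obtain ⟨n, rfl⟩ : ∃ k, n = k + 1 := ⟨n - 1, by omega⟩
  clear hn
  induction n generalizing b with
  | zero =>
    -- For this `P`, a function vanishing at `P` has a quotient by `θ(z - P)` of index `0` with
    -- non-exponential multipliers, hence `0`. Evaluation at `P` is therefore injective.
    obtain ⟨P, hP⟩ := exists_sign_generic a b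
    have hb' : -(b * Complex.exp (-(2 * Real.pi * Complex.I * P))) ≠ 0 :=
      neg_ne_zero.2 (mul_ne_zero hb (Complex.exp_ne_zero _))
    have hker : ∀ h ∈ Theta (-(0 + 1 : ℕ)) a b, h P = 0 → h = 0 := by
      intro h hh h0
      obtain ⟨g, hg, hgh⟩ := exists_theta_quotient ha hb hh h0
      have : g = 0 := Theta_zero_eq_zero ha hb' hP (by simpa using hg)
      ext z
      simp [hgh, this]
    obtain ⟨h, hh, hne⟩ := exists_ne_zero_mem_Theta ha hb (n := 0 + 1) (by simp)
    have hhP : h P ≠ 0 := fun h0 => hne (hker h hh h0)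
    have hs : Module.rank ℂ (Theta (-(0 + 1 : ℕ)) a b) = 1 := by
      rw [rank_eq_one_iff]
      refine ⟨⟨h, hh⟩, fun h0 => hne (congrArg Subtype.val h0), fun g => ⟨g.1 P / h P, ?_⟩⟩
      have := hker (g.1 - (g.1 P / h P) • h) (Submodule.sub_mem _ g.2 (Submodule.smul_mem _ _ hh))
        (by simp [hhP])
      exact Subtype.ext (sub_eq_zero.1 this).symm
    simpa using hs
  | succ n ih =>
    obtain ⟨h, hh, hne⟩ := exists_ne_zero_mem_Theta ha hb (n := n + 1 + 1) (by simp)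
    obtain ⟨P, hP⟩ : ∃ P, h P ≠ 0 := by
      by_contra! h0; exact hne (funext h0)
    set b' := -(b * Complex.exp (-(2 * Real.pi * Complex.I * P))) with hb'
    have hb'0 : b' ≠ 0 := neg_ne_zero.2 (mul_ne_zero hb (Complex.exp_ne_zero _))
    let ev : Theta (-(n + 1 + 1 : ℕ)) a b →ₗ[ℂ] ℂ :=
      (LinearMap.proj P : (ℂ → ℂ) →ₗ[ℂ] ℂ) ∘ₗ Submodule.subtype _
    have hsurj : Function.Surjective ev := by
      intro y
      refine ⟨(y / h P) • ⟨h, hh⟩, ?_⟩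
      simp [ev, hP]
    -- The kernel of the evaluation at `P` is `θ(z - P)` times a theta space of degree one less,
    -- which gives the inductive step through rank-nullity.
    let mulθ : Theta (-(n + 1 : ℕ)) a b' →ₗ[ℂ] LinearMap.ker ev :=
      { toFun := fun g => ⟨⟨fun z => theta (z - P) * g.1 z, by
            refine Theta_congr ?_ (one_mul a) ?_ (mul_mem_Theta (theta_mem_Theta P) g.2)
            · push_cast; ring
            · rw [hb', Complex.exp_neg]
              have := Complex.exp_ne_zero (2 * Real.pi * Complex.I * P)
              field_simp⟩, by simp [ev, theta_zero]⟩
        map_add' := fun g g' => by ext z; simp [mul_add]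
        map_smul' := fun c g => by ext z; simp [mul_left_comm] }
    have hbij : Function.Bijective mulθ := by
      constructor
      · intro g g' hg
        apply Subtype.ext
        apply g.2.1.continuous.ext_on (dense_theta_ne_zero P) g'.2.1.continuous
        intro z hz
        exact mul_left_cancel₀ hz (congrFun (congrArg (fun x => x.1.1) hg) z)
      · rintro ⟨⟨f, hf⟩, hf0⟩
        obtain ⟨g, hg, hgf⟩ := exists_theta_quotient ha hb hf hf0
        refine ⟨⟨g, Theta_congr (by push_cast; ring) rfl rfl hg⟩, ?_⟩
        ext z
        exact (hgf z).symm
    have hk := (LinearEquiv.ofBijective mulθ hbij).rank_eq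
    rw [← LinearMap.rank_range_add_rank_ker ev, LinearMap.range_eq_top.2 hsurj, rank_top, ← hk, ih hb'0]
    simp [add_comm]

/-! ### Radial averages -/

/-- The radial average `∫₀¹ t^n f(tz) dt`. -/
def radialAvg {E : Type} [NormedAddCommGroup E] [NormedSpace ℝ E] (n : ℕ) (f : ℂ → E) (z : ℂ) : E :=
  ∫ t in (0 : ℝ)..1, t ^ n • f (t • z)

/-- Differentiation under the integral sign; the chain rule contributes one factor `t`, which raises
the weight `n` to `n + 1`. -/
lemma hasFDerivAt_radialAvg {E : Type} [NormedAddCommGroup E] [NormedSpace ℝ E]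
    (n : ℕ) {f : ℂ → E} (hf : ContDiff ℝ ∞ f) (z : ℂ) :
    HasFDerivAt (radialAvg n f) (radialAvg (n + 1) (fderiv ℝ f) z) z := by
  have hf' : Continuous (fderiv ℝ f) := hf.continuous_fderiv (by simp)
  obtain ⟨C, hC⟩ := (isCompact_closedBall (0 : ℂ) (‖z‖ + 1)).exists_bound_of_continuousOn
    hf'.continuousOn
  have hI : ∀ t ∈ uIoc (0 : ℝ) 1, 0 ≤ t ∧ t ≤ 1 := by
    intro t ht
    rw [uIoc_of_le zero_le_one] at ht
    exact ⟨ht.1.le, ht.2⟩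
  unfold radialAvg
  refine intervalIntegral.hasFDerivAt_integral_of_dominated_of_fderiv_le
    (F := fun x t => t ^ n • f (t • x)) (F' := fun x t => t ^ (n + 1) • fderiv ℝ f (t • x))
    (s := Metric.ball z 1) (bound := fun _ => C) (Metric.ball_mem_nhds z one_pos) ?_ ?_ ?_ ?_ ?_ ?_
  · exact Filter.Eventually.of_forall fun x =>
      (Continuous.aestronglyMeasurable (by have := hf.continuous; fun_prop))
  · exact Continuous.intervalIntegrable (by have := hf.continuous; fun_prop) _ _
  · exact Continuous.aestronglyMeasurable (by fun_prop)
  · refine Filter.Eventually.of_forall fun t ht x hx => ?_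
    obtain ⟨h0, h1⟩ := hI t ht
    have hx' : ‖x‖ ≤ ‖z‖ + 1 := by
      have := norm_sub_norm_le x z
      rw [Metric.mem_ball, dist_eq_norm] at hx
      linarith
    have hb : ‖fderiv ℝ f (t • x)‖ ≤ C := by
      apply hC
      rw [mem_closedBall_zero_iff, norm_smul, Real.norm_of_nonneg h0]
      nlinarith [norm_nonneg x]
    rw [norm_smul, norm_pow, Real.norm_of_nonneg h0]
    have := pow_le_one₀ h0 h1 (n := n + 1)
    nlinarith [norm_nonneg (fderiv ℝ f (t • x)), pow_nonneg h0 (n + 1)]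
  · exact intervalIntegrable_const
  · refine Filter.Eventually.of_forall fun t _ x _ => ?_
    have h1 : HasFDerivAt (fun x : ℂ => t • x) (t • ContinuousLinearMap.id ℝ ℂ) x :=
      (hasFDerivAt_id x).const_smul t
    have h2 := (hf.differentiable (by simp) (t • x)).hasFDerivAt.comp x h1
    have h3 := h2.const_smul (t ^ n)
    refine h3.congr_fderiv ?_
    ext v
    simp [pow_succ, mul_smul]

lemma contDiff_radialAvg {E : Type} [NormedAddCommGroup E] [NormedSpace ℝ E]
    (n : ℕ) {f : ℂ → E} (hf : ContDiff ℝ ∞ f) : ContDiff ℝ ∞ (radialAvg n f) := by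
  rw [contDiff_infty]
  intro k
  induction k generalizing E n with
  | zero =>
    rw [Nat.cast_zero, contDiff_zero]
    exact continuous_iff_continuousAt.2 fun z => (hasFDerivAt_radialAvg n hf z).continuousAt
  | succ k ih =>
    rw [Nat.cast_succ, contDiff_succ_iff_hasFDerivAt]
    exact ⟨_, ih (n + 1) (hf.fderiv_right (by simp)), fun z => hasFDerivAt_radialAvg n hf z⟩

/-! ### The functions `z̄^N / z^l` -/

lemma norm_conj_pow_div_pow_le {N l : ℕ} (h : l ≤ N) (z : ℂ) :
    ‖conj z ^ N / z ^ l‖ ≤ ‖z‖ ^ (N - l) := by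
  rw [norm_div, norm_pow, norm_pow, Complex.norm_conj]
  by_cases hz : ‖z‖ = 0
  · rw [hz]
    rcases Nat.eq_zero_or_pos l with rfl | hl
    · simp
    · rw [zero_pow hl.ne', div_zero]; positivity
  · rw [div_eq_mul_inv, ← pow_sub₀ _ hz h]

/-- The function is homogeneous of degree `N - l`, and its derivative is a combination of functions
of the same kind of degree one less. The hypothesis keeps this degree positive through `k`
derivatives, which is continuity at `0`. -/
lemma contDiff_conj_pow_div_pow (k : ℕ) {N l : ℕ} (h : l + k + 1 ≤ N) :
    ContDiff ℝ k fun z : ℂ => conj z ^ N / z ^ l := by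
  have hcont : ∀ {N l : ℕ}, l + 1 ≤ N → Continuous fun z : ℂ => conj z ^ N / z ^ l := by
    intro N l h
    rw [continuous_iff_continuousAt]
    intro z
    by_cases hz : z = 0
    · subst hz
      have h0 : conj (0 : ℂ) ^ N / 0 ^ l = 0 := by
        rw [map_zero, zero_pow (by omega), zero_div]
      rw [ContinuousAt, h0]
      refine squeeze_zero_norm (norm_conj_pow_div_pow_le (by omega)) ?_
      have : Continuous fun z : ℂ => ‖z‖ ^ (N - l) := by fun_prop
      have h1 := this.tendsto 0
      rwa [norm_zero, zero_pow (by omega)] at h1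
    · exact ContinuousAt.div (by fun_prop) (by fun_prop) (pow_ne_zero _ hz)
  induction k generalizing N l with
  | zero =>
    rw [Nat.cast_zero, contDiff_zero]
    exact hcont (by omega)
  | succ k ih =>
    rw [Nat.cast_succ, contDiff_succ_iff_hasFDerivAt]
    obtain ⟨N, rfl⟩ : ∃ M, N = M + 1 := ⟨N - 1, by omega⟩
    refine ⟨fun z => ((N + 1 : ℂ) * (conj z ^ N / z ^ l)) • Complex.conjCLE.toContinuousLinearMap -
      ((l : ℂ) * (conj z ^ (N + 1) / z ^ (l + 1))) • ContinuousLinearMap.id ℝ ℂ, ?_, fun z => ?_⟩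
    · exact ((contDiff_const.mul (ih (by omega))).smul contDiff_const).sub
        ((contDiff_const.mul (ih (by omega))).smul contDiff_const)
    · by_cases hz : z = 0
      · subst hz
        have e : ((N + 1 : ℂ) * (conj (0 : ℂ) ^ N / 0 ^ l)) •
            Complex.conjCLE.toContinuousLinearMap -
            ((l : ℂ) * (conj 0 ^ (N + 1) / 0 ^ (l + 1))) • ContinuousLinearMap.id ℝ ℂ = 0 := by
          rcases Nat.eq_zero_or_pos N with rfl | hN
          · omega
          · rw [map_zero, zero_pow hN.ne', zero_pow (Nat.succ_ne_zero N)]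
            ext v; simp
        -- At the origin the function is bounded by `‖z‖` to a power at least `2`, so its derivative
        -- is `0`.
        refine HasFDerivAt.congr_fderiv ?_ e.symm
        rw [hasFDerivAt_iff_isLittleO_nhds_zero]
        have h0 : conj (0 : ℂ) ^ (N + 1) / 0 ^ l = 0 := by
          rw [map_zero, zero_pow (by omega), zero_div]
        simp only [zero_add, h0, sub_zero, zero_apply]
        have h2 : (fun z : ℂ => conj z ^ (N + 1) / z ^ l) =O[nhds 0] fun z : ℂ => z ^ (N + 1 - l) :=
          Asymptotics.isBigO_of_le _ fun z => by
            rw [norm_pow]; exact norm_conj_pow_div_pow_le (by omega) z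
        refine h2.trans_isLittleO ?_
        exact Asymptotics.isLittleO_pow_id (by omega)
      · have h1 : HasFDerivAt (fun z : ℂ => conj z) Complex.conjCLE.toContinuousLinearMap z :=
          Complex.conjCLE.hasFDerivAt
        have h2 := h1.pow (N + 1)
        have h3 : HasDerivAt (fun z : ℂ => (z ^ l)⁻¹) (-(l * z ^ (l - 1)) / (z ^ l) ^ 2) z :=
          (hasDerivAt_pow l z).fun_inv (pow_ne_zero _ hz)
        have h4 := h2.mul (h3.hasFDerivAt.restrictScalars ℝ)
        refine (h4.congr_fderiv ?_ : _)
        ext v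
        rcases l with _ | l
        · simp
        · simp
          field_simp
          ring

/-! ### Dividing out zeros -/

/-- The operator `2D_{z̄}` on differentiable functions. -/
def dbar (f : ℂ → ℂ) (z : ℂ) : ℂ :=
  (1 / Complex.I) * (fderiv ℝ f z 1 + Complex.I * fderiv ℝ f z Complex.I)

/-- This is `df = ∂_z f dz + ∂_{z̄} f dz̄`; the factor `i/2` appears because `2D_{z̄} = (2/i)
∂_{z̄}`. -/
lemma fderiv_apply_eq (f : ℂ → ℂ) (z v : ℂ) :
    fderiv ℝ f z v = v * dz f z + conj v * (Complex.I / 2 * dbar f z) := by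
  have hv : v = v.re • (1 : ℂ) + v.im • Complex.I := by simp
  have e : fderiv ℝ f z v = v.re * fderiv ℝ f z 1 + v.im * fderiv ℝ f z Complex.I := by
    conv_lhs => rw [hv, map_add, map_smul, map_smul]
    simp
  rw [e, dz, dbar]
  have h1 : v = v.re + v.im * Complex.I := (Complex.re_add_im v).symm
  have h2 : conj v = v.re - v.im * Complex.I := by
    conv_lhs => rw [h1]
    rw [map_add, map_mul, Complex.conj_ofReal, Complex.conj_ofReal, Complex.conj_I]; ring
  have hI := Complex.I_ne_zero
  rw [h2]
  conv_rhs => rw [h1]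
  simp only [smul_eq_mul, Complex.add_re, Complex.add_im, Complex.ofReal_re, Complex.ofReal_im,
    Complex.mul_re, Complex.mul_im, Complex.I_re, Complex.I_im]
  field_simp
  ring_nf
  simp

lemma contDiff_dz {E : Type} [NormedAddCommGroup E] [NormedSpace ℂ E] {f : ℂ → E}
    (hf : ContDiff ℝ ∞ f) : ContDiff ℝ ∞ (dz f) := by
  have h := hf.fderiv_right (m := ∞) (by simp)
  exact ((h.clm_apply contDiff_const).sub ((h.clm_apply contDiff_const).const_smul _)).const_smul _

lemma contDiff_dbar {f : ℂ → ℂ} (hf : ContDiff ℝ ∞ f) : ContDiff ℝ ∞ (dbar f) := by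
  have h := hf.fderiv_right (m := ∞) (by simp)
  exact contDiff_const.mul ((h.clm_apply contDiff_const).add
    (contDiff_const.mul (h.clm_apply contDiff_const)))

/-- Hadamard's formula. -/
lemma eq_radialAvg {f : ℂ → ℂ} (hf : ContDiff ℝ ∞ f) (h0 : f 0 = 0) (z : ℂ) :
    f z = z * radialAvg 0 (dz f) z + conj z * (Complex.I / 2 * radialAvg 0 (dbar f) z) := by
  have hd : ∀ t : ℝ, HasDerivAt (fun t : ℝ => f (t • z)) (fderiv ℝ f (t • z) z) t := by
    intro t
    have h1 : HasDerivAt (fun t : ℝ => t • z) z t := by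
      simpa using (hasDerivAt_id t).smul_const z
    exact ((hf.differentiable (by simp) (t • z)).hasFDerivAt.comp_hasDerivAt t h1)
  have hc : Continuous (fderiv ℝ f) := hf.continuous_fderiv (by simp)
  have hz := (contDiff_dz hf).continuous
  have hb := (contDiff_dbar hf).continuous
  have h := intervalIntegral.integral_eq_sub_of_hasDerivAt (a := 0) (b := 1) (fun t _ => hd t)
    (Continuous.intervalIntegrable (by fun_prop) _ _)
  simp only [one_smul, zero_smul, h0, sub_zero] at h
  rw [← h]
  simp only [fderiv_apply_eq, radialAvg, pow_zero, one_smul]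
  rw [intervalIntegral.integral_add (Continuous.intervalIntegrable (by fun_prop) _ _)
    (Continuous.intervalIntegrable (by fun_prop) _ _)]
  simp only [intervalIntegral.integral_const_mul]

lemma radialAvg_add {f g : ℂ → ℂ} (hf : Continuous f) (hg : Continuous g) (n : ℕ) (z : ℂ) :
    radialAvg n (fun z => f z + g z) z = radialAvg n f z + radialAvg n g z := by
  unfold radialAvg
  simp only [smul_add]
  exact intervalIntegral.integral_add (Continuous.intervalIntegrable (by fun_prop) _ _)
    (Continuous.intervalIntegrable (by fun_prop) _ _)

lemma radialAvg_pow_mul (f : ℂ → ℂ) (n N M : ℕ) (z : ℂ) :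
    radialAvg n (fun z => z ^ N * conj z ^ M * f z) z =
      z ^ N * conj z ^ M * radialAvg (n + N + M) f z := by
  unfold radialAvg
  rw [← intervalIntegral.integral_const_mul]
  congr 1
  ext t
  simp only [Complex.real_smul, map_mul, Complex.conj_ofReal, mul_pow]
  push_cast
  ring

/-- A solution of a `∂̄`-system vanishing at `0` has no pure powers of `z̄` in its Taylor series. -/
lemma exists_eq_mul_add_conj_pow_mul {ι : Type} [Fintype ι] {w : ι → ℂ → ℂ} {β : ι → ι → ℂ → ℂ}
    (hw : ∀ i, ContDiff ℝ ∞ (w i)) (hβ : ∀ i j, ContDiff ℝ ∞ (β i j))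
    (heq : ∀ i z, dbar (w i) z = ∑ j, β i j z * w j z) (h0 : ∀ i, w i 0 = 0) (N : ℕ) :
    ∃ a b : ι → ℂ → ℂ, (∀ i, ContDiff ℝ ∞ (a i)) ∧ (∀ i, ContDiff ℝ ∞ (b i)) ∧
      ∀ i z, w i z = z * a i z + conj z ^ N * b i z := by
  induction N with
  | zero => exact ⟨0, w, fun i => contDiff_const, hw, fun i z => by simp⟩
  | succ N ih =>
    obtain ⟨a, b, ha, hb, hab⟩ := ih
    set A : ι → ℂ → ℂ := fun i z => ∑ j, β i j z * a j z with hA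
    set B : ι → ℂ → ℂ := fun i z => ∑ j, β i j z * b j z with hB
    have hAs : ∀ i, ContDiff ℝ ∞ (A i) := fun i =>
      ContDiff.sum fun j _ => (hβ i j).mul (ha j)
    have hBs : ∀ i, ContDiff ℝ ∞ (B i) := fun i =>
      ContDiff.sum fun j _ => (hβ i j).mul (hb j)
    have hconj : ContDiff ℝ ∞ fun z : ℂ => conj z := Complex.conjCLE.contDiff
    -- Inserting the expansion of order `N` in the equation gives `2D_{z̄} w = z A + z̄^N B`. In
    -- Hadamard's formula this term carries one more `z̄`: the `A` part is absorbed in the multiple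
    -- of `z`, and the `B` part has `z̄^{N+1}`.
    refine ⟨fun i z => radialAvg 0 (dz (w i)) z +
        conj z * (Complex.I / 2 * radialAvg 1 (A i) z),
      fun i z => Complex.I / 2 * radialAvg N (B i) z, fun i => ?_, fun i => ?_, fun i z => ?_⟩
    · exact (contDiff_radialAvg _ (contDiff_dz (hw i))).add
        (hconj.mul (contDiff_const.mul (contDiff_radialAvg _ (hAs i))))
    · exact contDiff_const.mul (contDiff_radialAvg _ (hBs i))
    · rw [eq_radialAvg (hw i) (h0 i)]
      have e : dbar (w i) = fun z => z ^ 1 * conj z ^ 0 * A i z + z ^ 0 * conj z ^ N * B i z := by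
        ext z
        rw [heq, hA, hB]
        simp only [Finset.mul_sum]
        rw [← Finset.sum_add_distrib]
        refine Finset.sum_congr rfl fun j _ => ?_
        rw [hab j z]; ring
      have hAc := (hAs i).continuous
      have hBc := (hBs i).continuous
      have hcc := hconj.continuous
      rw [e, radialAvg_add (by fun_prop) (by fun_prop), radialAvg_pow_mul, radialAvg_pow_mul]
      simp only [zero_add, add_zero]
      ring

/-- A smooth solution of a `∂̄`-system vanishing at `0` is divisible by `z`. -/
lemma exists_eq_mul_of_dbar_system {ι : Type} [Fintype ι] {w : ι → ℂ → ℂ} {β : ι → ι → ℂ → ℂ}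
    (hw : ∀ i, ContDiff ℝ ∞ (w i)) (hβ : ∀ i j, ContDiff ℝ ∞ (β i j))
    (heq : ∀ i z, dbar (w i) z = ∑ j, β i j z * w j z) (h0 : ∀ i, w i 0 = 0) :
    ∃ r : ι → ℂ → ℂ, (∀ i, ContDiff ℝ ∞ (r i)) ∧ ∀ i z, w i z = z * r i z := by
  have key : ∀ k : ℕ, ∃ r : ι → ℂ → ℂ, (∀ i, ContDiff ℝ k (r i)) ∧
      ∀ i z, w i z = z * r i z := by
    intro k
    -- The power `k + 2` is what makes `z̄^{k+2} / z` of class `C^k`.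
    obtain ⟨a, b, ha, hb, hab⟩ := exists_eq_mul_add_conj_pow_mul hw hβ heq h0 (k + 2)
    refine ⟨fun i z => a i z + conj z ^ (k + 2) / z ^ 1 * b i z, fun i => ?_, fun i z => ?_⟩
    · exact ((ha i).of_le (by exact_mod_cast le_top)).add
        ((contDiff_conj_pow_div_pow k (by omega)).mul
          ((hb i).of_le (by exact_mod_cast le_top)))
    · rw [hab i z]
      by_cases hz : z = 0
      · simp [hz]
      · field_simp
  choose r hr hwr using key
  -- Off the origin the quotient is determined by `w`, so the quotients of all finite regularities
  -- coincide and the common one is smooth.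
  have huniq : ∀ k i, r k i = r 0 i := by
    intro k i
    refine Continuous.ext_on (dense_compl_singleton (0 : ℂ)) (hr k i).continuous
      (hr 0 i).continuous ?_
    intro z hz
    exact mul_left_cancel₀ (hz : z ≠ 0) (by rw [← hwr, ← hwr])
  refine ⟨r 0, fun i => ?_, hwr 0⟩
  rw [contDiff_infty]
  intro k
  rw [← huniq k]
  exact hr k i

/-! ### Multiplicities of zeros -/

section Multiplicity

variable {E : Type} [NormedAddCommGroup E] [NormedSpace ℂ E]

/-- `∂_z^j w` vanishes at `z₀` for all `j < m`. -/
def VanishesTo (m : ℕ) (w : ℂ → E) (z₀ : ℂ) : Prop := ∀ j < m, dz^[j] w z₀ = 0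

lemma vanishesTo_succ {m : ℕ} {w : ℂ → E} {z₀ : ℂ} :
    VanishesTo (m + 1) w z₀ ↔ w z₀ = 0 ∧ VanishesTo m (dz w) z₀ := by
  constructor
  · intro h
    exact ⟨h 0 (Nat.succ_pos m), fun j hj => by
      simpa only [Function.iterate_succ_apply] using h (j + 1) (by omega)⟩
  · rintro ⟨h0, h⟩ j hj
    rcases j with _ | j
    · exact h0
    · simpa only [Function.iterate_succ_apply] using h j (by omega)

lemma VanishesTo.mono {m n : ℕ} (hmn : m ≤ n) {w : ℂ → E} {z₀ : ℂ} (h : VanishesTo n w z₀) :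
    VanishesTo m w z₀ := fun j hj => h j (hj.trans_le hmn)

lemma dz_add {f g : ℂ → E} (hf : ContDiff ℝ ∞ f) (hg : ContDiff ℝ ∞ g) :
    dz (fun z => f z + g z) = fun z => dz f z + dz g z := by
  ext z
  have h : fderiv ℝ (fun z => f z + g z) z = fderiv ℝ f z + fderiv ℝ g z :=
    fderiv_fun_add (hf.differentiable (by simp) z) (hg.differentiable (by simp) z)
  simp only [dz, h, add_apply, smul_add, smul_sub]
  abel

lemma dz_smul {h : ℂ → ℂ} (hh : Differentiable ℂ h) {w : ℂ → E} (hw : ContDiff ℝ ∞ w) :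
    dz (fun z => h z • w z) = fun z => deriv h z • w z + h z • dz w z := by
  ext z
  have h1 : HasFDerivAt h ((ContinuousLinearMap.toSpanSingleton ℂ (deriv h z)).restrictScalars ℝ)
      z := (hh z).hasDerivAt.hasFDerivAt.restrictScalars ℝ
  have h2 := (h1.smul (hw.differentiable (by simp) z).hasFDerivAt).fderiv
  have h2' : fderiv ℝ (fun z => h z • w z) z = _ := h2
  simp only [dz, h2']
  simp only [add_apply, smul_apply, ContinuousLinearMap.smulRight_apply,
    ContinuousLinearMap.coe_restrictScalars', ContinuousLinearMap.toSpanSingleton_apply,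
    smul_eq_mul, one_mul]
  have hI : Complex.I * Complex.I = -1 := Complex.I_mul_I
  simp only [smul_add, smul_sub, smul_smul]
  rw [show (1 / 2 * (Complex.I * (Complex.I * deriv h z)) : ℂ) = -(1 / 2 * deriv h z) by
    rw [← mul_assoc Complex.I, hI]; ring]
  module

lemma contDiff_smul_of_differentiable {h : ℂ → ℂ} (hh : Differentiable ℂ h) {w : ℂ → E}
    (hw : ContDiff ℝ ∞ w) : ContDiff ℝ ∞ fun z => h z • w z :=
  (hh.contDiff.restrict_scalars ℝ).smul hw

lemma differentiable_deriv {h : ℂ → ℂ} (hh : Differentiable ℂ h) : Differentiable ℂ (deriv h) :=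
  (hh.contDiff (n := 2)).differentiable_deriv_two

lemma VanishesTo.add {m : ℕ} {f g : ℂ → E} {z₀ : ℂ} (hf : ContDiff ℝ ∞ f) (hg : ContDiff ℝ ∞ g)
    (h1 : VanishesTo m f z₀) (h2 : VanishesTo m g z₀) :
    VanishesTo m (fun z => f z + g z) z₀ := by
  induction m generalizing f g with
  | zero => intro j hj; omega
  | succ m ih =>
    rw [vanishesTo_succ] at h1 h2 ⊢
    rw [dz_add hf hg]
    exact ⟨by simp [h1.1, h2.1], ih (contDiff_dz hf) (contDiff_dz hg) h1.2 h2.2⟩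

lemma VanishesTo.smul {m : ℕ} {h : ℂ → ℂ} {w : ℂ → E} {z₀ : ℂ} (hh : Differentiable ℂ h)
    (hw : ContDiff ℝ ∞ w) (h1 : VanishesTo m w z₀) : VanishesTo m (fun z => h z • w z) z₀ := by
  induction m generalizing h w with
  | zero => intro j hj; omega
  | succ m ih =>
    have h2 := vanishesTo_succ.1 h1
    rw [vanishesTo_succ, dz_smul hh hw]
    refine ⟨by simp [h2.1], ?_⟩
    exact (ih (differentiable_deriv hh) hw (h1.mono (by omega))).add
      (contDiff_smul_of_differentiable (differentiable_deriv hh) hw)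
      (contDiff_smul_of_differentiable hh (contDiff_dz hw)) (ih hh (contDiff_dz hw) h2.2)

/-- For the converse, `∂_z(h w) = h' w + h ∂_z w`: by induction `w`, hence `h' w`, already vanishes
to order `m`, and subtracting it leaves `h ∂_z w`. -/
lemma vanishesTo_smul_iff {m : ℕ} {h : ℂ → ℂ} {w : ℂ → E} {z₀ : ℂ} (hh : Differentiable ℂ h)
    (hw : ContDiff ℝ ∞ w) (h0 : h z₀ ≠ 0) :
    VanishesTo m (fun z => h z • w z) z₀ ↔ VanishesTo m w z₀ := by
  refine ⟨fun h1 => ?_, fun h1 => h1.smul hh hw⟩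
  induction m generalizing w with
  | zero => intro j hj; omega
  | succ m ih =>
    have hm := ih hw (h1.mono (by omega))
    rw [vanishesTo_succ, dz_smul hh hw] at h1
    rw [vanishesTo_succ]
    refine ⟨(smul_eq_zero.1 h1.1).resolve_left h0, ih (contDiff_dz hw) ?_⟩
    have hd := differentiable_deriv hh
    have h2 := h1.2.add ((contDiff_smul_of_differentiable hd hw).add
      (contDiff_smul_of_differentiable hh (contDiff_dz hw)))
      (contDiff_smul_of_differentiable (hd.const_smul (-1 : ℂ)) hw)
      (hm.smul (hd.const_smul (-1 : ℂ)) hw)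
    convert h2 using 2 with z
    simp

/-- Leibniz gives `∂_z^{j+1}((z - z₀)w) = (j+1) ∂_z^j w + (z - z₀) ∂_z^{j+1} w`, and at `z₀` only
the first term survives. -/
lemma vanishesTo_sub_smul_iff {m : ℕ} {w : ℂ → E} {z₀ : ℂ} (hw : ContDiff ℝ ∞ w) :
    VanishesTo (m + 1) (fun z => (z - z₀) • w z) z₀ ↔ VanishesTo m w z₀ := by
  have key : ∀ j : ℕ, ContDiff ℝ ∞ (dz^[j] w) ∧ dz^[j + 1] (fun z => (z - z₀) • w z) =
      fun z => (j + 1 : ℂ) • dz^[j] w z + (z - z₀) • dz^[j + 1] w z := by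
    have hd : Differentiable ℂ fun z : ℂ => z - z₀ := by fun_prop
    have hder : ∀ z, deriv (fun z : ℂ => z - z₀) z = 1 := fun z => by simp
    intro j
    induction j with
    | zero =>
      refine ⟨hw, ?_⟩
      simp only [zero_add, Function.iterate_one, Function.iterate_zero, id]
      rw [dz_smul hd hw]
      simp
    | succ j ih =>
      obtain ⟨h1, h2⟩ := ih
      have h3 : ContDiff ℝ ∞ (dz^[j + 1] w) := by
        rw [Function.iterate_succ_apply']; exact contDiff_dz h1
      refine ⟨h3, ?_⟩
      rw [Function.iterate_succ_apply', h2, dz_add (f := fun z => (j + 1 : ℂ) • dz^[j] w z) (contDiff_const.smul h1)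
        (contDiff_smul_of_differentiable hd h3), dz_smul hd h3,
        dz_smul (h := fun _ => (j + 1 : ℂ)) (differentiable_const _) h1]
      ext z
      simp only [deriv_const, zero_smul, zero_add, hder]
      rw [← Function.iterate_succ_apply' (f := dz) (x := w) (n := j),
        ← Function.iterate_succ_apply' (f := dz) (x := w) (n := j + 1)]
      push_cast
      module
  constructor
  · intro h j hj
    have := h (j + 1) (by omega)
    rw [(key j).2] at this
    simp only [sub_self, zero_smul, add_zero] at this
    exact (smul_eq_zero.1 this).resolve_left (Nat.cast_add_one_ne_zero j)
  · intro h j hj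
    rcases j with _ | j
    · simp
    · rw [(key j).2]
      simp [h j (by omega)]

end Multiplicity

/-- The admissible orders are closed downwards, so the supremum, even when infinite, is tested by
natural numbers. -/
lemma le_zeroMult {w : ℂ → ℂ × ℂ} {z₀ : ℂ} {m : ℕ} :
    (m : ℕ∞) ≤ zeroMult w z₀ ↔ VanishesTo m w z₀ := by
  constructor
  · intro h
    rcases m with _ | m
    · intro j hj; omega
    have h1 : (m : ℕ∞) < zeroMult w z₀ :=
      lt_of_lt_of_le (by exact_mod_cast Nat.lt_succ_self m) h
    unfold zeroMult at h1
    simp only [lt_iSup_iff] at h1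
    obtain ⟨n, hn, hmn⟩ := h1
    have : VanishesTo n w z₀ := hn
    exact this.mono (by exact_mod_cast hmn)
  · intro h
    exact le_iSup₂_of_le m h le_rfl

lemma zeroMult_congr {w w' : ℂ → ℂ × ℂ} {z₀ : ℂ}
    (h : ∀ m, VanishesTo m w z₀ ↔ VanishesTo m w' z₀) : zeroMult w z₀ = zeroMult w' z₀ := by
  apply le_antisymm <;> rw [← ENat.forall_natCast_le_iff_le] <;> intro m hm <;>
    rw [le_zeroMult] at hm ⊢
  · exact (h m).1 hm
  · exact (h m).2 hm

lemma zeroMult_eq_zero {w : ℂ → ℂ × ℂ} {z₀ : ℂ} (h : w z₀ ≠ 0) : zeroMult w z₀ = 0 := by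
  by_contra h0
  have : ((1 : ℕ) : ℕ∞) ≤ zeroMult w z₀ := by
    rw [Nat.cast_one]; exact Order.one_le_iff_ne_zero.2 h0
  rw [le_zeroMult] at this
  exact h (this 0 one_pos)

lemma zeroMult_sub_smul {w : ℂ → ℂ × ℂ} {z₀ : ℂ} (hw : ContDiff ℝ ∞ w) :
    zeroMult (fun z => (z - z₀) • w z) z₀ = zeroMult w z₀ + 1 := by
  apply le_antisymm <;> rw [← ENat.forall_natCast_le_iff_le] <;> intro m hm
  · rcases m with _ | m
    · simp
    rw [le_zeroMult, vanishesTo_sub_smul_iff hw, ← le_zeroMult] at hm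
    push_cast
    gcongr
  · rcases m with _ | m
    · simp
    rw [le_zeroMult, vanishesTo_sub_smul_iff hw, ← le_zeroMult]
    push_cast at hm
    exact (ENat.add_le_add_iff_right (by simp)).1 hm

/-- Near `z₀` the theta factor is either nonzero or `z - z₀` times a nonvanishing holomorphic
function, and the latter does not affect multiplicities. -/
lemma zeroMult_theta_smul {P : ℂ} {w : ℂ → ℂ × ℂ} (hw : ContDiff ℝ ∞ w) (z₀ : ℂ) :
    zeroMult (fun z => theta (z - P) • w z) z₀ =
      zeroMult w z₀ + if theta (z₀ - P) = 0 then 1 else 0 := by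
  rcases theta_factor P z₀ with h | ⟨h, κ, hκ, h0, hfac⟩
  · rw [if_neg h, add_zero]
    exact zeroMult_congr fun m =>
      vanishesTo_smul_iff (h := fun z => theta (z - P)) (differentiable_theta.comp (by fun_prop))
        hw h
  · rw [if_pos h]
    simp only [hfac, mul_smul]
    rw [zeroMult_sub_smul (contDiff_smul_of_differentiable hκ hw)]
    congr 1
    exact zeroMult_congr fun m => vanishesTo_smul_iff hκ hw h0

lemma eq_of_mem_cell {z : ℂ} {m n : ℤ} (hz : z ∈ cell) (h : z + (m + n * omega) ∈ cell) :
    m = 0 ∧ n = 0 := by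
  rw [mem_cell_iff] at hz h
  rw [(coord_add z m n).1, (coord_add z m n).2] at h
  obtain ⟨⟨a1, a2⟩, b1, b2⟩ := hz
  obtain ⟨⟨c1, c2⟩, d1, d2⟩ := h
  have e1 : (-1 : ℝ) < m := by linarith
  have e2 : (m : ℝ) < 1 := by linarith
  have e3 : (-1 : ℝ) < n := by linarith
  have e4 : (n : ℝ) < 1 := by linarith
  have f1 : -1 < m := by exact_mod_cast e1
  have f2 : m < 1 := by exact_mod_cast e2
  have f3 : -1 < n := by exact_mod_cast e3
  have f4 : n < 1 := by exact_mod_cast e4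
  omega

/-- `θ(z - P)` has exactly one zero in the fundamental parallelogram. -/
lemma exists_unique_theta_zero (P : ℂ) : ∃ p : cell, ∀ z : cell, theta (z - P) = 0 ↔ z = p := by
  obtain ⟨m, n, h⟩ := exists_add_mem_cell P
  have hq := isQuasiPeriodic_theta 0
  simp only [sub_zero] at hq
  have hz := hq.eq_zero_of_eq_zero one_ne_zero (by simp) theta_zero m n
  rw [zero_add] at hz
  refine ⟨⟨_, h⟩, fun z => ⟨fun h0 => ?_, fun h0 => ?_⟩⟩
  · obtain ⟨m', n', h'⟩ := theta_eq_zero h0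
    have e : (z : ℂ) = P + (m + n * omega) + ((m' - m : ℤ) + (n' - n : ℤ) * omega) := by
      rw [sub_eq_iff_eq_add] at h'
      rw [h']; push_cast; ring
    have hz := z.2
    rw [e] at hz
    obtain ⟨h1, h2⟩ := eq_of_mem_cell h hz
    apply Subtype.ext
    rw [e, h1, h2]; simp
  · rw [h0]
    simpa using hz

/-! ### Smooth solutions of the scalar model -/

lemma dbar_mul {f g : ℂ → ℂ} (hf : ContDiff ℝ ∞ f) (hg : ContDiff ℝ ∞ g) (z : ℂ) :
    dbar (fun z => f z * g z) z = f z * dbar g z + g z * dbar f z := by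
  have h : fderiv ℝ (fun z => f z * g z) z = f z • fderiv ℝ g z + g z • fderiv ℝ f z :=
    fderiv_fun_mul (hf.differentiable (by simp) z) (hg.differentiable (by simp) z)
  simp only [dbar, h, add_apply, smul_apply, smul_eq_mul]
  ring

lemma dbar_add {f g : ℂ → ℂ} (hf : ContDiff ℝ ∞ f) (hg : ContDiff ℝ ∞ g) (z : ℂ) :
    dbar (fun z => f z + g z) z = dbar f z + dbar g z := by
  have h : fderiv ℝ (fun z => f z + g z) z = fderiv ℝ f z + fderiv ℝ g z :=
    fderiv_fun_add (hf.differentiable (by simp) z) (hg.differentiable (by simp) z)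
  simp only [dbar, h, add_apply]
  ring

lemma dbar_sub {f g : ℂ → ℂ} (hf : ContDiff ℝ ∞ f) (hg : ContDiff ℝ ∞ g) (z : ℂ) :
    dbar (fun z => f z - g z) z = dbar f z - dbar g z := by
  have h : fderiv ℝ (fun z => f z - g z) z = fderiv ℝ f z - fderiv ℝ g z :=
    fderiv_fun_sub (hf.differentiable (by simp) z) (hg.differentiable (by simp) z)
  simp only [dbar, h, sub_apply]
  ring

lemma dbar_const_mul (c : ℂ) {f : ℂ → ℂ} (hf : ContDiff ℝ ∞ f) (z : ℂ) :
    dbar (fun z => c * f z) z = c * dbar f z := by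
  rw [dbar_mul contDiff_const hf]
  simp [dbar]

lemma dbar_eq_zero {h : ℂ → ℂ} (hh : Differentiable ℂ h) (z : ℂ) : dbar h z = 0 := by
  have h1 : HasFDerivAt h ((ContinuousLinearMap.toSpanSingleton ℂ (deriv h z)).restrictScalars ℝ)
      z := (hh z).hasDerivAt.hasFDerivAt.restrictScalars ℝ
  rw [dbar, h1.fderiv]
  simp [← mul_assoc]

lemma differentiable_of_dbar_eq_zero {f : ℂ → ℂ} (hf : ContDiff ℝ ∞ f) (h : ∀ z, dbar f z = 0) :
    Differentiable ℂ f := by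
  intro z
  have h1 := (hf.differentiable (by simp) z).hasFDerivAt
  have h2 : fderiv ℝ f z =
      (ContinuousLinearMap.toSpanSingleton ℂ (dz f z)).restrictScalars ℝ := by
    ext v
    rw [fderiv_apply_eq, h]
    simp
  rw [h2] at h1
  have h3 : HasFDerivAt f (ContinuousLinearMap.toSpanSingleton ℂ (dz f z)) z :=
    hasFDerivAt_of_restrictScalars ℝ h1 rfl
  exact h3.differentiableAt

lemma dbar_comp_add_const (f : ℂ → ℂ) (c z : ℂ) :
    dbar (fun z => f (z + c)) z = dbar f (z + c) := by
  simp only [dbar, fderiv_comp_add_right]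

lemma Potential.contDiff (V : Potential) : ContDiff ℝ ∞ V.toFun := by
  rw [← contDiffOn_univ]
  exact V.analytic.analyticOn.contDiffOn uniqueDiffOn_univ

/-- Smooth solutions `w` of `(2D_{z̄} + k) w₁ = α² V w₂`, `(2D_{z̄} + k) w₂ = w₁`. -/
def Sol (V : Potential) (α k : ℂ) : Submodule ℂ (ℂ → ℂ × ℂ) where
  carrier := {w | ContDiff ℝ ∞ w ∧
    (∀ z, dbar (fun z => (w z).1) z + k * (w z).1 = α ^ 2 * V.toFun z * (w z).2) ∧
    ∀ z, dbar (fun z => (w z).2) z + k * (w z).2 = (w z).1}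
  zero_mem' := ⟨contDiff_const, by simp [dbar], by simp [dbar]⟩
  add_mem' := by
    rintro f g ⟨hf, hf1, hf2⟩ ⟨hg, hg1, hg2⟩
    refine ⟨hf.add hg, fun z => ?_, fun z => ?_⟩
    · have := dbar_add hf.fst hg.fst z
      simp only [Pi.add_apply, Prod.fst_add, Prod.snd_add] at this ⊢
      rw [this]
      linear_combination hf1 z + hg1 z
    · have := dbar_add hf.snd hg.snd z
      simp only [Pi.add_apply, Prod.fst_add, Prod.snd_add] at this ⊢
      rw [this]
      linear_combination hf2 z + hg2 z
  smul_mem' := by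
    rintro c f ⟨hf, hf1, hf2⟩
    refine ⟨hf.const_smul c, fun z => ?_, fun z => ?_⟩
    · have := dbar_const_mul c hf.fst z
      simp only [Pi.smul_apply, Prod.smul_fst, Prod.smul_snd, smul_eq_mul] at this ⊢
      rw [this]
      linear_combination c * hf1 z
    · have := dbar_const_mul c hf.snd z
      simp only [Pi.smul_apply, Prod.smul_fst, Prod.smul_snd, smul_eq_mul] at this ⊢
      rw [this]
      linear_combination c * hf2 z

/-- Quasi-periodic functions with given multipliers. -/
def quasiPeriodic (N : ℤ) (a b : ℂ) : Submodule ℂ (ℂ → ℂ × ℂ) where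
  carrier := {w | IsQuasiPeriodic N a b w}
  zero_mem' := ⟨fun z => by simp, fun z => by simp⟩
  add_mem' := by
    rintro f g ⟨hf1, hf2⟩ ⟨hg1, hg2⟩
    exact ⟨fun z => by simp only [Pi.add_apply, hf1, hg1, smul_add],
      fun z => by simp only [Pi.add_apply, hf2, hg2, smul_add]⟩
  smul_mem' := by
    rintro c f ⟨hf1, hf2⟩
    exact ⟨fun z => by simp only [Pi.smul_apply, hf1]; rw [smul_comm],
      fun z => by simp only [Pi.smul_apply, hf2]; rw [smul_comm]⟩

/-- Quasi-periodic smooth solutions. -/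
def QSol (V : Potential) (α : ℂ) (N : ℤ) (a b : ℂ) : Submodule ℂ (ℂ → ℂ × ℂ) :=
  Sol V α 0 ⊓ quasiPeriodic N a b

variable {V : Potential} {α : ℂ}

lemma smul_mem_Sol {k : ℂ} {h : ℂ → ℂ} (hh : Differentiable ℂ h) {w : ℂ → ℂ × ℂ}
    (hw : w ∈ Sol V α k) : (fun z => h z • w z) ∈ Sol V α k := by
  have hs : ContDiff ℝ ∞ h := hh.contDiff.restrict_scalars ℝ
  refine ⟨hs.smul hw.1, fun z => ?_, fun z => ?_⟩
  · have := dbar_mul hs hw.1.fst z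
    simp only [Prod.smul_fst, Prod.smul_snd, smul_eq_mul] at this ⊢
    rw [this, dbar_eq_zero hh]
    linear_combination h z * hw.2.1 z
  · have := dbar_mul hs hw.1.snd z
    simp only [Prod.smul_fst, Prod.smul_snd, smul_eq_mul] at this ⊢
    rw [this, dbar_eq_zero hh]
    linear_combination h z * hw.2.2 z

lemma smul_mem_QSol {N N' : ℤ} {a b a' b' : ℂ} {h : ℂ → ℂ} (hh : h ∈ Theta N a b)
    {w : ℂ → ℂ × ℂ} (hw : w ∈ QSol V α N' a' b') :
    (fun z => h z • w z) ∈ QSol V α (N + N') (a * a') (b * b') :=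
  ⟨smul_mem_Sol hh.1 hw.1, hh.2.smul hw.2⟩

/-- A smooth solution vanishing at `z₁` is divisible by `z - z₁`. -/
lemma exists_eq_sub_smul_of_mem_Sol {w : ℂ → ℂ × ℂ} (hw : w ∈ Sol V α 0) {z₁ : ℂ}
    (h0 : w z₁ = 0) : ∃ r : ℂ → ℂ × ℂ, ContDiff ℝ ∞ r ∧ ∀ z, w z = (z - z₁) • r z := by
  have hsh : ContDiff ℝ ∞ fun z : ℂ => z + z₁ := contDiff_id.add contDiff_const
  obtain ⟨r, hr, hwr⟩ := exists_eq_mul_of_dbar_system (ι := Fin 2)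
    (w := ![fun z => (w (z + z₁)).1, fun z => (w (z + z₁)).2])
    (β := ![![fun _ => 0, fun z => α ^ 2 * V.toFun (z + z₁)], ![fun _ => 1, fun _ => 0]])
    (by
      intro i
      fin_cases i
      · exact hw.1.fst.comp hsh
      · exact hw.1.snd.comp hsh)
    (by
      intro i j
      fin_cases i <;> fin_cases j
      · exact contDiff_const
      · exact contDiff_const.mul (V.contDiff.comp hsh)
      · exact contDiff_const
      · exact contDiff_const)
    (by
      intro i z
      have h1 := hw.2.1 (z + z₁)
      have h2 := hw.2.2 (z + z₁)
      rw [zero_mul, add_zero] at h1 h2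
      fin_cases i
      · have := dbar_comp_add_const (fun z => (w z).1) z₁ z
        simp [this, h1]
      · have := dbar_comp_add_const (fun z => (w z).2) z₁ z
        simp [this, h2])
    (by
      intro i
      fin_cases i <;> simp [h0])
  refine ⟨fun z => (r 0 (z - z₁), r 1 (z - z₁)), ?_, fun z => ?_⟩
  · have hsh' : ContDiff ℝ ∞ fun z : ℂ => z - z₁ := contDiff_id.sub contDiff_const
    exact ((hr 0).comp hsh').prodMk ((hr 1).comp hsh')
  · have e0 := hwr 0 (z - z₁)
    have e1 := hwr 1 (z - z₁)
    simp at e0 e1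
    exact Prod.ext e0 e1

/-- A quasi-periodic solution vanishing at `P` is divisible by `θ(z - P)`. -/
lemma exists_theta_quotient_of_mem_QSol {N : ℤ} {a b P : ℂ} (ha : a ≠ 0) (hb : b ≠ 0)
    {w : ℂ → ℂ × ℂ} (hw : w ∈ QSol V α N a b) (hP : w P = 0) :
    ∃ g ∈ QSol V α (N + 1) a (-(b * Complex.exp (-(2 * Real.pi * Complex.I * P)))),
      ∀ z, w z = theta (z - P) • g z := by
  have hθd : Differentiable ℂ fun z => theta (z - P) := differentiable_theta.comp (by fun_prop)
  have hθs : ContDiff ℝ ∞ fun z => theta (z - P) := hθd.contDiff.restrict_scalars ℝ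
  obtain ⟨g, hg, hgw⟩ := exists_glued_quotient (t := fun z => theta (z - P)) (h := w)
    (fun ρ z₁ => ContDiffAt ℝ ∞ ρ z₁) (eventually_theta_ne_zero P) (by
      intro z₁
      rcases theta_factor P z₁ with h0 | ⟨h0, κ, hκ, hκ0, hfac⟩
      · refine ⟨fun z => (theta (z - P))⁻¹ • w z, (hθs.contDiffAt.inv h0).smul
          hw.1.1.contDiffAt, ?_⟩
        filter_upwards [hθs.continuous.continuousAt.eventually_ne h0] with z hz
        rw [smul_smul, mul_inv_cancel₀ hz, one_smul]
      · obtain ⟨m, n, hmn⟩ := theta_eq_zero h0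
        have hz₁ : w z₁ = 0 := by
          have := hw.2.eq_zero_of_eq_zero ha hb hP m n
          rwa [← hmn, add_sub_cancel] at this
        obtain ⟨r, hr, hwr⟩ := exists_eq_sub_smul_of_mem_Sol hw.1 hz₁
        have hκs : ContDiff ℝ ∞ κ := hκ.contDiff.restrict_scalars ℝ
        refine ⟨fun z => (κ z)⁻¹ • r z, (hκs.contDiffAt.inv hκ0).smul hr.contDiffAt, ?_⟩
        filter_upwards [hκ.continuous.continuousAt.eventually_ne hκ0] with z hz
        rw [hwr, hfac, smul_smul, mul_assoc, mul_inv_cancel₀ hz, mul_one])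
  have hgs : ContDiff ℝ ∞ g := contDiff_iff_contDiffAt.2 fun z₁ => by
    obtain ⟨ρ, hρ, he⟩ := hg z₁
    exact hρ.congr_of_eventuallyEq he
  refine ⟨g, ⟨⟨hgs, ?_, ?_⟩, hw.2.of_theta_smul hgs.continuous hgw⟩, hgw⟩
  -- The holomorphic factor `θ` commutes with `2D_{z̄}`, so it cancels from the equation for `w`
  -- wherever it is nonzero.
  · refine congrFun (Continuous.ext_on (dense_theta_ne_zero P) ?_ ?_ ?_)
    · exact ((contDiff_dbar hgs.fst).continuous).add (continuous_const.mul hgs.fst.continuous)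
    · exact (continuous_const.mul V.contDiff.continuous).mul hgs.snd.continuous
    · intro z hz
      have h1 := hw.1.2.1 z
      have h2 := dbar_mul hθs hgs.fst z
      rw [dbar_eq_zero hθd, mul_zero, add_zero] at h2
      have e1 : (fun z => (w z).1) = fun z => theta (z - P) * (g z).1 := by
        ext z; rw [hgw]; rfl
      rw [e1, h2, hgw] at h1
      apply mul_left_cancel₀ hz
      simp only [Prod.smul_snd, Prod.smul_fst, smul_eq_mul] at h1
      linear_combination h1
  · refine congrFun (Continuous.ext_on (dense_theta_ne_zero P) ?_ ?_ ?_)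
    · exact ((contDiff_dbar hgs.snd).continuous).add (continuous_const.mul hgs.snd.continuous)
    · exact hgs.fst.continuous
    · intro z hz
      have h1 := hw.1.2.2 z
      have h2 := dbar_mul hθs hgs.snd z
      rw [dbar_eq_zero hθd, mul_zero, add_zero] at h2
      have e1 : (fun z => (w z).2) = fun z => theta (z - P) * (g z).2 := by
        ext z; rw [hgw]; rfl
      rw [e1, h2, hgw] at h1
      apply mul_left_cancel₀ hz
      simp only [Prod.smul_snd, Prod.smul_fst, smul_eq_mul] at h1
      linear_combination h1

/-! ### The structure of the space of solutions -/

/-- The coefficient matrix of the system has zero trace, so the determinant of two solutions is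
annihilated by `2D_{z̄}`; the multipliers simply multiply. -/
lemma wronskian_mem_Theta {N N' : ℤ} {a b a' b' : ℂ} {s w : ℂ → ℂ × ℂ} (hs : s ∈ QSol V α N a b)
    (hw : w ∈ QSol V α N' a' b') :
    (fun z => (s z).1 * (w z).2 - (s z).2 * (w z).1) ∈ Theta (N + N') (a * a') (b * b') := by
  refine ⟨differentiable_of_dbar_eq_zero ?_ fun z => ?_, fun z => ?_, fun z => ?_⟩
  · exact (hs.1.1.fst.mul hw.1.1.snd).sub (hs.1.1.snd.mul hw.1.1.fst)
  · rw [dbar_sub (hs.1.1.fst.mul hw.1.1.snd) (hs.1.1.snd.mul hw.1.1.fst),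
      dbar_mul hs.1.1.fst hw.1.1.snd, dbar_mul hs.1.1.snd hw.1.1.fst]
    have h1 := hs.1.2.1 z
    have h2 := hs.1.2.2 z
    have h3 := hw.1.2.1 z
    have h4 := hw.1.2.2 z
    rw [zero_mul, add_zero] at h1 h2 h3 h4
    rw [h1, h2, h3, h4]
    ring
  · simp only [hs.2.1 z, hw.2.1 z, Prod.smul_fst, Prod.smul_snd, smul_eq_mul]
    ring
  · simp only [hs.2.2 z, hw.2.2 z, Prod.smul_fst, Prod.smul_snd, smul_eq_mul]
    have e : Complex.exp (2 * Real.pi * Complex.I * ((N + N' : ℤ) : ℂ) * z) =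
        Complex.exp (2 * Real.pi * Complex.I * N * z) *
          Complex.exp (2 * Real.pi * Complex.I * N' * z) := by
      rw [← Complex.exp_add]; congr 1; push_cast; ring
    rw [e]
    ring

/-- Solutions proportional to a nowhere vanishing one are holomorphic multiples of it. -/
lemma exists_smul_of_wronskian_eq_zero {N N' : ℤ} {a b a' b' : ℂ} (ha : a ≠ 0) (hb : b ≠ 0)
    {s w : ℂ → ℂ × ℂ} (hs : s ∈ QSol V α N a b) (hw : w ∈ QSol V α N' a' b')
    (hs0 : ∀ z, s z ≠ 0) (hW : ∀ z, (s z).1 * (w z).2 - (s z).2 * (w z).1 = 0) :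
    ∃ g ∈ Theta (N' - N) (a' / a) (b' / b), ∀ z, w z = g z • s z := by
  set n : ℂ → ℂ := fun z => (s z).1 * conj (s z).1 + (s z).2 * conj (s z).2 with hn
  have hn0 : ∀ z, n z ≠ 0 := by
    intro z h
    simp only [hn, Complex.mul_conj] at h
    have h' : Complex.normSq (s z).1 + Complex.normSq (s z).2 = 0 := by exact_mod_cast h
    have h1 := Complex.normSq_nonneg (s z).1
    have h2 := Complex.normSq_nonneg (s z).2
    exact hs0 z (Prod.ext (Complex.normSq_eq_zero.1 (by linarith))
      (Complex.normSq_eq_zero.1 (by linarith)))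
  -- The ratio is written as the Hermitian projection of `w` on `s`, which is visibly smooth because
  -- `s` has no zeros.
  set g : ℂ → ℂ := fun z => (conj (s z).1 * (w z).1 + conj (s z).2 * (w z).2) / n z with hg
  have hc1 : ContDiff ℝ ∞ fun z => conj (s z).1 := Complex.conjCLE.contDiff.comp hs.1.1.fst
  have hc2 : ContDiff ℝ ∞ fun z => conj (s z).2 := Complex.conjCLE.contDiff.comp hs.1.1.snd
  have hns : ContDiff ℝ ∞ n := (hs.1.1.fst.mul hc1).add (hs.1.1.snd.mul hc2)
  have hgs : ContDiff ℝ ∞ g := by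
    simp only [hg, div_eq_mul_inv]
    exact ((hc1.mul hw.1.1.fst).add (hc2.mul hw.1.1.snd)).mul (hns.inv hn0)
  have hwg : ∀ z, w z = g z • s z := by
    intro z
    have h := hW z
    have h0 := hn0 z
    refine Prod.ext ?_ ?_ <;> simp only [hg, Prod.smul_fst, Prod.smul_snd, smul_eq_mul] <;>
      rw [div_mul_eq_mul_div, eq_div_iff h0] <;> simp only [hn]
    · linear_combination -conj (s z).2 * h
    · linear_combination conj (s z).1 * h
  -- Subtracting `g` times the equations of `s` from those of `w = g s` leaves `(2D_{z̄} g) s = 0`.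
  have hdg : ∀ z, dbar g z = 0 := by
    intro z
    have h1 := hw.1.2.1 z
    have h2 := hw.1.2.2 z
    have h3 := hs.1.2.1 z
    have h4 := hs.1.2.2 z
    have e1 : (fun z => (w z).1) = fun z => g z * (s z).1 := by ext z; rw [hwg]; rfl
    have e2 : (fun z => (w z).2) = fun z => g z * (s z).2 := by ext z; rw [hwg]; rfl
    rw [e1, dbar_mul hgs hs.1.1.fst, hwg] at h1
    rw [e2, dbar_mul hgs hs.1.1.snd, hwg] at h2
    simp only [Prod.smul_fst, Prod.smul_snd, smul_eq_mul] at h1 h2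
    by_contra h
    refine hs0 z (Prod.ext ?_ ?_)
    · exact mul_right_cancel₀ h (by rw [Prod.fst_zero]; linear_combination h1 - g z * h3)
    · exact mul_right_cancel₀ h (by rw [Prod.snd_zero]; linear_combination h2 - g z * h4)
  refine ⟨g, ⟨differentiable_of_dbar_eq_zero hgs hdg, fun z => ?_, fun z => ?_⟩, hwg⟩
  · have h1 := hw.2.1 z
    rw [hwg, hwg, hs.2.1, smul_smul, smul_smul] at h1
    have := smul_left_injective ℂ (hs0 z) h1
    rw [smul_eq_mul, div_mul_eq_mul_div, eq_div_iff ha, this]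
  · have h1 := hw.2.2 z
    rw [hwg, hwg, hs.2.2, smul_smul, smul_smul] at h1
    have := smul_left_injective ℂ (hs0 z) h1
    have hE := Complex.exp_ne_zero (2 * Real.pi * Complex.I * N * z)
    have e : Complex.exp (2 * Real.pi * Complex.I * N' * z) =
        Complex.exp (2 * Real.pi * Complex.I * N * z) *
          Complex.exp (2 * Real.pi * Complex.I * ((N' - N : ℤ) : ℂ) * z) := by
      rw [← Complex.exp_add]; congr 1; push_cast; ring
    rw [e] at this
    rw [smul_eq_mul]
    apply mul_right_cancel₀ (mul_ne_zero hb hE)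
    rw [this]
    field_simp

/-- With a nowhere vanishing solution of degree `m ≥ 1`, the solutions of degree `0` are its
multiples by theta functions. -/
lemma finrank_QSol_zero {m : ℕ} (hm : m ≠ 0) {a₀ b₀ a b : ℂ} (ha₀ : a₀ ≠ 0) (hb₀ : b₀ ≠ 0)
    (ha : a ≠ 0) (hb : b ≠ 0) {s : ℂ → ℂ × ℂ} (hs : s ∈ QSol V α m a₀ b₀) (hs0 : ∀ z, s z ≠ 0) :
    Module.rank ℂ (QSol V α 0 a b) = m := by
  have hmem : ∀ g ∈ Theta (-m) (a / a₀) (b / b₀), (fun z => g z • s z) ∈ QSol V α 0 a b := by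
    intro g hg
    have := smul_mem_QSol hg hs
    rwa [neg_add_cancel, div_mul_cancel₀ _ ha₀, div_mul_cancel₀ _ hb₀] at this
  let F : Theta (-m) (a / a₀) (b / b₀) →ₗ[ℂ] QSol V α 0 a b :=
    { toFun := fun g => ⟨fun z => g.1 z • s z, hmem g.1 g.2⟩
      map_add' := fun g g' => Subtype.ext (funext fun z => add_smul _ _ _)
      map_smul' := fun c g => Subtype.ext (funext fun z => mul_smul c (g.1 z) _) }
  have hF : Function.Bijective F := by
    constructor
    · intro g g' h
      refine Subtype.ext (funext fun z => ?_)
      exact smul_left_injective ℂ (hs0 z) (congrFun (congrArg Subtype.val h) z)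
    · rintro ⟨w, hw⟩
      -- The Wronskian has index `m > 0`, the wrong sign for a nonzero entire function.
      have hW := Theta_eq_zero_of_neg (mul_ne_zero ha₀ ha) (mul_ne_zero hb₀ hb) hm
        (by simpa using wronskian_mem_Theta hs hw)
      obtain ⟨g, hg, hgw⟩ := exists_smul_of_wronskian_eq_zero ha₀ hb₀ hs hw hs0 (congrFun hW)
      exact ⟨⟨g, by simpa using hg⟩, Subtype.ext (funext fun z => (hgw z).symm)⟩
  rw [← (LinearEquiv.ofBijective F hF).rank_eq]
  obtain ⟨h1, h2⟩ := finrank_Theta (div_ne_zero ha ha₀) (div_ne_zero hb hb₀) hm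
  rw [← Module.finrank_eq_rank, h2]

/-- A solution of degree `N` bounds the dimension of the periodic solutions from below. -/
lemma le_finrank_QSol {N : ℕ} {a b : ℂ} (ha : a ≠ 0) (hb : b ≠ 0) {w : ℂ → ℂ × ℂ}
    (hw : w ∈ QSol V α N a b) (hw0 : w ≠ 0) [Module.Finite ℂ (QSol V α 0 1 1)] :
    N ≤ Module.finrank ℂ (QSol V α 0 1 1) := by
  rcases Nat.eq_zero_or_pos N with rfl | hN
  · exact Nat.zero_le _
  have hmem : ∀ g ∈ Theta (-N) (1 / a) (1 / b), (fun z => g z • w z) ∈ QSol V α 0 1 1 := by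
    intro g hg
    have := smul_mem_QSol hg hw
    rwa [neg_add_cancel, div_mul_cancel₀ _ ha, div_mul_cancel₀ _ hb] at this
  let F : Theta (-N) (1 / a) (1 / b) →ₗ[ℂ] QSol V α 0 1 1 :=
    { toFun := fun g => ⟨fun z => g.1 z • w z, hmem g.1 g.2⟩
      map_add' := fun g g' => Subtype.ext (funext fun z => add_smul _ _ _)
      map_smul' := fun c g => Subtype.ext (funext fun z => mul_smul c (g.1 z) _) }
  have hF : Function.Injective F := by
    rw [injective_iff_map_eq_zero]
    intro g hg
    have h0 : ∀ z, g.1 z • w z = 0 := congrFun (congrArg Subtype.val hg)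
    obtain ⟨z₁, hz₁⟩ : ∃ z, w z ≠ 0 := by
      by_contra! h; exact hw0 (funext h)
    -- Although `w` may have zeros, `g` vanishes near a point where `w` does not, and the identity
    -- theorem does the rest.
    have hev : ∀ᶠ z in nhds z₁, g.1 z = 0 := by
      filter_upwards [hw.1.1.continuous.continuousAt.eventually_ne hz₁] with z hz
      exact (smul_eq_zero.1 (h0 z)).resolve_right hz
    have han : AnalyticOnNhd ℂ g.1 univ := fun z _ => g.2.1.analyticAt z
    exact Subtype.ext (funext fun z =>
      han.eqOn_zero_of_preconnected_of_eventuallyEq_zero isPreconnected_univ (mem_univ z₁) hev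
        (mem_univ z))
  obtain ⟨h1, h2⟩ := finrank_Theta (n := N) (one_div_ne_zero ha) (one_div_ne_zero hb) (by omega)
  have := LinearMap.finrank_le_finrank_of_injective hF
  omega

/-- The zeros of a periodic solution can be divided out, and their number is the degree of the
nowhere vanishing quotient. -/
lemma exists_nowhere_zero_solution [Module.Finite ℂ (QSol V α 0 1 1)] {u : ℂ → ℂ × ℂ}
    (hu : u ∈ QSol V α 0 1 1) (hu0 : u ≠ 0) :
    ∃ (m : ℕ) (a b : ℂ) (s : ℂ → ℂ × ℂ), a ≠ 0 ∧ b ≠ 0 ∧ s ∈ QSol V α m a b ∧ (∀ z, s z ≠ 0) ∧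
      zeroCount u = m ∧ (m = 0 → s = u) := by
  by_contra hcon
  -- If no quotient were free of zeros, division could be repeated `N` times for every `N`, against
  -- `le_finrank_QSol`. The function `c` records how many zeros were removed at each point of the
  -- cell.
  have key : ∀ N : ℕ, ∃ (a b : ℂ) (w : ℂ → ℂ × ℂ) (c : cell → ℕ∞), a ≠ 0 ∧ b ≠ 0 ∧
      w ∈ QSol V α N a b ∧ w ≠ 0 ∧ (N = 0 → w = u) ∧ (Function.support c).Finite ∧
      ∑ᶠ z, c z = N ∧ ∀ z : cell, zeroMult u z = zeroMult w z + c z := by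
    intro N
    induction N with
    | zero =>
      exact ⟨1, 1, u, 0, one_ne_zero, one_ne_zero, hu, hu0, fun _ => rfl, by simp, by simp,
        by simp⟩
    | succ N ih =>
      obtain ⟨a, b, w, c, ha, hb, hw, hw0, hN, hc, hcN, hmult⟩ := ih
      obtain ⟨P, hP⟩ : ∃ P, w P = 0 := by
        by_contra! hP
        refine hcon ⟨N, a, b, w, ha, hb, hw, hP, ?_, hN⟩
        have : ∀ z : cell, zeroMult u z = c z := fun z => by
          rw [hmult, zeroMult_eq_zero (hP z), zero_add]
        rw [zeroCount, funext this, tsum_eq_finsum hc, hcN]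
      obtain ⟨g, hg, hgw⟩ := exists_theta_quotient_of_mem_QSol ha hb hw hP
      obtain ⟨p, hp⟩ := exists_unique_theta_zero P
      classical
      have hsupp : (Function.support (fun z : cell => if z = p then (1 : ℕ∞) else 0)).Finite :=
        (Set.finite_singleton p).subset fun z hz => by
          by_contra h
          exact hz (if_neg h)
      refine ⟨_, _, g, fun z => c z + if z = p then 1 else 0, ha,
        neg_ne_zero.2 (mul_ne_zero hb (Complex.exp_ne_zero _)), by exact_mod_cast hg, ?_, by simp,
        (hc.union hsupp).subset (Function.support_add _ _), ?_, fun z => ?_⟩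
      · rintro rfl
        exact hw0 (funext fun z => by simp [hgw])
      · rw [finsum_add_distrib hc hsupp, hcN, finsum_eq_single _ p fun z hz => if_neg hz]
        simp
      · rw [hmult, funext hgw, zeroMult_theta_smul hg.1.1, add_assoc]
        simp only [hp, add_comm (c z)]
  obtain ⟨a, b, w, -, ha, hb, hw, hw0, -⟩ := key (Module.finrank ℂ (QSol V α 0 1 1) + 1)
  have := le_finrank_QSol ha hb hw hw0
  omega

/-- The number of zeros of periodic solutions, and the dimension of the spaces of quasi-periodic
ones, when there is a solution with multipliers not coming from an exponential. -/
theorem solutions_structure [Module.Finite ℂ (QSol V α 0 1 1)] {a b : ℂ} (ha : a ≠ 0) (hb : b ≠ 0)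
    (hab : ∀ c, a = Complex.exp c → b ≠ Complex.exp (c * omega)) (hne : QSol V α 0 a b ≠ ⊥)
    (hne1 : QSol V α 0 1 1 ≠ ⊥) :
    ∃ m : ℕ, (∀ u ∈ QSol V α 0 1 1, u ≠ 0 → zeroCount u = m) ∧
      ∀ a b : ℂ, a ≠ 0 → b ≠ 0 → Module.rank ℂ (QSol V α 0 a b) = m := by
  have main : ∀ u ∈ QSol V α 0 1 1, u ≠ 0 → ∃ m : ℕ, zeroCount u = m ∧
      ∀ a b : ℂ, a ≠ 0 → b ≠ 0 → Module.rank ℂ (QSol V α 0 a b) = m := by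
    intro u hu hu0
    obtain ⟨m, a₀, b₀, s, ha₀, hb₀, hs, hs0, hm, hms⟩ := exists_nowhere_zero_solution hu hu0
    refine ⟨m, hm, fun a' b' ha' hb' => ?_⟩
    refine finrank_QSol_zero (fun h0 => hne ?_) ha₀ hb₀ ha' hb' hs hs0
    -- If `m = 0`, then `u` itself has no zeros. A solution `w` with the non-exponential multipliers
    -- `(a, b)` has Wronskian with `u` in a zero space, so `w = g u`, and `g` lies in the same zero
    -- space. This contradicts `hne`.
    rw [hms h0] at hs0
    rw [Submodule.eq_bot_iff]
    intro w hw
    have hW := Theta_zero_eq_zero (h := fun z => (u z).1 * (w z).2 - (u z).2 * (w z).1) ha hb hab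
      (by simpa using wronskian_mem_Theta hu hw)
    obtain ⟨g, hg, hgw⟩ := exists_smul_of_wronskian_eq_zero one_ne_zero one_ne_zero hu hw hs0
      (congrFun hW)
    have hg0 : g = 0 := Theta_zero_eq_zero ha hb hab (by simpa using hg)
    ext z <;> simp [hgw, hg0]
  obtain ⟨u₀, hu₀, hu₀0⟩ := Submodule.exists_mem_ne_zero_of_ne_bot hne1
  obtain ⟨m, -, hm⟩ := main u₀ hu₀ hu₀0
  refine ⟨m, fun u hu hu0 => ?_, hm⟩
  obtain ⟨m', h1, h2⟩ := main u hu hu0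
  rw [h1]
  -- Two solutions have equally many zeros because both numbers are the dimension of the space of
  -- periodic solutions.
  have := (h2 1 1 one_ne_zero one_ne_zero).symm.trans (hm 1 1 one_ne_zero one_ne_zero)
  exact_mod_cast this

/-! ### Removing the quasi-momentum -/

/-- Periodic smooth solutions of the system with quasi-momentum `k`. -/
def PerSol (V : Potential) (α k : ℂ) : Submodule ℂ (ℂ → ℂ × ℂ) :=
  Sol V α k ⊓ quasiPeriodic 0 1 1

lemma dbar_exp_conj (c z : ℂ) : dbar (fun z => Complex.exp (c * conj z)) z =
    -(2 * Complex.I * c) * Complex.exp (c * conj z) := by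
  have h1 : HasFDerivAt (fun z : ℂ => c * conj z) (c • Complex.conjCLE.toContinuousLinearMap) z :=
    Complex.conjCLE.hasFDerivAt.const_mul c
  have h2 := h1.cexp.fderiv
  simp only [dbar, h2]
  simp
  ring_nf
  simp
  ring

/-- The exponent `c = i(k - k')/2` is the one for which `2D_{z̄} e^{c z̄} = (k - k') e^{c z̄}`. -/
lemma exp_conj_smul_mem_Sol {k k' : ℂ} {w : ℂ → ℂ × ℂ} (hw : w ∈ Sol V α k) :
    (fun z => Complex.exp (Complex.I * (k - k') / 2 * conj z) • w z) ∈ Sol V α k' := by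
  have hc : ContDiff ℝ ∞ fun z : ℂ => conj z := Complex.conjCLE.contDiff
  have hs : ContDiff ℝ ∞ fun z => Complex.exp (Complex.I * (k - k') / 2 * conj z) :=
    (contDiff_const.mul hc).cexp
  refine ⟨hs.smul hw.1, fun z => ?_, fun z => ?_⟩
  · have := dbar_mul hs hw.1.fst z
    simp only [Prod.smul_fst, Prod.smul_snd, smul_eq_mul] at this ⊢
    rw [this, dbar_exp_conj]
    linear_combination Complex.exp (Complex.I * (k - k') / 2 * conj z) * hw.2.1 z -
      (w z).1 * (k - k') * Complex.exp (Complex.I * (k - k') / 2 * conj z) * Complex.I_mul_I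
  · have := dbar_mul hs hw.1.snd z
    simp only [Prod.smul_fst, Prod.smul_snd, smul_eq_mul] at this ⊢
    rw [this, dbar_exp_conj]
    linear_combination Complex.exp (Complex.I * (k - k') / 2 * conj z) * hw.2.2 z -
      (w z).2 * (k - k') * Complex.exp (Complex.I * (k - k') / 2 * conj z) * Complex.I_mul_I

lemma isQuasiPeriodic_exp_conj (c : ℂ) :
    IsQuasiPeriodic 0 (Complex.exp c) (Complex.exp (c * conj omega))
      fun z => Complex.exp (c * conj z) := by
  refine ⟨fun z => ?_, fun z => ?_⟩ <;> simp [mul_add, Complex.exp_add, mul_comm]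

/-- Multiplication by `e^{ikz̄/2}` removes the quasi-momentum. -/
def gaugeEquiv (V : Potential) (α k : ℂ) : PerSol V α k ≃ₗ[ℂ]
    QSol V α 0 (Complex.exp (Complex.I * k / 2)) (Complex.exp (Complex.I * k / 2 * conj omega)) where
  toFun w := ⟨fun z => Complex.exp (Complex.I * k / 2 * conj z) • w.1 z, by
    refine ⟨by simpa using exp_conj_smul_mem_Sol (k' := 0) w.2.1, ?_⟩
    simpa using! (isQuasiPeriodic_exp_conj (Complex.I * k / 2)).smul w.2.2⟩
  invFun w := ⟨fun z => Complex.exp (-(Complex.I * k / 2) * conj z) • w.1 z, by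
    refine ⟨?_, ?_⟩
    · have := exp_conj_smul_mem_Sol (k' := k) w.2.1
      rwa [show Complex.I * (0 - k) / 2 = -(Complex.I * k / 2) by ring] at this
    · have h := (isQuasiPeriodic_exp_conj (-(Complex.I * k / 2))).smul w.2.2
      rw [← Complex.exp_add, ← Complex.exp_add, ← add_mul, neg_add_cancel, zero_mul,
        Complex.exp_zero, add_zero] at h
      exact h⟩
  map_add' w w' := Subtype.ext (funext fun z => smul_add _ _ _)
  map_smul' c w := Subtype.ext (funext fun z => smul_comm _ c (w.1 z))
  left_inv w := Subtype.ext (funext fun z => by simp [smul_smul, ← Complex.exp_add])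
  right_inv w := Subtype.ext (funext fun z => by simp [smul_smul, ← Complex.exp_add])

/-- The number of zeros of periodic solutions and the dimension of the spaces of periodic
solutions at all quasi-momenta. -/
theorem periodic_solutions_structure [Module.Finite ℂ (PerSol V α 0)]
    (hne : ∀ k, PerSol V α k ≠ ⊥) :
    ∃ m : ℕ, (∀ u ∈ PerSol V α 0, u ≠ 0 → zeroCount u = m) ∧
      ∀ k : ℂ, Module.rank ℂ (PerSol V α k) = m := by
  have hfin : Module.Finite ℂ (QSol V α 0 1 1) := ‹Module.Finite ℂ (PerSol V α 0)›
  have hp := omega_im_pos.ne'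
  -- This makes `c₀ = ik/2 = π/(2 Im ω)` real. If `e^{c₀}` and `e^{c₀ ω̄}` were the multipliers of
  -- an exponential `e^{cz}`, then `c = c₀ - 2πi n`; the real part of `c₀ω̄ = cω + 2πi l` forces `n
  -- = 0`, and the imaginary part then gives `4l = -2`.
  set k : ℂ := Real.pi / (Complex.I * omega.im) with hk
  have hk2 : Complex.I * k / 2 = Real.pi / (2 * omega.im) := by
    have : (omega.im : ℂ) ≠ 0 := by exact_mod_cast hp
    rw [hk]; field_simp
  have hgen : QSol V α 0 (Complex.exp (Complex.I * k / 2))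
      (Complex.exp (Complex.I * k / 2 * conj omega)) ≠ ⊥ := by
    intro h
    obtain ⟨w, hw, hw0⟩ := Submodule.exists_mem_ne_zero_of_ne_bot (hne k)
    have h1 : gaugeEquiv V α k ⟨w, hw⟩ = 0 := by
      exact Subtype.ext ((Submodule.eq_bot_iff _).1 h _ (gaugeEquiv V α k ⟨w, hw⟩).2)
    rw [map_eq_zero_iff _ (gaugeEquiv V α k).injective] at h1
    exact hw0 (congrArg Subtype.val h1)
  obtain ⟨m, h1, h2⟩ := solutions_structure (Complex.exp_ne_zero _) (Complex.exp_ne_zero _) (by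
    intro c hc hc'
    rw [Complex.exp_eq_exp_iff_exists_int] at hc hc'
    obtain ⟨n, hn⟩ := hc
    obtain ⟨l, hl⟩ := hc'
    have e : c = Complex.I * k / 2 - n * (2 * Real.pi * Complex.I) := by rw [hn]; ring
    rw [e, hk2] at hl
    have hi := congrArg Complex.im hl
    have hr := congrArg Complex.re hl
    have hq : ((Real.pi : ℂ) / (2 * omega.im)) = ((Real.pi / (2 * omega.im) : ℝ) : ℂ) := by
      push_cast; rfl
    rw [hq] at hi hr
    simp [-Complex.ofReal_div, Complex.sub_re, Complex.sub_im] at hi hr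
    have hn0 : n = 0 := by
      rcases hr with h | h
      · exact h
      · exact absurd h hp
    rw [hn0] at hi
    field_simp at hi
    have : (4 * l : ℝ) = -2 := by simp at hi; nlinarith [Real.pi_pos]
    have h4 : 4 * l = -2 := by exact_mod_cast this
    omega) hgen (hne 0)
  refine ⟨m, h1, fun k => ?_⟩
  rw [(gaugeEquiv V α k).rank_eq]
  exact h2 _ _ (Complex.exp_ne_zero _) (Complex.exp_ne_zero _)

/-! ### Characters of `ℂ/Λ` -/

/-- The linear form `v ↦ 2πi (n₁ s(v) + n₂ t(v))`, where `v = s(v) + t(v) ω`. -/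
def freq (n : ℤ × ℤ) : ℂ →L[ℝ] ℂ :=
  (2 * Real.pi * Complex.I : ℂ) • (Complex.ofRealCLM ∘L ((n.1 : ℝ) • coordS + (n.2 : ℝ) • coordT))

lemma freq_apply (n : ℤ × ℤ) (v : ℂ) :
    freq n v = 2 * Real.pi * Complex.I * (n.1 * coordS v + n.2 * coordT v) := by
  simp [freq, mul_add]

lemma freq_add (n m : ℤ × ℤ) (v : ℂ) : freq (n + m) v = freq n v + freq m v := by
  simp only [freq_apply, Prod.fst_add, Prod.snd_add]; push_cast; ring

lemma freq_neg (n : ℤ × ℤ) (v : ℂ) : freq (-n) v = -freq n v := by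
  simp only [freq_apply, Prod.fst_neg, Prod.snd_neg]; push_cast; ring

lemma conj_freq (n : ℤ × ℤ) (v : ℂ) : conj (freq n v) = -freq n v := by
  simp only [freq_apply, map_mul, map_add, Complex.conj_I, Complex.conj_ofReal, map_intCast,
    map_ofNat]
  ring

/-- The character `e^{2πi (n₁ s + n₂ t)}` of `ℂ/Λ`. -/
def chi (n : ℤ × ℤ) (z : ℂ) : ℂ := Complex.exp (freq n z)

lemma contDiff_chi (n : ℤ × ℤ) : ContDiff ℝ ∞ (chi n) := (freq n).contDiff.cexp

lemma hasFDerivAt_chi (n : ℤ × ℤ) (z : ℂ) : HasFDerivAt (chi n) (chi n z • freq n) z :=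
  (freq n).hasFDerivAt.cexp

lemma chi_apply_add (n : ℤ × ℤ) (z w : ℂ) : chi n (z + w) = chi n z * chi n w := by
  simp only [chi, map_add, Complex.exp_add]

lemma chi_add (n m : ℤ × ℤ) (z : ℂ) : chi (n + m) z = chi n z * chi m z := by
  simp only [chi, freq_add, Complex.exp_add]

lemma chi_zero (z : ℂ) : chi 0 z = 1 := by simp [chi, freq_apply]

lemma conj_chi (n : ℤ × ℤ) (z : ℂ) : conj (chi n z) = chi (-n) z := by
  rw [chi, ← Complex.exp_conj, conj_freq, chi, freq_neg]

lemma norm_chi (n : ℤ × ℤ) (z : ℂ) : ‖chi n z‖ = 1 := by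
  rw [chi, Complex.norm_exp, freq_apply]
  simp

lemma isTest_chi (n : ℤ × ℤ) : IsTest (chi n) := by
  refine ⟨contDiff_chi n, fun a b z => ?_⟩
  rw [chi_apply_add]
  have h1 := coord_add 0 a b
  simp only [zero_add, map_zero] at h1
  have : chi n (a + b * omega) = 1 := by
    rw [chi, freq_apply, h1.1, h1.2, Complex.exp_eq_one_iff]
    exact ⟨n.1 * a + n.2 * b, by push_cast; ring⟩
  rw [this, mul_one]

/-! ### Integration over the fundamental parallelogram -/

/-- The lattice `Λ` as a subgroup of `ℂ`. -/
def lattice : AddSubgroup ℂ where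
  carrier := {γ | ∃ m n : ℤ, γ = m + n * omega}
  zero_mem' := ⟨0, 0, by simp⟩
  add_mem' := by
    rintro _ _ ⟨m, n, rfl⟩ ⟨m', n', rfl⟩
    exact ⟨m + m', n + n', by push_cast; ring⟩
  neg_mem' := by
    rintro _ ⟨m, n, rfl⟩
    exact ⟨-m, -n, by push_cast; ring⟩

instance : Countable lattice := by
  have : Function.Surjective fun p : ℤ × ℤ => (⟨p.1 + p.2 * omega, p.1, p.2, rfl⟩ : lattice) := by
    rintro ⟨_, m, n, rfl⟩
    exact ⟨(m, n), rfl⟩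
  exact this.countable

lemma isAddFundamentalDomain_translate (c : ℂ) :
    IsAddFundamentalDomain lattice ((fun z => z + c) ⁻¹' cell) volume := by
  refine IsAddFundamentalDomain.mk'
    (measurableSet_cell.preimage (measurable_add_const c)).nullMeasurableSet fun z => ?_
  obtain ⟨m, n, h⟩ := exists_add_mem_cell (z + c)
  refine ⟨⟨m + n * omega, m, n, rfl⟩, ?_, ?_⟩
  · change (m + n * omega) + z + c ∈ cell
    rwa [show (m : ℂ) + n * omega + z + c = z + c + (m + n * omega) by ring]
  · rintro ⟨_, m', n', rfl⟩ h'
    change (m' + n' * omega) + z + c ∈ cell at h'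
    rw [show (m' : ℂ) + n' * omega + z + c =
      z + c + (m + n * omega) + ((m' - m : ℤ) + (n' - n : ℤ) * omega) by push_cast; ring] at h'
    obtain ⟨h1, h2⟩ := eq_of_mem_cell h h'
    obtain rfl : m' = m := by omega
    obtain rfl : n' = n := by omega
    rfl

/-- A translate of the cell is again a fundamental domain, and a periodic function has the same
integral over all of them. -/
lemma integral_translate {F : ℂ → ℂ} (hF : IsPeriodic F) (c : ℂ) :
    ∫ z, F (z + c) ∂cellMeasure = ∫ z, F z ∂cellMeasure := by
  have h1 : ∫ z in cell, F z = ∫ z in (fun z => z + -c) ⁻¹' cell, F z := by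
    have h0 := isAddFundamentalDomain_translate 0
    simp only [add_zero, preimage_id'] at h0
    refine h0.setIntegral_eq (isAddFundamentalDomain_translate (-c)) ?_
    rintro ⟨_, m, n, rfl⟩ z
    change F (m + n * omega + z) = F z
    rw [add_comm, hF]
  rw [h1]
  have h2 := (measurePreserving_add_right (volume : Measure ℂ) c).setIntegral_preimage_emb
    (measurableEmbedding_addRight c) F ((fun z => z + -c) ⁻¹' cell)
  have e : (fun z => z + c) ⁻¹' ((fun z => z + -c) ⁻¹' cell) = cell := by
    ext z; simp
  rw [e] at h2
  exact h2

lemma integrable_of_continuous {F : ℂ → ℂ} (hF : Continuous F) : Integrable F cellMeasure :=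
  (memLp_top_of_continuous hF).integrable le_top

lemma IsPeriodic.fderiv {F : ℂ → ℂ} (hF : IsPeriodic F) (v : ℂ) :
    IsPeriodic fun z => fderiv ℝ F z v := by
  intro m n z
  have h : (fun z => F (z + (m + n * omega))) = F := funext fun z => hF m n z
  have h2 := fderiv_comp_add_right (𝕜 := ℝ) (f := F) (x := z) ((m : ℂ) + n * omega)
  rw [h] at h2
  simp only [← h2]

lemma IsTest.fderiv {F : ℂ → ℂ} (hF : IsTest F) (v : ℂ) : IsTest fun z => fderiv ℝ F z v :=
  ⟨(hF.1.fderiv_right (m := ∞) (by simp)).clm_apply contDiff_const, hF.2.fderiv v⟩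

lemma IsTest.mul {f g : ℂ → ℂ} (hf : IsTest f) (hg : IsTest g) : IsTest fun z => f z * g z :=
  ⟨hf.1.mul hg.1, fun m n z => by simp only [hf.2 m n, hg.2 m n]⟩

lemma IsTest.conj {f : ℂ → ℂ} (hf : IsTest f) : IsTest fun z => conj (f z) :=
  ⟨Complex.conjCLE.contDiff.comp hf.1, fun m n z => by simp only [hf.2 m n]⟩

/-- The integral of a derivative of a periodic function vanishes. -/
lemma integral_fderiv_eq_zero {F : ℂ → ℂ} (hF : IsTest F) (v : ℂ) :
    ∫ z, fderiv ℝ F z v ∂cellMeasure = 0 := by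
  obtain ⟨C, hC⟩ := (hF.fderiv v).2.exists_bound (hF.fderiv v).1.continuous
  -- The integral of `F(z + t v)` does not depend on `t`; its derivative at `t = 0` is the integral
  -- in question.
  have hd := hasDerivAt_integral_of_dominated_loc_of_deriv_le (μ := cellMeasure)
    (F := fun (t : ℝ) z => F (z + t • v)) (F' := fun (t : ℝ) z => fderiv ℝ F (z + t • v) v)
    (x₀ := 0) (s := univ) (bound := fun _ => C) Filter.univ_mem
    (Filter.Eventually.of_forall fun t =>
      (hF.1.continuous.comp (by fun_prop)).aestronglyMeasurable)
    (integrable_of_continuous (hF.1.continuous.comp (by fun_prop)))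
    ((hF.fderiv v).1.continuous.comp (by fun_prop)).aestronglyMeasurable
    (Filter.Eventually.of_forall fun z t _ => hC _) (integrable_const C)
    (Filter.Eventually.of_forall fun z t _ => by
      have h1 : HasDerivAt (fun t : ℝ => z + t • v) v t := by
        simpa using ((hasDerivAt_id t).smul_const v).const_add z
      exact (hF.1.differentiable (by simp) (z + t • v)).hasFDerivAt.comp_hasDerivAt t h1)
  have h2 := hd.2
  simp only [integral_translate hF.2, zero_smul, add_zero] at h2
  exact h2.unique (hasDerivAt_const _ _)

lemma integral_fderiv_mul {f g : ℂ → ℂ} (hf : IsTest f) (hg : IsTest g) (v : ℂ) :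
    ∫ z, f z * fderiv ℝ g z v ∂cellMeasure = -∫ z, fderiv ℝ f z v * g z ∂cellMeasure := by
  have h := integral_fderiv_eq_zero (hf.mul hg) v
  have e : ∀ z, fderiv ℝ (fun z => f z * g z) z v = f z * fderiv ℝ g z v + fderiv ℝ f z v * g z := by
    intro z
    have h : fderiv ℝ (fun z => f z * g z) z = f z • fderiv ℝ g z + g z • fderiv ℝ f z :=
      fderiv_fun_mul (hf.1.differentiable (by simp) z) (hg.1.differentiable (by simp) z)
    rw [h]
    simp [mul_comm]
  simp only [e] at h
  rw [integral_add (integrable_of_continuous (hf.mul (hg.fderiv v)).1.continuous)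
    (integrable_of_continuous ((hf.fderiv v).mul hg).1.continuous)] at h
  linear_combination h

/-- At `c = 1/(2n₁)`, or `c = ω/(2n₂)` when `n₁ = 0`, the phase is half a turn. -/
lemma exists_chi_ne_one {n : ℤ × ℤ} (hn : n ≠ 0) : ∃ c, chi n c ≠ 1 := by
  have h0 : ∀ c, chi n c = 1 → ∃ k : ℤ, (n.1 : ℝ) * coordS c + n.2 * coordT c = k := by
    intro c hc
    rw [chi, freq_apply, Complex.exp_eq_one_iff] at hc
    obtain ⟨k, hk⟩ := hc
    refine ⟨k, ?_⟩
    have := mul_left_cancel₀ Complex.two_pi_I_ne_zero (hk.trans (mul_comm _ _))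
    exact_mod_cast this
  by_contra! hall
  by_cases h1 : n.1 = 0
  · have h2 : n.2 ≠ 0 := fun h2 => hn (Prod.ext h1 h2)
    obtain ⟨k, hk⟩ := h0 _ (hall (((0 : ℝ) : ℂ) + ((1 / (2 * n.2) : ℝ) : ℂ) * omega))
    rw [coordS_mk, coordT_mk] at hk
    have h2' : (n.2 : ℝ) ≠ 0 := by exact_mod_cast h2
    field_simp at hk
    have : (1 : ℤ) = 2 * k := by exact_mod_cast (by linarith : (1 : ℝ) = 2 * k)
    omega
  · obtain ⟨k, hk⟩ := h0 _ (hall (((1 / (2 * n.1) : ℝ) : ℂ) + ((0 : ℝ) : ℂ) * omega))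
    rw [coordS_mk, coordT_mk] at hk
    have h2' : (n.1 : ℝ) ≠ 0 := by exact_mod_cast h1
    field_simp at hk
    have : (1 : ℤ) = 2 * k := by exact_mod_cast (by linarith : (1 : ℝ) = 2 * k)
    omega

/-- Translation by `c` preserves the integral and multiplies it by `χ(c) ≠ 1`. -/
lemma integral_chi {n : ℤ × ℤ} (hn : n ≠ 0) : ∫ z, chi n z ∂cellMeasure = 0 := by
  obtain ⟨c, hc⟩ := exists_chi_ne_one hn
  have h := integral_translate (isTest_chi n).2 c
  simp only [chi_apply_add] at h
  rw [integral_mul_const] at h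
  have : (∫ z, chi n z ∂cellMeasure) * (chi n c - 1) = 0 := by linear_combination h
  exact (mul_eq_zero.1 this).resolve_right (sub_ne_zero.2 hc)

/-! ### Completeness of the characters -/

/-- The projection of `ℝ²` to the torus. -/
def torusProj : C(Fin 2 → ℝ, UnitAddTorus (Fin 2)) :=
  ⟨Pi.map fun _ => ((↑) : ℝ → UnitAddCircle), by
    exact Continuous.piMap fun _ => AddCircle.continuous_mk' 1⟩

lemma isQuotientMap_torusProj : Topology.IsQuotientMap torusProj :=
  (IsOpenQuotientMap.piMap fun _ : Fin 2 => QuotientAddGroup.isOpenQuotientMap_mk).isQuotientMap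

lemma mFourier_torusProj (n : Fin 2 → ℤ) (z : ℂ) :
    UnitAddTorus.mFourier n (torusProj ![coordS z, coordT z]) = chi (n 0, n 1) z := by
  simp only [UnitAddTorus.mFourier, torusProj, ContinuousMap.coe_mk, Pi.map_apply, Fin.prod_univ_two,
    Matrix.cons_val_zero, Matrix.cons_val_one, fourier_coe_apply, chi, freq_apply,
    ← Complex.exp_add]
  congr 1
  push_cast
  ring

/-- An element of `L²(ℂ/Λ)` orthogonal to all characters vanishes. -/
lemma eq_zero_of_forall_chi {h : L2} (hh : ∀ n, ∫ z, h z * chi n z ∂cellMeasure = 0) : h = 0 := by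
  refine eq_zero_of_forall_test fun φ hφ => ?_
  have hint : Integrable (fun z => h z) cellMeasure := (Lp.memLp h).integrable (by norm_num)
  set φ' : C(Fin 2 → ℝ, ℂ) := ⟨fun x => φ (x 0 + x 1 * omega), hφ.1.continuous.comp (by fun_prop)⟩
    with hφ'
  set Φ : C(UnitAddTorus (Fin 2), ℂ) := isQuotientMap_torusProj.lift φ' (by
    intro x y hxy
    have h0 : ((x 0 : ℝ) : UnitAddCircle) = y 0 := congrFun hxy 0
    have h1 : ((x 1 : ℝ) : UnitAddCircle) = y 1 := congrFun hxy 1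
    rw [← sub_eq_zero, ← AddCircle.coe_sub, AddCircle.coe_eq_zero_iff] at h0 h1
    obtain ⟨m, hm⟩ := h0
    obtain ⟨n, hn⟩ := h1
    have e0 : x 0 = y 0 + m := by
      rw [zsmul_eq_mul, mul_one] at hm; linarith
    have e1 : x 1 = y 1 + n := by
      rw [zsmul_eq_mul, mul_one] at hn; linarith
    change φ (x 0 + x 1 * omega) = φ (y 0 + y 1 * omega)
    rw [← hφ.2 m n (y 0 + y 1 * omega), e0, e1]
    congr 1
    push_cast
    ring) with hΦ
  have hΦφ : ∀ z, Φ (torusProj ![coordS z, coordT z]) = φ z := by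
    intro z
    have : Φ.comp torusProj = φ' := isQuotientMap_torusProj.lift_comp _ _
    change (Φ.comp torusProj) _ = _
    rw [this]
    change φ (coordS z + coordT z * omega) = φ z
    rw [← coord_eq]
  have hcont : ∀ F : C(UnitAddTorus (Fin 2), ℂ),
      Continuous fun z => F (torusProj ![coordS z, coordT z]) := by
    intro F
    refine F.continuous.comp (torusProj.continuous.comp (continuous_pi fun i => ?_))
    fin_cases i
    · exact coordS.continuous
    · exact coordT.continuous
  have hspan : ∀ F ∈ Submodule.span ℂ (range (UnitAddTorus.mFourier (d := Fin 2))),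
      ∫ z, h z * F (torusProj ![coordS z, coordT z]) ∂cellMeasure = 0 := by
    intro F hF
    induction hF using Submodule.span_induction with
    | mem F hF =>
      obtain ⟨n, rfl⟩ := hF
      simp only [mFourier_torusProj]
      exact hh _
    | zero => simp
    | add F G _ _ hF hG =>
      simp only [ContinuousMap.add_apply, mul_add]
      rw [integral_add (integrable_mul h (hcont F)) (integrable_mul h (hcont G)), hF, hG, add_zero]
    | smul c F _ hF =>
      simp only [ContinuousMap.smul_apply, smul_eq_mul, mul_left_comm _ c]
      rw [integral_const_mul, hF, mul_zero]
  -- The test function descends to a continuous `Φ` on the torus, which is uniformly approximated by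
  -- trigonometric polynomials; `h` is orthogonal to these, so only the error `ε` times the `L¹`
  -- norm of `h` remains.
  have hbound : ∀ ε > 0, ‖∫ z, h z * φ z ∂cellMeasure‖ ≤ ε * ∫ z, ‖h z‖ ∂cellMeasure := by
    intro ε hε
    have hmem : Φ ∈ closure (Submodule.span ℂ (range (UnitAddTorus.mFourier (d := Fin 2))) :
        Set C(UnitAddTorus (Fin 2), ℂ)) := by
      rw [← Submodule.topologicalClosure_coe, UnitAddTorus.span_mFourier_closure_eq_top]
      trivial
    obtain ⟨F, hF, hd⟩ := Metric.mem_closure_iff.1 hmem ε hε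
    have e : ∫ z, h z * φ z ∂cellMeasure =
        ∫ z, h z * (Φ - F) (torusProj ![coordS z, coordT z]) ∂cellMeasure := by
      simp only [ContinuousMap.sub_apply, hΦφ, mul_sub]
      rw [integral_sub (integrable_mul h hφ.1.continuous) (integrable_mul h (hcont F)),
        hspan F hF, sub_zero]
    rw [e, ← integral_const_mul]
    refine norm_integral_le_of_norm_le (hint.norm.const_mul ε) (Filter.Eventually.of_forall
      fun z => ?_)
    rw [norm_mul, mul_comm]
    refine mul_le_mul_of_nonneg_right ?_ (norm_nonneg _)
    exact ((Φ - F).norm_coe_le_norm _).trans (by rw [← dist_eq_norm]; exact hd.le)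
  have hlim : ‖∫ z, h z * φ z ∂cellMeasure‖ ≤ 0 := by
    refine le_of_forall_pos_le_add fun δ hδ => ?_
    have hI : 0 ≤ ∫ z, ‖h z‖ ∂cellMeasure := integral_nonneg fun z => norm_nonneg _
    have := hbound (δ / ((∫ z, ‖h z‖ ∂cellMeasure) + 1)) (by positivity)
    refine this.trans ?_
    rw [zero_add, div_mul_eq_mul_div, div_le_iff₀ (by positivity)]
    nlinarith
  simpa using hlim

/-! ### Fourier coefficients -/

/-- A continuous function as an element of `L²(ℂ/Λ)`. -/
def contL2 (f : ℂ → ℂ) (hf : Continuous f) : L2 :=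
  ((memLp_top_of_continuous hf).mono_exponent le_top : MemLp f 2 cellMeasure).toLp f

lemma coeFn_contL2 {f : ℂ → ℂ} (hf : Continuous f) : contL2 f hf =ᵐ[cellMeasure] f :=
  MemLp.coeFn_toLp _

lemma inner_contL2_left {f : ℂ → ℂ} (hf : Continuous f) (g : L2) :
    inner ℂ (contL2 f hf) g = ∫ z, g z * conj (f z) ∂cellMeasure := by
  rw [L2.inner_def]
  refine integral_congr_ae ?_
  filter_upwards [coeFn_contL2 hf] with z hz
  rw [hz, RCLike.inner_apply]

/-- The area of `ℂ/Λ`. -/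
def cellArea : ℝ := volume.real cell

lemma cellArea_pos : 0 < cellArea := by
  rw [cellArea, measureReal_def, ENNReal.toReal_pos_iff]
  constructor
  · have hU : IsOpen (coordS ⁻¹' Ioo (0 : ℝ) 1 ∩ coordT ⁻¹' Ioo (0 : ℝ) 1) :=
      (isOpen_Ioo.preimage coordS.continuous).inter (isOpen_Ioo.preimage coordT.continuous)
    refine (hU.measure_pos volume ⟨((1 / 2 : ℝ) : ℂ) + ((1 / 2 : ℝ) : ℂ) * omega, ?_⟩).trans_le
      (measure_mono fun z hz => ?_)
    · constructor
      · rw [mem_preimage, coordS_mk]; norm_num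
      · rw [mem_preimage, coordT_mk]; norm_num
    · exact (mem_cell_iff z).2 ⟨Ioo_subset_Ico_self hz.1, Ioo_subset_Ico_self hz.2⟩
  · exact lt_of_le_of_lt (measure_mono cell_subset) measure_closedBall_lt_top

/-- The normalization constant of the characters. -/
def normConst : ℝ := (√cellArea)⁻¹

lemma normConst_pos : 0 < normConst := inv_pos.2 (Real.sqrt_pos.2 cellArea_pos)

lemma normConst_sq : normConst * normConst * cellArea = 1 := by
  have h := Real.mul_self_sqrt cellArea_pos.le
  have h0 := (Real.sqrt_pos.2 cellArea_pos).ne'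
  rw [normConst]
  field_simp
  nlinarith

lemma continuous_normalized_chi (n : ℤ × ℤ) : Continuous fun z => (normConst : ℂ) * chi n z :=
  continuous_const.mul (contDiff_chi n).continuous

lemma inner_normalized_chi (n : ℤ × ℤ) (g : L2) :
    inner ℂ (contL2 _ (continuous_normalized_chi n)) g =
      normConst * ∫ z, g z * chi (-n) z ∂cellMeasure := by
  rw [inner_contL2_left, ← integral_const_mul]
  congr 1
  ext z
  rw [map_mul, Complex.conj_ofReal, conj_chi]
  ring

lemma integral_contL2_mul {f g : ℂ → ℂ} (hf : Continuous f) :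
    ∫ z, contL2 f hf z * g z ∂cellMeasure = ∫ z, f z * g z ∂cellMeasure := by
  refine integral_congr_ae ?_
  filter_upwards [coeFn_contL2 hf] with z hz
  rw [hz]

lemma integral_chi_mul_chi (n m : ℤ × ℤ) :
    ∫ z, chi n z * chi (-m) z ∂cellMeasure = if n = m then (cellArea : ℂ) else 0 := by
  simp only [← chi_add]
  split_ifs with h
  · subst h
    simp only [add_neg_cancel, chi_zero]
    simp [cellArea, Measure.real]
  · exact integral_chi fun h0 => h (by rwa [← sub_eq_add_neg, sub_eq_zero] at h0)

/-- The orthonormal basis of characters of `L²(ℂ/Λ)`. -/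
def chiBasis : HilbertBasis (ℤ × ℤ) ℂ L2 :=
  HilbertBasis.mkOfOrthogonalEqBot (v := fun n => contL2 _ (continuous_normalized_chi n))
    (by
      classical
      rw [orthonormal_iff_ite]
      intro n m
      rw [inner_normalized_chi, integral_contL2_mul]
      simp only [mul_assoc]
      rw [integral_const_mul, integral_chi_mul_chi]
      by_cases h : m = n
      · rw [if_pos h, if_pos h.symm, ← mul_assoc]
        exact_mod_cast normConst_sq
      · rw [if_neg h, if_neg (Ne.symm h)]; simp)
    (by
      rw [Submodule.eq_bot_iff]
      intro h hh
      refine eq_zero_of_forall_chi fun n => ?_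
      have := (Submodule.mem_orthogonal _ _).1 hh _ (Submodule.subset_span ⟨-n, rfl⟩)
      rw [inner_normalized_chi, neg_neg] at this
      exact (mul_eq_zero.1 this).resolve_left (by exact_mod_cast normConst_pos.ne'))

/-- The Fourier coefficients. -/
def fc (f : L2) (n : ℤ × ℤ) : ℂ := chiBasis.repr f n

lemma fc_eq (f : L2) (n : ℤ × ℤ) : fc f n = normConst * ∫ z, f z * chi (-n) z ∂cellMeasure := by
  rw [fc, chiBasis.repr_apply_apply, ← inner_normalized_chi, chiBasis,
    HilbertBasis.coe_mkOfOrthogonalEqBot]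

lemma fc_add (f g : L2) (n : ℤ × ℤ) : fc (f + g) n = fc f n + fc g n := by simp [fc]

lemma fc_smul (c : ℂ) (f : L2) (n : ℤ × ℤ) : fc (c • f) n = c * fc f n := by simp [fc]

lemma fc_zero (n : ℤ × ℤ) : fc 0 n = 0 := by simp [fc]

lemma fc_neg (f : L2) (n : ℤ × ℤ) : fc (-f) n = -fc f n := by simp [fc]

lemma fc_sub (f g : L2) (n : ℤ × ℤ) : fc (f - g) n = fc f n - fc g n := by simp [fc]

lemma fc_ext {f g : L2} (h : ∀ n, fc f n = fc g n) : f = g :=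
  chiBasis.repr.injective (lp.ext (funext h))

lemma hasSum_norm_fc_sq (f : L2) : HasSum (fun n => ‖fc f n‖ ^ 2) (‖f‖ ^ 2) := by
  rw [← chiBasis.repr.norm_map f]
  have := lp.hasSum_norm (p := 2) (by norm_num) (chiBasis.repr f)
  simpa [fc] using this

lemma norm_fc_le (f : L2) (n : ℤ × ℤ) : ‖fc f n‖ ≤ ‖f‖ := by
  rw [← chiBasis.repr.norm_map f]
  exact lp.norm_apply_le_norm (by norm_num) _ n

lemma hasSum_inner_fc (f g : L2) : HasSum (fun n => conj (fc f n) * fc g n) (inner ℂ f g) := by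
  have h : ∀ n, conj (fc f n) * fc g n =
      inner ℂ f (chiBasis n) * inner ℂ (chiBasis n) g := fun n => by
    simp only [fc, chiBasis.repr_apply_apply, inner_conj_symm]
  simp only [h]
  exact chiBasis.hasSum_inner_mul_inner f g

lemma exists_fc_eq {c : ℤ × ℤ → ℂ} (hc : Summable fun n => ‖c n‖ ^ 2) : ∃ f : L2, ∀ n, fc f n = c n := by
  have hmem : Memℓp c 2 := by
    refine (memℓp_gen_iff (by norm_num)).2 ?_
    simpa using hc
  refine ⟨chiBasis.repr.symm ⟨c, hmem⟩, fun n => ?_⟩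
  rw [fc, LinearIsometryEquiv.apply_symm_apply]

/-! ### Weak derivatives and Fourier coefficients -/

lemma fc_contL2_fderiv {ψ : ℂ → ℂ} (hψ : IsTest ψ) (v : ℂ) (n : ℤ × ℤ) :
    fc (contL2 (fun z => fderiv ℝ ψ z v) (hψ.fderiv v).1.continuous) n =
      freq n v * fc (contL2 ψ hψ.1.continuous) n := by
  rw [fc_eq, fc_eq, integral_contL2_mul, integral_contL2_mul]
  have h := integral_fderiv_mul hψ (isTest_chi (-n)) v
  simp only [(hasFDerivAt_chi _ _).fderiv, smul_apply, smul_eq_mul, freq_neg, mul_neg] at h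
  have e : ∫ z, -(ψ z * (chi (-n) z * freq n v)) ∂cellMeasure =
      -((∫ z, ψ z * chi (-n) z ∂cellMeasure) * freq n v) := by
    rw [integral_neg, ← integral_mul_const]
    simp only [mul_assoc]
  rw [e] at h
  linear_combination normConst * h

lemma fderiv_conj {f : ℂ → ℂ} (hf : ContDiff ℝ ∞ f) (z v : ℂ) :
    fderiv ℝ (fun z => conj (f z)) z v = conj (fderiv ℝ f z v) := by
  have h : HasFDerivAt (fun z => conj (f z))
      (Complex.conjCLE.toContinuousLinearMap ∘L fderiv ℝ f z) z :=
    (Complex.conjCLE.toContinuousLinearMap.hasFDerivAt).comp z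
      (hf.differentiable (by simp) z).hasFDerivAt
  rw [h.fderiv]
  simp

/-- One direction tests against characters; the other is Parseval, with the conjugate of the test
function integrated by parts classically. -/
lemma isWeakDeriv_iff_fc {v : ℂ} {f g : L2} :
    IsWeakDeriv v f g ↔ ∀ n, fc g n = freq n v * fc f n := by
  constructor
  · intro h n
    have h1 := h _ (isTest_chi (-n))
    simp only [(hasFDerivAt_chi _ _).fderiv, smul_apply, smul_eq_mul, freq_neg, mul_neg] at h1
    rw [integral_neg] at h1
    simp only [← mul_assoc] at h1
    rw [integral_mul_const] at h1
    rw [fc_eq, fc_eq]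
    linear_combination normConst * h1
  · intro h φ hφ
    have hψ := hφ.conj
    have e : ∀ (F : L2) (η : ℂ → ℂ) (hη : Continuous η),
        ∫ z, F z * conj (η z) ∂cellMeasure = inner ℂ (contL2 η hη) F :=
      fun F η hη => (inner_contL2_left hη F).symm
    have e1 := e f _ (hψ.fderiv v).1.continuous
    have e2 := e g _ hψ.1.continuous
    simp only [fderiv_conj hφ.1, Complex.conj_conj] at e1 e2
    rw [e1, e2, ← (hasSum_inner_fc _ _).tsum_eq, ← (hasSum_inner_fc _ _).tsum_eq, ← tsum_neg]
    refine tsum_congr fun n => ?_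
    have h3 := fc_contL2_fderiv hψ v n
    simp only [fderiv_conj hφ.1] at h3
    rw [h3, h, map_mul, conj_freq]
    ring

/-- The symbol of `2D_{z̄}`. -/
def dsym (n : ℤ × ℤ) : ℂ := (1 / Complex.I) * (freq n 1 + Complex.I * freq n Complex.I)

lemma freq_eq_real (n : ℤ × ℤ) (v : ℂ) : freq n v = Complex.I * (freq n v).im := by
  rw [freq_apply]
  apply Complex.ext <;> simp

lemma dsym_eq (n : ℤ × ℤ) : dsym n = (freq n 1).im + (freq n Complex.I).im * Complex.I := by
  rw [dsym, freq_eq_real n 1, freq_eq_real n Complex.I]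
  have := Complex.I_ne_zero
  simp
  ring_nf
  simp
  ring

lemma freq_eq_dsym (n : ℤ × ℤ) (v : ℂ) :
    freq n v = Complex.I * (v.re * (dsym n).re + v.im * (dsym n).im) := by
  have hv : v = v.re • (1 : ℂ) + v.im • Complex.I := by simp
  have h1 : (dsym n).re = (freq n 1).im := by rw [dsym_eq]; simp
  have h2 : (dsym n).im = (freq n Complex.I).im := by rw [dsym_eq]; simp
  conv_lhs => rw [hv, map_add, map_smul, map_smul, freq_eq_real n 1, freq_eq_real n Complex.I]
  rw [h1, h2]
  simp only [Complex.real_smul]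
  ring

lemma conj_dsym (n : ℤ × ℤ) :
    conj (dsym n) = (1 / Complex.I) * (freq n 1 - Complex.I * freq n Complex.I) := by
  rw [dsym]
  simp only [map_mul, map_add, map_div₀, map_one, Complex.conj_I, conj_freq]
  have := Complex.I_ne_zero
  field_simp
  ring

/-- Ellipticity of `2D_{z̄}`: its symbol is `ξ₁ + iξ₂` with `ξ` real, so its modulus controls the
symbol of every first derivative. -/
lemma norm_freq_le (n : ℤ × ℤ) (v : ℂ) : ‖freq n v‖ ≤ 2 * ‖v‖ * ‖dsym n‖ := by
  rw [freq_eq_dsym, norm_mul, Complex.norm_I, one_mul]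
  have h1 := Complex.abs_re_le_norm v
  have h2 := Complex.abs_im_le_norm v
  have h3 := Complex.abs_re_le_norm (dsym n)
  have h4 := Complex.abs_im_le_norm (dsym n)
  refine (norm_add_le _ _).trans ?_
  rw [norm_mul, norm_mul, Complex.norm_real, Complex.norm_real, Complex.norm_real,
    Complex.norm_real]
  simp only [Real.norm_eq_abs]
  have e1 := mul_le_mul h1 h3 (abs_nonneg _) (norm_nonneg _)
  have e2 := mul_le_mul h2 h4 (abs_nonneg _) (norm_nonneg _)
  linarith

lemma freq_one (n : ℤ × ℤ) : freq n 1 = 2 * Real.pi * Complex.I * n.1 := by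
  have h1 : coordS 1 = 1 := by simpa using coordS_mk 1 0
  have h2 : coordT 1 = 0 := by simpa using coordT_mk 1 0
  rw [freq_apply, h1, h2]; simp

lemma freq_omega (n : ℤ × ℤ) : freq n omega = 2 * Real.pi * Complex.I * n.2 := by
  have h1 : coordS omega = 0 := by simpa using coordS_mk 0 1
  have h2 : coordT omega = 1 := by simpa using coordT_mk 0 1
  rw [freq_apply, h1, h2]; simp

lemma abs_fst_le_norm_dsym (n : ℤ × ℤ) : |(n.1 : ℝ)| ≤ ‖dsym n‖ := by
  have h := norm_freq_le n 1
  rw [freq_one] at h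
  simp only [norm_mul, Complex.norm_I, Complex.norm_real, Complex.norm_intCast, norm_one,
    Complex.norm_ofNat, Real.norm_eq_abs, abs_of_pos Real.pi_pos] at h
  nlinarith [Real.pi_gt_three, abs_nonneg (n.1 : ℝ)]

lemma abs_snd_le_norm_dsym (n : ℤ × ℤ) : |(n.2 : ℝ)| ≤ ‖dsym n‖ := by
  have h := norm_freq_le n omega
  rw [freq_omega, norm_omega] at h
  simp only [norm_mul, Complex.norm_I, Complex.norm_real, Complex.norm_intCast,
    Complex.norm_ofNat, Real.norm_eq_abs, abs_of_pos Real.pi_pos] at h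
  nlinarith [Real.pi_gt_three, abs_nonneg (n.2 : ℝ)]

lemma finite_norm_dsym_le (R : ℝ) : {n : ℤ × ℤ | ‖dsym n‖ ≤ R}.Finite := by
  obtain ⟨N, hN⟩ := exists_nat_ge R
  refine (Set.finite_Icc ((-(N : ℤ), -(N : ℤ)) : ℤ × ℤ) ((N : ℤ), (N : ℤ))).subset fun n hn => ?_
  have h1 := (abs_le.1 ((abs_fst_le_norm_dsym n).trans (le_trans hn hN)))
  have h2 := (abs_le.1 ((abs_snd_le_norm_dsym n).trans (le_trans hn hN)))
  refine ⟨⟨?_, ?_⟩, ?_, ?_⟩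
  · exact_mod_cast h1.1
  · exact_mod_cast h2.1
  · exact_mod_cast h1.2
  · exact_mod_cast h2.2

lemma fc_weakDeriv (k : ℕ) (v : ℂ) (f : sobolev (k + 1)) (n : ℤ × ℤ) :
    fc (weakDeriv k v f) n = freq n v * fc f n :=
  isWeakDeriv_iff_fc.1 (f.2 v).choose_spec.2 n

lemma fc_twoDbar (k : ℕ) (f : sobolev (k + 1)) (n : ℤ × ℤ) :
    fc (twoDbar k f) n = dsym n * fc f n := by
  have : ((twoDbar k f : sobolev k) : L2) =
      (1 / Complex.I) • ((weakDeriv k 1 f : L2) + Complex.I • (weakDeriv k Complex.I f : L2)) := rfl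
  rw [this, fc_smul, fc_add, fc_smul, fc_weakDeriv, fc_weakDeriv, dsym]
  ring

lemma fc_twoDz (k : ℕ) (f : sobolev (k + 1)) (n : ℤ × ℤ) :
    fc (twoDz k f) n = conj (dsym n) * fc f n := by
  have : ((twoDz k f : sobolev k) : L2) =
      (1 / Complex.I) • ((weakDeriv k 1 f : L2) - Complex.I • (weakDeriv k Complex.I f : L2)) := rfl
  rw [this, fc_smul, fc_sub, fc_smul, fc_weakDeriv, fc_weakDeriv, conj_dsym]
  ring

lemma contL2_mem_sobolev {f : ℂ → ℂ} (hf : IsTest f) (k : ℕ) :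
    contL2 f hf.1.continuous ∈ sobolev k := by
  induction k generalizing f with
  | zero => trivial
  | succ k ih =>
    intro v
    exact ⟨_, ih (hf.fderiv v), isWeakDeriv_iff_fc.2 (fc_contL2_fderiv hf v)⟩

/-- A smooth periodic function as an element of `H^k(ℂ/Λ)`. -/
def toSobolev (k : ℕ) {f : ℂ → ℂ} (hf : IsTest f) : sobolev k :=
  ⟨contL2 f hf.1.continuous, contL2_mem_sobolev hf k⟩

lemma fc_contL2_add_smul {f g : ℂ → ℂ} (hf : Continuous f) (hg : Continuous g) (a b : ℂ)
    (h : Continuous fun z => a * f z + b * g z) (n : ℤ × ℤ) :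
    fc (contL2 _ h) n = a * fc (contL2 f hf) n + b * fc (contL2 g hg) n := by
  rw [← fc_smul, ← fc_smul, ← fc_add]
  congr 1

lemma IsTest.dbar {f : ℂ → ℂ} (hf : IsTest f) : IsTest (dbar f) :=
  ⟨contDiff_dbar hf.1, fun m n z => by
    simp only [ScalarModel.dbar, hf.2.fderiv 1 m n z, hf.2.fderiv Complex.I m n z]⟩

lemma twoDbar_toSobolev (k : ℕ) {f : ℂ → ℂ} (hf : IsTest f) :
    twoDbar k (toSobolev (k + 1) hf) = toSobolev k hf.dbar := by
  apply Subtype.ext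
  apply fc_ext
  intro n
  rw [fc_twoDbar]
  have h1 : Continuous fun z => (1 / Complex.I) * fderiv ℝ f z 1 + 1 * fderiv ℝ f z Complex.I :=
    (continuous_const.mul (hf.fderiv 1).1.continuous).add
      (continuous_const.mul (hf.fderiv Complex.I).1.continuous)
  have e : dbar f = fun z => (1 / Complex.I) * fderiv ℝ f z 1 + 1 * fderiv ℝ f z Complex.I := by
    ext z
    rw [dbar]
    have := Complex.I_ne_zero
    field_simp
  have h2 := fc_contL2_add_smul (hf.fderiv 1).1.continuous (hf.fderiv Complex.I).1.continuous
    (1 / Complex.I) 1 h1 n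
  rw [fc_contL2_fderiv hf, fc_contL2_fderiv hf] at h2
  have h3 : fc (toSobolev k hf.dbar : L2) n = fc (contL2 _ h1) n := by
    simp only [toSobolev, e]
  rw [h3, h2, toSobolev, dsym]
  have := Complex.I_ne_zero
  field_simp

/-! ### Elliptic regularity -/

lemma exists_weakDeriv_of_elliptic {τ : ℤ × ℤ → ℂ} (hτ : ∀ n, ‖dsym n‖ ≤ ‖τ n‖) {f g : L2}
    (hfg : ∀ n, fc g n = τ n * fc f n) (v : ℂ) : ∃ F : L2, ∀ n, fc F n = freq n v * fc f n := by
  refine exists_fc_eq (Summable.of_nonneg_of_le (fun n => by positivity) (fun n => ?_)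
    ((hasSum_norm_fc_sq g).summable.mul_left ((2 * ‖v‖) ^ 2)))
  rw [← mul_pow, hfg, norm_mul, norm_mul, ← mul_assoc]
  gcongr
  refine (norm_freq_le n v).trans ?_
  gcongr
  exact hτ n

/-- Weak derivatives are Fourier multipliers too, so those of `f` and `g` satisfy the same relation
with the same `τ`, and the induction applies to them. -/
lemma mem_sobolev_succ_of_elliptic {τ : ℤ × ℤ → ℂ} (hτ : ∀ n, ‖dsym n‖ ≤ ‖τ n‖) {k : ℕ} {f g : L2}
    (hg : g ∈ sobolev k) (hfg : ∀ n, fc g n = τ n * fc f n) : f ∈ sobolev (k + 1) := by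
  induction k generalizing f g with
  | zero =>
    intro v
    obtain ⟨F, hF⟩ := exists_weakDeriv_of_elliptic hτ hfg v
    exact ⟨F, trivial, isWeakDeriv_iff_fc.2 hF⟩
  | succ k ih =>
    intro v
    obtain ⟨F, hF⟩ := exists_weakDeriv_of_elliptic hτ hfg v
    obtain ⟨gv, hgv, hw⟩ := hg v
    refine ⟨F, ih hgv fun n => ?_, isWeakDeriv_iff_fc.2 hF⟩
    rw [isWeakDeriv_iff_fc.1 hw, hF, hfg]
    ring

/-- The Leibniz rule in weak form: the product `gφ` is itself a test function for `f`. -/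
lemma mulOp_mem_sobolev {g : ℂ → ℂ} (hg : IsTest g) {k : ℕ} {f : L2} (hf : f ∈ sobolev k) :
    mulOp ⟨g, hg.1.continuous⟩ f ∈ sobolev k := by
  induction k generalizing g f with
  | zero => trivial
  | succ k ih =>
    intro v
    obtain ⟨fv, hfv, hw⟩ := hf v
    refine ⟨mulOp ⟨_, (hg.fderiv v).1.continuous⟩ f + mulOp ⟨g, hg.1.continuous⟩ fv,
      Submodule.add_mem _ (ih (hg.fderiv v) (sobolev_succ_le k hf)) (ih hg hfv), ?_⟩
    intro φ hφ
    have hcoe : ∀ (η : C(ℂ, ℂ)) (F : L2), mulOp η F =ᵐ[cellMeasure] fun z => η z * F z :=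
      fun η F => (memLp_mul η.continuous F).coeFn_toLp
    have h1 : ∫ z, mulOp ⟨g, hg.1.continuous⟩ f z * fderiv ℝ φ z v ∂cellMeasure =
        ∫ z, (f z * fderiv ℝ (fun z => g z * φ z) z v - f z * (fderiv ℝ g z v * φ z))
          ∂cellMeasure := by
      refine integral_congr_ae ?_
      filter_upwards [hcoe ⟨g, hg.1.continuous⟩ f] with z hz
      have h : fderiv ℝ (fun z => g z * φ z) z = g z • fderiv ℝ φ z + φ z • fderiv ℝ g z :=
        fderiv_fun_mul (hg.1.differentiable (by simp) z) (hφ.1.differentiable (by simp) z)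
      rw [hz, h]
      simp only [ContinuousMap.coe_mk, add_apply, smul_apply, smul_eq_mul]
      ring
    have h2 : ∫ z, (mulOp ⟨_, (hg.fderiv v).1.continuous⟩ f + mulOp ⟨g, hg.1.continuous⟩ fv : L2) z
        * φ z ∂cellMeasure =
        ∫ z, (f z * (fderiv ℝ g z v * φ z) + fv z * (g z * φ z)) ∂cellMeasure := by
      refine integral_congr_ae ?_
      filter_upwards [hcoe ⟨g, hg.1.continuous⟩ fv, hcoe ⟨_, (hg.fderiv v).1.continuous⟩ f,
        Lp.coeFn_add (mulOp ⟨_, (hg.fderiv v).1.continuous⟩ f)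
          (mulOp ⟨g, hg.1.continuous⟩ fv)] with z h1 h2 h3
      rw [h3, Pi.add_apply, h1, h2]
      simp only [ContinuousMap.coe_mk]
      ring
    rw [h1, h2, integral_sub (integrable_mul f ((hg.mul hφ).fderiv v).1.continuous)
      (integrable_mul f ((hg.fderiv v).mul hφ).1.continuous),
      integral_add (integrable_mul f ((hg.fderiv v).mul hφ).1.continuous)
      (integrable_mul fv (hg.mul hφ).1.continuous), hw _ (hg.mul hφ)]
    ring

/-! ### Smooth representatives -/

lemma exists_norm_dsym_pow_mul_fc_le {k : ℕ} {f : L2} (hf : f ∈ sobolev k) :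
    ∃ C, ∀ n, ‖dsym n‖ ^ k * ‖fc f n‖ ≤ C := by
  induction k generalizing f with
  | zero => exact ⟨‖f‖, fun n => by simpa using norm_fc_le f n⟩
  | succ k ih =>
    obtain ⟨C, hC⟩ := ih (twoDbar k ⟨f, hf⟩).2
    refine ⟨C, fun n => ?_⟩
    have := hC n
    rw [fc_twoDbar, norm_mul] at this
    rw [pow_succ, mul_assoc]
    exact this

lemma summable_lattice_decay :
    Summable fun n : ℤ × ℤ => ((1 + |(n.1 : ℝ)|) ^ 2)⁻¹ * ((1 + |(n.2 : ℝ)|) ^ 2)⁻¹ := by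
  have h : Summable fun n : ℤ => ((1 + |(n : ℝ)|) ^ 2)⁻¹ := by
    have hN : Summable fun n : ℕ => ((1 + (n : ℝ)) ^ 2)⁻¹ := by
      have := (summable_nat_add_iff 1).2 (Real.summable_nat_pow_inv.2 (by norm_num : 1 < 2))
      refine this.congr fun n => ?_
      push_cast
      rw [add_comm]
    refine Summable.of_nat_of_neg ?_ ?_
    · simpa using hN
    · simpa using hN
  exact h.mul_of_nonneg h (fun _ => by positivity) (fun _ => by positivity)

/-- Rapidly decaying coefficients. -/
def RapidDecay {E : Type} [NormedAddCommGroup E] (c : ℤ × ℤ → E) : Prop :=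
  ∀ j : ℕ, Summable fun n => (1 + ‖dsym n‖) ^ j * ‖c n‖

lemma rapidDecay_fc {f : L2} (hf : ∀ k, f ∈ sobolev k) : RapidDecay (fc f) := by
  intro j
  obtain ⟨C₀, h0⟩ := exists_norm_dsym_pow_mul_fc_le (hf 0)
  -- The four extra powers of `1 + |dsym|` dominate `(1+|n₁|)² (1+|n₂|)²`, whose inverse is summable
  -- over the lattice.
  obtain ⟨C₁, h1⟩ := exists_norm_dsym_pow_mul_fc_le (hf (j + 4))
  refine Summable.of_nonneg_of_le (fun n => by positivity) (fun n => ?_)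
    (summable_lattice_decay.mul_left (2 ^ (j + 4) * (C₀ + C₁)))
  have ha := abs_fst_le_norm_dsym n
  have hb := abs_snd_le_norm_dsym n
  have hd := norm_nonneg (dsym n)
  have hf0 := norm_nonneg (fc f n)
  have key : (1 + ‖dsym n‖) ^ (j + 4) * ‖fc f n‖ ≤ 2 ^ (j + 4) * (C₀ + C₁) := by
    have h0n := h0 n
    have h1n := h1 n
    rw [pow_zero, one_mul] at h0n
    have hp : (1 + ‖dsym n‖) ^ (j + 4) ≤ 2 ^ (j + 4) * (1 + ‖dsym n‖ ^ (j + 4)) := by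
      rcases le_total ‖dsym n‖ 1 with h | h
      · have : (1 + ‖dsym n‖) ^ (j + 4) ≤ 2 ^ (j + 4) := pow_le_pow_left₀ (by positivity) (by linarith) _
        nlinarith [pow_nonneg hd (j + 4), pow_pos (by norm_num : (0 : ℝ) < 2) (j + 4)]
      · have : (1 + ‖dsym n‖) ^ (j + 4) ≤ (2 * ‖dsym n‖) ^ (j + 4) :=
          pow_le_pow_left₀ (by positivity) (by linarith) _
        rw [mul_pow] at this
        nlinarith [pow_pos (by norm_num : (0 : ℝ) < 2) (j + 4)]
    calc (1 + ‖dsym n‖) ^ (j + 4) * ‖fc f n‖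
        ≤ 2 ^ (j + 4) * (1 + ‖dsym n‖ ^ (j + 4)) * ‖fc f n‖ := by gcongr
      _ = 2 ^ (j + 4) * (‖fc f n‖ + ‖dsym n‖ ^ (j + 4) * ‖fc f n‖) := by ring
      _ ≤ 2 ^ (j + 4) * (C₀ + C₁) := by gcongr
  have h4 : (1 + |(n.1 : ℝ)|) ^ 2 * (1 + |(n.2 : ℝ)|) ^ 2 ≤ (1 + ‖dsym n‖) ^ 4 := by
    calc (1 + |(n.1 : ℝ)|) ^ 2 * (1 + |(n.2 : ℝ)|) ^ 2
        ≤ (1 + ‖dsym n‖) ^ 2 * (1 + ‖dsym n‖) ^ 2 := by gcongr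
      _ = _ := by ring
  have h5 : 0 < (1 + |(n.1 : ℝ)|) ^ 2 * (1 + |(n.2 : ℝ)|) ^ 2 := by positivity
  rw [← mul_inv, ← div_eq_mul_inv, le_div_iff₀ h5]
  calc (1 + ‖dsym n‖) ^ j * ‖fc f n‖ * ((1 + |(n.1 : ℝ)|) ^ 2 * (1 + |(n.2 : ℝ)|) ^ 2)
      ≤ (1 + ‖dsym n‖) ^ j * ‖fc f n‖ * (1 + ‖dsym n‖) ^ 4 := by gcongr
    _ = (1 + ‖dsym n‖) ^ (j + 4) * ‖fc f n‖ := by ring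
    _ ≤ _ := key

lemma norm_freq_clm_le (n : ℤ × ℤ) : ‖freq n‖ ≤ 2 * (1 + ‖dsym n‖) :=
  (freq n).opNorm_le_bound (by positivity) fun v => by
    have := norm_freq_le n v
    nlinarith [norm_nonneg v, norm_nonneg (dsym n)]

lemma norm_freq_smulRight_le {E : Type} [NormedAddCommGroup E] [NormedSpace ℂ E] (n : ℤ × ℤ)
    (x : E) : ‖(freq n).smulRight x‖ ≤ 2 * (1 + ‖dsym n‖) * ‖x‖ :=
  ContinuousLinearMap.opNorm_le_bound _ (by positivity) fun v => by
    rw [ContinuousLinearMap.smulRight_apply, norm_smul]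
    calc ‖freq n v‖ * ‖x‖ ≤ 2 * (1 + ‖dsym n‖) * ‖v‖ * ‖x‖ := by
          gcongr; exact (freq n).le_of_opNorm_le (norm_freq_clm_le n) v
      _ = _ := by ring

lemma RapidDecay.summable {E : Type} [NormedAddCommGroup E] {c : ℤ × ℤ → E} (hc : RapidDecay c) :
    Summable fun n => ‖c n‖ := by simpa using hc 0

lemma hasFDerivAt_fourierSeries {E : Type} [NormedAddCommGroup E] [NormedSpace ℂ E]
    [CompleteSpace E] {c : ℤ × ℤ → E} (hc : RapidDecay c) (z : ℂ) :
    HasFDerivAt (fun z => ∑' n, chi n z • c n) (∑' n, chi n z • (freq n).smulRight (c n)) z := by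
  have hu : Summable fun n => 2 * ((1 + ‖dsym n‖) ^ 1 * ‖c n‖) := (hc 1).mul_left 2
  refine hasFDerivAt_tsum (𝕜 := ℝ) (f := fun n z => chi n z • c n)
    (f' := fun n z => chi n z • (freq n).smulRight (c n)) hu (fun n z => ?_) (fun n z => ?_)
    (x₀ := 0) ?_ z
  · have h : HasFDerivAt (fun z => chi n z • c n) ((chi n z • freq n).smulRight (c n)) z :=
      HasFDerivAt.smul_const (hasFDerivAt_chi n z) (c n)
    refine h.congr_fderiv ?_
    ext v
    simp [mul_smul]
  · rw [norm_smul, norm_chi, one_mul, pow_one, ← mul_assoc]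
    exact norm_freq_smulRight_le n (c n)
  · refine Summable.of_norm ?_
    simpa [norm_smul, norm_chi] using hc.summable

lemma RapidDecay.smulRight {E : Type} [NormedAddCommGroup E] [NormedSpace ℂ E]
    {c : ℤ × ℤ → E} (hc : RapidDecay c) : RapidDecay fun n => (freq n).smulRight (c n) := by
  intro j
  refine Summable.of_nonneg_of_le (fun n => by positivity) (fun n => ?_) ((hc (j + 1)).mul_left 2)
  calc (1 + ‖dsym n‖) ^ j * ‖(freq n).smulRight (c n)‖
      ≤ (1 + ‖dsym n‖) ^ j * (2 * (1 + ‖dsym n‖) * ‖c n‖) := by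
        gcongr; exact norm_freq_smulRight_le n (c n)
    _ = _ := by ring

/-- The derivative is again such a series, with rapidly decaying operator-valued coefficients, hence
the induction over all target spaces at once. -/
lemma contDiff_fourierSeries {E : Type} [NormedAddCommGroup E] [NormedSpace ℂ E]
    [CompleteSpace E] {c : ℤ × ℤ → E} (hc : RapidDecay c) :
    ContDiff ℝ ∞ fun z => ∑' n, chi n z • c n := by
  rw [contDiff_infty]
  intro k
  induction k generalizing E with
  | zero =>
    rw [Nat.cast_zero, contDiff_zero]
    exact continuous_iff_continuousAt.2 fun z => (hasFDerivAt_fourierSeries hc z).continuousAt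
  | succ k ih =>
    rw [Nat.cast_succ, contDiff_succ_iff_hasFDerivAt]
    exact ⟨_, ih hc.smulRight, fun z => hasFDerivAt_fourierSeries hc z⟩

/-- An element of all Sobolev spaces is represented by a smooth periodic function. -/
lemma exists_smooth_representative {f : L2} (hf : ∀ k, f ∈ sobolev k) :
    ∃ (u : ℂ → ℂ) (hu : IsTest u), f = contL2 u hu.1.continuous := by
  have hc := rapidDecay_fc hf
  set u : ℂ → ℂ := fun z => normConst * ∑' n, chi n z • fc f n with hu
  have hut : IsTest u := by
    refine ⟨contDiff_const.mul (contDiff_fourierSeries hc), fun m n z => ?_⟩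
    simp only [hu, (isTest_chi _).2 m n z]
  refine ⟨u, hut, fc_ext fun m => ?_⟩
  rw [fc_eq (contL2 u _), integral_contL2_mul]
  have hint : ∀ n, Integrable (fun z => chi n z • fc f n * chi (-m) z) cellMeasure := fun n =>
    integrable_of_continuous (((contDiff_chi n).continuous.smul continuous_const).mul
      (contDiff_chi (-m)).continuous)
  have hsum : Summable fun n => ∫ z, ‖chi n z • fc f n * chi (-m) z‖ ∂cellMeasure := by
    simp only [norm_mul, norm_chi, one_mul, mul_one, integral_const, smul_eq_mul]
    exact hc.summable.mul_left _
  have h := integral_tsum_of_summable_integral_norm hint hsum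
  have e1 : ∫ z, u z * chi (-m) z ∂cellMeasure =
      normConst * ∫ z, ∑' n, chi n z • fc f n * chi (-m) z ∂cellMeasure := by
    rw [← integral_const_mul]
    congr 1
    ext z
    rw [hu, tsum_mul_right]
    ring
  rw [e1, ← h]
  have e2 : ∀ n, ∫ z, chi n z • fc f n * chi (-m) z ∂cellMeasure =
      if n = m then fc f m * cellArea else 0 := by
    intro n
    have : ∀ z, chi n z • fc f n * chi (-m) z = fc f n * (chi n z * chi (-m) z) := fun z => by
      rw [smul_eq_mul]; ring
    simp only [this]
    rw [integral_const_mul, integral_chi_mul_chi]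
    split_ifs with h
    · rw [h]
    · rw [mul_zero]
  simp only [e2, tsum_ite_eq]
  have hn : ((normConst * normConst * cellArea : ℝ) : ℂ) = 1 := by rw [normConst_sq]; simp
  push_cast at hn
  linear_combination -fc f m * hn

/-! ### Smooth functions inside `L²` -/

lemma contL2_eq_add {f g h : ℂ → ℂ} (hf : Continuous f) (hg : Continuous g) (hh : Continuous h)
    (e : ∀ z, h z = f z + g z) : contL2 h hh = contL2 f hf + contL2 g hg := by
  obtain rfl : h = fun z => f z + g z := funext e
  rfl

lemma contL2_eq_smul {f h : ℂ → ℂ} (c : ℂ) (hf : Continuous f) (hh : Continuous h)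
    (e : ∀ z, h z = c * f z) : contL2 h hh = c • contL2 f hf := by
  obtain rfl : h = fun z => c * f z := funext e
  rfl

lemma contL2_congr {f g : ℂ → ℂ} (hf : Continuous f) (hg : Continuous g) (h : ∀ z, f z = g z) :
    contL2 f hf = contL2 g hg := by
  obtain rfl : f = g := funext h
  rfl

lemma coeFn_mulOp (g : C(ℂ, ℂ)) (f : L2) : mulOp g f =ᵐ[cellMeasure] fun z => g z * f z :=
  (memLp_mul g.continuous f).coeFn_toLp

lemma mulOp_contL2 (g : C(ℂ, ℂ)) {f : ℂ → ℂ} (hf : Continuous f) :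
    mulOp g (contL2 f hf) = contL2 (fun z => g z * f z) (g.continuous.mul hf) := by
  have hgf : Continuous fun z => g z * f z := g.continuous.mul hf
  apply Lp.ext
  filter_upwards [coeFn_mulOp g (contL2 f hf), coeFn_contL2 hf, coeFn_contL2 hgf] with z h1 h2 h3
  rw [h1, h2, h3]

/-- Equality almost everywhere on the cell spreads to `ℂ` by periodicity, and continuity removes the
null set. -/
lemma IsTest.eq_of_contL2_eq {f g : ℂ → ℂ} (hf : IsTest f) (hg : IsTest g)
    (h : contL2 f hf.1.continuous = contL2 g hg.1.continuous) : f = g := by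
  have h1 : f =ᵐ[cellMeasure] g :=
    (coeFn_contL2 hf.1.continuous).symm.trans (h ▸ coeFn_contL2 hg.1.continuous)
  have h0 := isAddFundamentalDomain_translate 0
  simp only [add_zero, preimage_id'] at h0
  have h2 : volume {z | ¬f z = g z} = 0 := by
    refine h0.measure_zero_of_invariant _ ?_ ?_
    · rintro ⟨_, m, n, rfl⟩
      ext z
      rw [mem_vadd_set_iff_neg_vadd_mem]
      change ¬f (-(m + n * omega) + z) = g (-(m + n * omega) + z) ↔ ¬f z = g z
      rw [show -((m : ℂ) + n * omega) + z = z + ((-m : ℤ) + (-n : ℤ) * omega) by push_cast; ring,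
        hf.2, hg.2]
    · have := ae_iff.1 h1
      rwa [Measure.restrict_apply'] at this
      exact measurableSet_cell
  exact (hf.1.continuous.ae_eq_iff_eq volume hg.1.continuous).1 (ae_iff.2 h2)

lemma Potential.isTest (V : Potential) : IsTest V.toFun := ⟨V.contDiff, V.periodic⟩

lemma isTest_of_mem_PerSol {k : ℂ} {w : ℂ → ℂ × ℂ} (hw : w ∈ PerSol V α k) :
    IsTest (fun z => (w z).1) ∧ IsTest (fun z => (w z).2) := by
  have hp : IsPeriodic w := by
    refine isPeriodic_of_generators (fun z => ?_) fun z => ?_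
    · rw [hw.2.1, one_smul]
    · rw [hw.2.2]; simp
  exact ⟨⟨hw.1.1.fst, fun m n z => by simp only [hp m n z]⟩,
    ⟨hw.1.1.snd, fun m n z => by simp only [hp m n z]⟩⟩

lemma IsTest.const_mul {f : ℂ → ℂ} (c : ℂ) (hf : IsTest f) : IsTest fun z => c * f z :=
  ⟨contDiff_const.mul hf.1, fun m n z => by simp only [hf.2 m n z]⟩

lemma IsTest.add {f g : ℂ → ℂ} (hf : IsTest f) (hg : IsTest g) : IsTest fun z => f z + g z :=
  ⟨hf.1.add hg.1, fun m n z => by simp only [hf.2 m n, hg.2 m n]⟩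

/-! ### The kernel of `D_S(α) + k` -/

lemma opDS_apply (k : ℂ) (x : H1sq) : opDS V α k x =
    ((twoDbar 0 x.1 : L2) + k • (x.1 : L2) + α • mulOp V.cont x.2,
      α • (x.1 : L2) + ((twoDbar 0 x.2 : L2) + k • (x.2 : L2))) := rfl

lemma opDSadj_apply (k : ℂ) (x : H1sq) : opDSadj V α k x =
    ((twoDz 0 x.1 : L2) + conj k • (x.1 : L2) + conj α • (x.2 : L2),
      conj α • mulOp V.conjCont x.1 + ((twoDz 0 x.2 : L2) + conj k • (x.2 : L2))) := rfl

lemma mem_ker_opDS {k : ℂ} {x : H1sq} : x ∈ LinearMap.ker (opDS V α k) ↔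
    (∀ n, dsym n * fc x.1 n + k * fc x.1 n + α * fc (mulOp V.cont x.2) n = 0) ∧
      ∀ n, α * fc x.1 n + (dsym n * fc x.2 n + k * fc x.2 n) = 0 := by
  rw [LinearMap.mem_ker, opDS_apply, Prod.mk_eq_zero]
  constructor
  · rintro ⟨h1, h2⟩
    refine ⟨fun n => ?_, fun n => ?_⟩
    · have := congrArg (fun f => fc f n) h1
      simpa only [fc_add, fc_smul, fc_twoDbar, fc_zero] using this
    · have := congrArg (fun f => fc f n) h2
      simpa only [fc_add, fc_smul, fc_twoDbar, fc_zero] using this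
  · rintro ⟨h1, h2⟩
    refine ⟨fc_ext fun n => ?_, fc_ext fun n => ?_⟩
    · simpa only [fc_add, fc_smul, fc_twoDbar, fc_zero] using h1 n
    · simpa only [fc_add, fc_smul, fc_twoDbar, fc_zero] using h2 n

lemma mem_ker_opDSadj {k : ℂ} {x : H1sq} : x ∈ LinearMap.ker (opDSadj V α k) ↔
    (∀ n, conj (dsym n) * fc x.1 n + conj k * fc x.1 n + conj α * fc x.2 n = 0) ∧
      ∀ n, conj α * fc (mulOp V.conjCont x.1) n +
        (conj (dsym n) * fc x.2 n + conj k * fc x.2 n) = 0 := by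
  rw [LinearMap.mem_ker, opDSadj_apply, Prod.mk_eq_zero]
  constructor
  · rintro ⟨h1, h2⟩
    refine ⟨fun n => ?_, fun n => ?_⟩
    · have := congrArg (fun f => fc f n) h1
      simpa only [fc_add, fc_smul, fc_twoDz, fc_zero] using this
    · have := congrArg (fun f => fc f n) h2
      simpa only [fc_add, fc_smul, fc_twoDz, fc_zero] using this
  · rintro ⟨h1, h2⟩
    refine ⟨fc_ext fun n => ?_, fc_ext fun n => ?_⟩
    · simpa only [fc_add, fc_smul, fc_twoDz, fc_zero] using h1 n
    · simpa only [fc_add, fc_smul, fc_twoDz, fc_zero] using h2 n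

/-- Elements of the kernel of `D_S(α) + k` are smooth. -/
lemma mem_sobolev_of_mem_ker_opDS {k : ℂ} {x : H1sq} (hx : x ∈ LinearMap.ker (opDS V α k)) (j : ℕ) :
    (x.1 : L2) ∈ sobolev j ∧ (x.2 : L2) ∈ sobolev j := by
  rw [mem_ker_opDS] at hx
  induction j with
  | zero => exact ⟨trivial, trivial⟩
  | succ j ih =>
    constructor
    -- Bootstrap: each equation expresses `2D_{z̄}` of one component through terms already in `H^j`.
    · refine mem_sobolev_succ_of_elliptic (τ := dsym) (fun n => le_rfl)
        (g := (-k) • (x.1 : L2) + (-α) • mulOp V.cont x.2)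
        (Submodule.add_mem _ (Submodule.smul_mem _ _ ih.1)
          (Submodule.smul_mem _ _ (mulOp_mem_sobolev V.isTest ih.2))) fun n => ?_
      rw [fc_add, fc_smul, fc_smul]
      linear_combination -hx.1 n
    · refine mem_sobolev_succ_of_elliptic (τ := dsym) (fun n => le_rfl)
        (g := (-k) • (x.2 : L2) + (-α) • (x.1 : L2))
        (Submodule.add_mem _ (Submodule.smul_mem _ _ ih.2) (Submodule.smul_mem _ _ ih.1))
        fun n => ?_
      rw [fc_add, fc_smul, fc_smul]
      linear_combination -hx.2 n

/-- Smooth functions `(u₁, u₂)` represent an element of the kernel of `D_S(α) + k` if and only if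
`(-α u₁, u₂)` is a smooth solution. -/
lemma toSobolev_mem_ker_opDS_iff {k : ℂ} {u₁ u₂ : ℂ → ℂ} (h₁ : IsTest u₁) (h₂ : IsTest u₂) :
    (toSobolev 1 h₁, toSobolev 1 h₂) ∈ LinearMap.ker (opDS V α k) ↔
      (∀ z, dbar u₁ z + k * u₁ z + α * (V.toFun z * u₂ z) = 0) ∧
        ∀ z, α * u₁ z + (dbar u₂ z + k * u₂ z) = 0 := by
  have hz : IsTest fun _ => 0 := ⟨contDiff_const, fun _ _ _ => rfl⟩
  have t1 : IsTest fun z => dbar u₁ z + k * u₁ z + α * (V.toFun z * u₂ z) :=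
    (h₁.dbar.add (h₁.const_mul k)).add ((V.isTest.mul h₂).const_mul α)
  have t2 : IsTest fun z => α * u₁ z + (dbar u₂ z + k * u₂ z) :=
    (h₁.const_mul α).add (h₂.dbar.add (h₂.const_mul k))
  have e : opDS V α k (toSobolev 1 h₁, toSobolev 1 h₂) =
      (contL2 _ t1.1.continuous, contL2 _ t2.1.continuous) := by
    rw [opDS_apply]
    simp only [twoDbar_toSobolev]
    rw [show ((toSobolev 1 h₂ : sobolev 1) : L2) = contL2 u₂ h₂.1.continuous from rfl, mulOp_contL2]
    rfl
  have ez : contL2 (fun _ => 0) hz.1.continuous = 0 := by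
    have := contL2_eq_smul 0 hz.1.continuous hz.1.continuous fun z => (mul_zero 0).symm
    simpa using this
  rw [LinearMap.mem_ker, e, Prod.mk_eq_zero]
  constructor
  · rintro ⟨e1, e2⟩
    exact ⟨congrFun (t1.eq_of_contL2_eq hz (e1.trans ez.symm)),
      congrFun (t2.eq_of_contL2_eq hz (e2.trans ez.symm))⟩
  · rintro ⟨e1, e2⟩
    exact ⟨(contL2_congr _ _ e1).trans ez, (contL2_congr _ _ e2).trans ez⟩

/-- The element of the kernel of `D_S(α) + k` given by a smooth periodic solution. -/
def solToKer (V : Potential) {α : ℂ} (hα : α ≠ 0) (k : ℂ) :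
    PerSol V α k →ₗ[ℂ] LinearMap.ker (opDS V α k) where
  -- The second row of `D_S(α) + k` reads `(2D_{z̄}+k)u₂ = -α u₁`, so `w₁ = -α u₁`; this is where `α
  -- ≠ 0` is needed.
  toFun w := ⟨(toSobolev 1 ((isTest_of_mem_PerSol w.2).1.const_mul (-α⁻¹)),
    toSobolev 1 (isTest_of_mem_PerSol w.2).2), by
    have ht := isTest_of_mem_PerSol w.2
    rw [toSobolev_mem_ker_opDS_iff]
    refine ⟨fun z => ?_, fun z => ?_⟩
    · rw [dbar_const_mul _ ht.1.1]
      have := w.2.1.2.1 z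
      field_simp
      linear_combination -this
    · have := w.2.1.2.2 z
      field_simp
      linear_combination this⟩
  map_add' w w' := by
    refine Subtype.ext (Prod.ext (Subtype.ext ?_) (Subtype.ext rfl))
    exact contL2_eq_add ((isTest_of_mem_PerSol w.2).1.const_mul (-α⁻¹)).1.continuous
      ((isTest_of_mem_PerSol w'.2).1.const_mul (-α⁻¹)).1.continuous
      ((isTest_of_mem_PerSol (w + w').2).1.const_mul (-α⁻¹)).1.continuous fun z => mul_add _ _ _
  map_smul' c w := by
    refine Subtype.ext (Prod.ext (Subtype.ext ?_) (Subtype.ext rfl))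
    exact contL2_eq_smul c ((isTest_of_mem_PerSol w.2).1.const_mul (-α⁻¹)).1.continuous
      ((isTest_of_mem_PerSol (c • w).2).1.const_mul (-α⁻¹)).1.continuous
      fun z => mul_left_comm _ _ _

lemma bijective_solToKer (V : Potential) {α : ℂ} (hα : α ≠ 0) (k : ℂ) :
    Function.Bijective (solToKer V hα k) := by
  constructor
  · intro w w' h
    have h1 := congrArg (fun x => (x.1.1 : L2)) h
    have h2 := congrArg (fun x => (x.1.2 : L2)) h
    have e1 := IsTest.eq_of_contL2_eq ((isTest_of_mem_PerSol w.2).1.const_mul (-α⁻¹))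
      ((isTest_of_mem_PerSol w'.2).1.const_mul (-α⁻¹)) h1
    have e2 := IsTest.eq_of_contL2_eq (isTest_of_mem_PerSol w.2).2 (isTest_of_mem_PerSol w'.2).2 h2
    refine Subtype.ext (funext fun z => Prod.ext ?_ (congrFun e2 z))
    exact mul_left_cancel₀ (neg_ne_zero.2 (inv_ne_zero hα)) (congrFun e1 z)
  · rintro ⟨x, hx⟩
    obtain ⟨u₁, h₁, e₁⟩ := exists_smooth_representative fun j => (mem_sobolev_of_mem_ker_opDS hx j).1
    obtain ⟨u₂, h₂, e₂⟩ := exists_smooth_representative fun j => (mem_sobolev_of_mem_ker_opDS hx j).2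
    have ex : x = (toSobolev 1 h₁, toSobolev 1 h₂) := Prod.ext (Subtype.ext e₁) (Subtype.ext e₂)
    subst ex
    obtain ⟨s1, s2⟩ := toSobolev_mem_ker_opDS_iff h₁ h₂ |>.1 hx
    refine ⟨⟨fun z => (-α * u₁ z, u₂ z), ⟨((h₁.const_mul (-α)).1.prodMk h₂.1), fun z => ?_,
      fun z => ?_⟩, fun z => ?_, fun z => ?_⟩, ?_⟩
    · simp only [dbar_const_mul _ h₁.1]
      linear_combination -α * s1 z
    · simp only []
      linear_combination s2 z
    · have a := (h₁.2 1 0 z)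
      have b := (h₂.2 1 0 z)
      simp only [Int.cast_one, Int.cast_zero, zero_mul, add_zero] at a b
      simp only [a, b, one_smul]
    · have a := (h₁.2 0 1 z)
      have b := (h₂.2 0 1 z)
      simp only [Int.cast_one, Int.cast_zero, zero_add, one_mul] at a b
      simp [a, b]
    · refine Subtype.ext (Prod.ext (Subtype.ext ?_) (Subtype.ext rfl))
      refine contL2_congr ((h₁.const_mul (-α)).const_mul (-α⁻¹)).1.continuous h₁.1.continuous
        fun z => ?_
      field_simp

/-! ### The adjoint -/

lemma integral_neg_comp {F : ℂ → ℂ} (hF : IsPeriodic F) :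
    ∫ z, F (-z) ∂cellMeasure = ∫ z, F z ∂cellMeasure := by
  have hdom : IsAddFundamentalDomain lattice ((fun z : ℂ => -z) ⁻¹' cell) volume := by
    refine IsAddFundamentalDomain.mk'
      (measurableSet_cell.preimage measurable_neg).nullMeasurableSet fun z => ?_
    obtain ⟨m, n, h⟩ := exists_add_mem_cell (-z)
    refine ⟨⟨(-m : ℤ) + (-n : ℤ) * omega, -m, -n, rfl⟩, ?_, ?_⟩
    · change -(((-m : ℤ) : ℂ) + (-n : ℤ) * omega + z) ∈ cell
      rwa [show -(((-m : ℤ) : ℂ) + (-n : ℤ) * omega + z) = -z + (m + n * omega) by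
        push_cast; ring]
    · rintro ⟨_, m', n', rfl⟩ h'
      change -((m' : ℂ) + n' * omega + z) ∈ cell at h'
      rw [show -((m' : ℂ) + n' * omega + z) =
        -z + (m + n * omega) + ((-m' - m : ℤ) + (-n' - n : ℤ) * omega) by push_cast; ring] at h'
      obtain ⟨h1, h2⟩ := eq_of_mem_cell h h'
      obtain rfl : m' = -m := by omega
      obtain rfl : n' = -n := by omega
      rfl
  have h1 : ∫ z in cell, F z = ∫ z in (fun z => -z) ⁻¹' cell, F z := by
    have h0 := isAddFundamentalDomain_translate 0
    simp only [add_zero, preimage_id'] at h0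
    refine h0.setIntegral_eq hdom ?_
    rintro ⟨_, m, n, rfl⟩ z
    change F (m + n * omega + z) = F z
    rw [add_comm, hF]
  rw [h1]
  have h2 := (Measure.measurePreserving_neg (volume : Measure ℂ)).setIntegral_preimage_emb
    (MeasurableEquiv.neg ℂ).measurableEmbedding F ((fun z => -z) ⁻¹' cell)
  have e : (fun z : ℂ => -z) ⁻¹' ((fun z => -z) ⁻¹' cell) = cell := by
    ext z; simp
  have e' : Neg.neg ⁻¹' ((fun z : ℂ => -z) ⁻¹' cell) = cell := e
  rw [e'] at h2
  exact h2

lemma inner_mulOp_left (g : C(ℂ, ℂ)) (f h : L2) : inner ℂ (mulOp g f) h =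
    inner ℂ f (mulOp ⟨fun z => conj (g z), Complex.continuous_conj.comp g.continuous⟩ h) := by
  rw [L2.inner_def, L2.inner_def]
  refine integral_congr_ae ?_
  filter_upwards [coeFn_mulOp g f,
    coeFn_mulOp ⟨fun z => conj (g z), Complex.continuous_conj.comp g.continuous⟩ h] with z h1 h2
  rw [h1, h2, RCLike.inner_apply, RCLike.inner_apply]
  simp only [map_mul, ContinuousMap.coe_mk]
  ring

/-- The antiunitary involution `f ↦ conj f(-·)` of `L²(ℂ/Λ)`, on Fourier coefficients. -/
def conjRefl (f : L2) : L2 :=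
  (exists_fc_eq (c := fun n => conj (fc f n))
    (by simpa using (hasSum_norm_fc_sq f).summable)).choose

lemma fc_conjRefl (f : L2) (n : ℤ × ℤ) : fc (conjRefl f) n = conj (fc f n) :=
  (exists_fc_eq (c := fun n => conj (fc f n))
    (by simpa using (hasSum_norm_fc_sq f).summable)).choose_spec n

lemma conjRefl_conjRefl (f : L2) : conjRefl (conjRefl f) = f :=
  fc_ext fun n => by rw [fc_conjRefl, fc_conjRefl, Complex.conj_conj]

lemma conjRefl_mem_sobolev_one {f : L2} (hf : f ∈ sobolev 1) : conjRefl f ∈ sobolev 1 := by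
  intro v
  obtain ⟨g, -, hg⟩ := hf v
  refine ⟨-conjRefl g, trivial, isWeakDeriv_iff_fc.2 fun n => ?_⟩
  rw [fc_neg, fc_conjRefl, fc_conjRefl, isWeakDeriv_iff_fc.1 hg, map_mul, conj_freq]
  ring

/-- The matrix of a multiplication operator in the basis of characters, found by moving the
conjugate of `g` to the character. It allows the multiplications by `V` and `V̄` to be compared
entry by entry. -/
lemma fc_mulOp (g : C(ℂ, ℂ)) (f : L2) (m : ℤ × ℤ) : HasSum
    (fun n => (normConst * normConst * ∫ z, g z * chi (n - m) z ∂cellMeasure) * fc f n)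
    (fc (mulOp g f) m) := by
  have h1 : fc (mulOp g f) m = inner ℂ (mulOp
      ⟨fun z => conj (g z), Complex.continuous_conj.comp g.continuous⟩
      (contL2 _ (continuous_normalized_chi m))) f := by
    rw [inner_mulOp_left, inner_normalized_chi, fc_eq]
    have : (⟨fun z => conj (conj (g z)), Complex.continuous_conj.comp
        (Complex.continuous_conj.comp g.continuous)⟩ : C(ℂ, ℂ)) = g := by
      ext z
      simp
    change _ = _ * ∫ z, mulOp (⟨fun z => conj (conj (g z)), Complex.continuous_conj.comp
        (Complex.continuous_conj.comp g.continuous)⟩ : C(ℂ, ℂ)) f z * _ ∂cellMeasure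
    rw [this]
  rw [h1]
  convert hasSum_inner_fc (mulOp ⟨fun z => conj (g z), Complex.continuous_conj.comp g.continuous⟩
    (contL2 _ (continuous_normalized_chi m))) f using 3 with n
  rw [mulOp_contL2, fc_eq, integral_contL2_mul, map_mul, Complex.conj_ofReal, ← integral_conj,
    mul_assoc, ← integral_const_mul]
  congr 2
  ext z
  simp only [ContinuousMap.coe_mk, map_mul, Complex.conj_conj, Complex.conj_ofReal, conj_chi,
    neg_neg]
  rw [sub_eq_add_neg, chi_add]
  ring

/-- Evenness of `V` enters here: after `z ↦ -z`, the matrix entries of `V̄` become the complex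
conjugates of those of `V`. -/
lemma mulOp_conjCont_conjRefl (V : Potential) (f : L2) :
    mulOp V.conjCont (conjRefl f) = conjRefl (mulOp V.cont f) := by
  refine fc_ext fun m => ?_
  rw [fc_conjRefl]
  have h1 := fc_mulOp V.conjCont (conjRefl f) m
  have h2 := Complex.hasSum_conj'.2 (fc_mulOp V.cont f m)
  refine h1.unique ?_
  convert h2 using 2 with n
  rw [fc_conjRefl, map_mul, map_mul, map_mul, Complex.conj_ofReal, ← integral_conj]
  congr 2
  have hper : IsPeriodic fun z => conj (V.toFun z * chi (n - m) z) :=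
    (V.isTest.mul (isTest_chi _)).conj.2
  have h3 := integral_neg_comp hper
  change ∫ z, conj (V.toFun z) * chi (n - m) z ∂cellMeasure =
    ∫ z, conj (V.toFun z * chi (n - m) z) ∂cellMeasure
  rw [← h3]
  congr 1
  ext z
  rw [V.even, map_mul]
  congr 1
  rw [conj_chi, chi, chi, freq_neg, map_neg, neg_neg]

/-- The kernels of `D_S(α) + k` and of its adjoint have the same dimension. -/
lemma rank_ker_opDSadj (V : Potential) (α k : ℂ) :
    Module.rank ℂ (LinearMap.ker (opDSadj V α k)) = Module.rank ℂ (LinearMap.ker (opDS V α k)) := by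
  -- Conjugation turns `2D_z + k̄` into `2D_{z̄} + k` on Fourier coefficients, and the swap of
  -- components puts `α` and `αV` back in their places.
  have hto : ∀ x : H1sq, x ∈ LinearMap.ker (opDSadj V α k) →
      ((⟨conjRefl x.2, conjRefl_mem_sobolev_one x.2.2⟩,
        ⟨conjRefl x.1, conjRefl_mem_sobolev_one x.1.2⟩) : H1sq) ∈ LinearMap.ker (opDS V α k) := by
    intro x hx
    rw [mem_ker_opDSadj] at hx
    rw [mem_ker_opDS]
    have hV : mulOp V.cont (conjRefl x.1) = conjRefl (mulOp V.conjCont x.1) := by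
      have := mulOp_conjCont_conjRefl V (conjRefl x.1)
      rw [conjRefl_conjRefl] at this
      rw [this, conjRefl_conjRefl]
    refine ⟨fun n => ?_, fun n => ?_⟩
    · have := congrArg conj (hx.2 n)
      simp only [map_add, map_mul, Complex.conj_conj, map_zero] at this
      simp only [hV, fc_conjRefl]
      linear_combination this
    · have := congrArg conj (hx.1 n)
      simp only [map_add, map_mul, Complex.conj_conj, map_zero] at this
      simp only [fc_conjRefl]
      linear_combination this
  have hfrom : ∀ x : H1sq, x ∈ LinearMap.ker (opDS V α k) →
      ((⟨conjRefl x.2, conjRefl_mem_sobolev_one x.2.2⟩,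
        ⟨conjRefl x.1, conjRefl_mem_sobolev_one x.1.2⟩) : H1sq) ∈
          LinearMap.ker (opDSadj V α k) := by
    intro x hx
    rw [mem_ker_opDS] at hx
    rw [mem_ker_opDSadj]
    refine ⟨fun n => ?_, fun n => ?_⟩
    · have := congrArg conj (hx.2 n)
      simp only [map_add, map_mul, map_zero] at this
      simp only [fc_conjRefl]
      linear_combination this
    · have := congrArg conj (hx.1 n)
      simp only [map_add, map_mul, map_zero] at this
      simp only [mulOp_conjCont_conjRefl, fc_conjRefl]
      linear_combination this
  let j : LinearMap.ker (opDSadj V α k) ≃+ LinearMap.ker (opDS V α k) :=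
    { toFun := fun x => ⟨_, hto x.1 x.2⟩
      invFun := fun x => ⟨_, hfrom x.1 x.2⟩
      left_inv := fun x => Subtype.ext (Prod.ext (Subtype.ext (conjRefl_conjRefl _))
        (Subtype.ext (conjRefl_conjRefl _)))
      right_inv := fun x => Subtype.ext (Prod.ext (Subtype.ext (conjRefl_conjRefl _))
        (Subtype.ext (conjRefl_conjRefl _)))
      map_add' := fun x y => Subtype.ext (Prod.ext
        (Subtype.ext (fc_ext fun n => by simp [fc_conjRefl, fc_add]))
        (Subtype.ext (fc_ext fun n => by simp [fc_conjRefl, fc_add]))) }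
  -- The bijection is conjugate-linear, so the ranks are compared through the automorphism `conj` of
  -- `ℂ`.
  refine rank_eq_of_equiv_equiv (fun c : ℂ => conj c) j (Function.Involutive.bijective fun c => Complex.conj_conj c)
    fun c x => ?_
  refine Subtype.ext (Prod.ext (Subtype.ext (fc_ext fun n => ?_)) (Subtype.ext (fc_ext fun n => ?_)))
  · simp [j, fc_conjRefl, fc_smul]
  · simp [j, fc_conjRefl, fc_smul]

/-! ### Magic parameters and solutions of the system -/

lemma fc_opP (k : ℂ) (U : sobolev 2) (n : ℤ × ℤ) :
    fc (opP V α k U) n = (dsym n + k) ^ 2 * fc U n - α ^ 2 * fc (mulOp V.cont U) n := by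
  have e : opP V α k U = ((twoDbar 0 (twoDbar 1 U + k • incl 1 U) : L2) +
      k • ((twoDbar 1 U : L2) + k • (U : L2))) + (-α ^ 2) • mulOp V.cont U := by
    rw [neg_smul, ← sub_eq_add_neg]
    rfl
  have e' : ((twoDbar 1 U + k • incl 1 U : sobolev 1) : L2) = (twoDbar 1 U : L2) + k • (U : L2) :=
    rfl
  rw [e, fc_add, fc_add, fc_smul, fc_smul, fc_twoDbar, e', fc_add, fc_smul, fc_twoDbar]
  ring

/-- At `α = 0` the operator is diagonal with entries `(dsym n + k)²`. Since `Re (dsym n)` is a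
multiple of `2π`, none of them vanishes at `k = π`. -/
lemma ne_zero_of_mem_magicSet (hα : α ∈ magicSet V) : α ≠ 0 := by
  rintro rfl
  refine hα Real.pi ((Submodule.eq_bot_iff _).2 fun U hU => Subtype.ext (fc_ext fun n => ?_))
  have h := congrArg (fun f => fc f n) (LinearMap.mem_ker.1 hU)
  simp only [fc_opP, fc_zero] at h
  have hd : dsym n + Real.pi ≠ 0 := by
    intro h0
    have h1 := congrArg Complex.re h0
    rw [dsym_eq, freq_one] at h1
    simp at h1
    have h2 : Real.pi * (2 * n.1 + 1) = 0 := by linarith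
    rcases mul_eq_zero.1 h2 with h3 | h3
    · exact Real.pi_ne_zero h3
    · have : 2 * n.1 + 1 = 0 := by exact_mod_cast h3
      omega
  have h4 : (dsym n + Real.pi) ^ 2 * fc U n = 0 := by simpa using h
  rw [(mul_eq_zero.1 h4).resolve_left (pow_ne_zero 2 hd)]
  exact (fc_zero n).symm

/-- The element `(-α⁻¹ (2 D_{z̄} + k) U, U)` attached to `U ∈ H²(ℂ/Λ)`. -/
def pairOf (α k : ℂ) (U : sobolev 2) : H1sq :=
  ((-α⁻¹) • (twoDbar 1 U + k • incl 1 U), incl 1 U)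

lemma pairOf_mem_ker (hα : α ≠ 0) {k : ℂ} {U : sobolev 2} (hU : U ∈ LinearMap.ker (opP V α k)) :
    pairOf α k U ∈ LinearMap.ker (opDS V α k) := by
  have e1 : ∀ n, fc (pairOf α k U).1 n = -α⁻¹ * ((dsym n + k) * fc U n) := fun n => by
    have : ((pairOf α k U).1 : L2) = (-α⁻¹) • ((twoDbar 1 U : L2) + k • (U : L2)) := rfl
    rw [this, fc_smul, fc_add, fc_smul, fc_twoDbar]
    ring
  have e2 : ((pairOf α k U).2 : L2) = U := rfl
  rw [mem_ker_opDS]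
  refine ⟨fun n => ?_, fun n => ?_⟩
  · have h := congrArg (fun f => fc f n) (LinearMap.mem_ker.1 hU)
    simp only [fc_opP, fc_zero] at h
    rw [e1, e2]
    field_simp
    linear_combination -h
  · rw [e1, e2]
    field_simp
    ring

lemma PerSol_ne_bot (hα : α ∈ magicSet V) (k : ℂ) : PerSol V α k ≠ ⊥ := by
  have h0 := ne_zero_of_mem_magicSet hα
  obtain ⟨U, hU, hne⟩ := (Submodule.ne_bot_iff _).1 (hα k)
  obtain ⟨w, hw⟩ := (bijective_solToKer V h0 k).2 ⟨_, pairOf_mem_ker h0 hU⟩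
  refine (Submodule.ne_bot_iff _).2 ⟨w, w.2, fun hz => hne ?_⟩
  have hw0 : w = 0 := Subtype.ext hz
  rw [hw0, map_zero] at hw
  have := congrArg (fun x => (x.1.2 : L2)) hw
  exact Subtype.ext this.symm

/-- A nonzero element of the kernel of `P(α, 0)` is smooth. -/
lemma exists_smooth_of_mem_ker_opP (hα : α ≠ 0) {U : sobolev 2}
    (hU : U ∈ LinearMap.ker (opP V α 0)) (hne : U ≠ 0) : ∃ u : ℂ → ℂ, ContDiff ℝ ∞ u ∧
      IsPeriodic u ∧ (U : L2) =ᵐ[cellMeasure] u ∧ vec u ∈ PerSol V α 0 ∧ vec u ≠ 0 := by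
  obtain ⟨w, hw⟩ := (bijective_solToKer V hα 0).2 ⟨_, pairOf_mem_ker hα hU⟩
  have ht := isTest_of_mem_PerSol w.2
  have e : contL2 _ ht.2.1.continuous = (U : L2) := congrArg (fun x => (x.1.2 : L2)) hw
  -- At `k = 0` the second equation is `w₁ = 2D_{z̄} w₂`, so `w` is the vector `𝐮` of its own second
  -- component.
  have hv : vec (fun z => (w.1 z).2) = w.1 := by
    ext1 z
    refine Prod.ext ?_ rfl
    have := w.2.1.2.2 z
    rw [zero_mul, add_zero] at this
    exact this
  refine ⟨fun z => (w.1 z).2, ht.2.1, ht.2.2, ?_, hv ▸ w.2, fun h0 => hne ?_⟩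
  · rw [← e]
    exact coeFn_contL2 _
  · have hw0 : w = 0 := Subtype.ext (hv.symm.trans h0)
    rw [hw0, map_zero] at hw
    exact Subtype.ext (congrArg (fun x => (x.1.2 : L2)) hw).symm

/-! ### Estimates at high frequencies -/

lemma mul_norm_le_of_fc {f g : L2} {R : ℝ} (hR : 0 ≤ R) (h : ∀ n, R * ‖fc f n‖ ≤ ‖fc g n‖) :
    R * ‖f‖ ≤ ‖g‖ := by
  refine le_of_sq_le_sq ?_ (norm_nonneg _)
  rw [mul_pow]
  refine hasSum_le (fun n => ?_) ((hasSum_norm_fc_sq f).mul_left (R ^ 2)) (hasSum_norm_fc_sq g)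
  rw [← mul_pow]
  exact pow_le_pow_left₀ (by positivity) (h n) 2

lemma exists_norm_mulOp_le (g : C(ℂ, ℂ)) : ∃ C, 0 ≤ C ∧ ∀ f, ‖mulOp g f‖ ≤ C * ‖f‖ := by
  obtain ⟨C, hC⟩ := (isCompact_closedBall (0 : ℂ) 2).exists_bound_of_continuousOn
    g.continuous.continuousOn
  refine ⟨max C 0, le_max_right _ _, fun f => ?_⟩
  refine Lp.norm_le_mul_norm_of_ae_le_mul ?_
  filter_upwards [coeFn_mulOp g f, ae_restrict_mem measurableSet_cell] with z hz hc
  rw [hz, norm_mul]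
  gcongr
  exact (hC z (cell_subset hc)).trans (le_max_left _ _)

/-- The Fourier coefficients of frequency at most `R` of an element of `L²(ℂ/Λ; ℂ²)`. -/
def lowModes (R : ℝ) : L2 × L2 →ₗ[ℂ] {n : ℤ × ℤ // ‖dsym n‖ ≤ R} → ℂ × ℂ where
  toFun f n := (fc f.1 n, fc f.2 n)
  map_add' f g := by ext n <;> simp [fc_add]
  map_smul' c f := by ext n <;> simp [fc_smul]

instance (R : ℝ) : Finite {n : ℤ × ℤ // ‖dsym n‖ ≤ R} := finite_norm_dsym_le R

/-- The constant `3` matters only in exceeding `2`, the loss in passing between the maximum norm on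
products and the Hilbert norm in `finite_eigenvalues`. -/
lemma three_mul_norm_le {c R : ℝ} {x d b : L2 × L2} (h1 : R * ‖x.1‖ ≤ ‖d.1‖)
    (h2 : R * ‖x.2‖ ≤ ‖d.2‖) (hb : ‖b‖ ≤ c * ‖x‖) (hR : c + 3 ≤ R) : 3 * ‖x‖ ≤ ‖d + b‖ := by
  have hd : R * ‖x‖ ≤ ‖d‖ := by
    rw [Prod.norm_def, Prod.norm_def]
    rcases max_choice ‖x.1‖ ‖x.2‖ with h | h <;> rw [h]
    · exact h1.trans (le_max_left _ _)
    · exact h2.trans (le_max_right _ _)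
  have h3 : ‖d‖ ≤ ‖d + b‖ + ‖b‖ := by
    calc ‖d‖ = ‖(d + b) - b‖ := by rw [add_sub_cancel_right]
      _ ≤ _ := norm_sub_le _ _
  nlinarith [norm_nonneg x]

/-- The inclusion `H¹(ℂ/Λ; ℂ²) ⊆ L²(ℂ/Λ; ℂ²)`. -/
def inclSq : H1sq →ₗ[ℂ] L2 × L2 := (sobolev 1).subtype.prodMap (sobolev 1).subtype

/-- On frequencies above `R` the first-order part is at least `R` times the norm, while the
zeroth-order terms have norm at most `‖k‖ + ‖α‖(C + C' + 1)`. -/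
lemma exists_opDS_bound (V : Potential) (α k : ℂ) : ∃ R₀ : ℝ, ∀ R ≥ R₀, ∀ x : H1sq,
    lowModes R (inclSq x) = 0 →
      3 * ‖inclSq x‖ ≤ ‖opDS V α k x‖ ∧ 3 * ‖inclSq x‖ ≤ ‖opDSadj V α k x‖ := by
  obtain ⟨C, hC0, hC⟩ := exists_norm_mulOp_le V.cont
  obtain ⟨C', hC0', hC'⟩ := exists_norm_mulOp_le V.conjCont
  refine ⟨‖k‖ + ‖α‖ * (C + C' + 1) + 3, fun R hR x hx => ?_⟩
  have hR0 : 0 ≤ R := le_trans (by positivity) hR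
  have hlow : ∀ n, ‖dsym n‖ ≤ R → fc x.1 n = 0 ∧ fc x.2 n = 0 := fun n hn =>
    Prod.mk_eq_zero.1 (congrFun hx ⟨n, hn⟩)
  have hx1 : ‖(x.1 : L2)‖ ≤ ‖inclSq x‖ := norm_fst_le (inclSq x)
  have hx2 : ‖(x.2 : L2)‖ ≤ ‖inclSq x‖ := norm_snd_le (inclSq x)
  have htail : ∀ f : sobolev 1, (∀ n, ‖dsym n‖ ≤ R → fc f n = 0) →
      R * ‖(f : L2)‖ ≤ ‖(twoDbar 0 f : L2)‖ ∧ R * ‖(f : L2)‖ ≤ ‖(twoDz 0 f : L2)‖ := by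
    intro f hf
    have h : ∀ n, R * ‖fc f n‖ ≤ ‖dsym n‖ * ‖fc f n‖ := fun n => by
      rcases le_total ‖dsym n‖ R with hn | hn
      · simp [hf n hn]
      · gcongr
    refine ⟨mul_norm_le_of_fc hR0 fun n => ?_, mul_norm_le_of_fc hR0 fun n => ?_⟩
    · rw [fc_twoDbar, norm_mul]
      exact h n
    · rw [fc_twoDz, norm_mul, RCLike.norm_conj]
      exact h n
  have t1 := htail x.1 fun n hn => (hlow n hn).1
  have t2 := htail x.2 fun n hn => (hlow n hn).2
  have hα := norm_nonneg α
  have hk := norm_nonneg k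
  have hN := norm_nonneg (inclSq x)
  constructor
  · have e : opDS V α k x = ((twoDbar 0 x.1 : L2), (twoDbar 0 x.2 : L2)) +
        (k • (x.1 : L2) + α • mulOp V.cont x.2, α • (x.1 : L2) + k • (x.2 : L2)) := by
      rw [opDS_apply, Prod.mk_add_mk]
      exact Prod.ext (add_assoc _ _ _) (add_left_comm _ _ _)
    rw [e]
    refine three_mul_norm_le (c := ‖k‖ + ‖α‖ * (C + C' + 1)) t1.1 t2.1 (norm_prod_le_iff.2 ⟨?_, ?_⟩) hR
    · calc ‖k • (x.1 : L2) + α • mulOp V.cont x.2‖ ≤ ‖k‖ * ‖(x.1 : L2)‖ + ‖α‖ * (C * ‖(x.2 : L2)‖) := by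
            refine (norm_add_le _ _).trans ?_
            rw [norm_smul, norm_smul]
            gcongr
            exact hC _
        _ ≤ ‖k‖ * ‖inclSq x‖ + ‖α‖ * ((C + C' + 1) * ‖inclSq x‖) := by
            gcongr
            linarith
        _ = _ := by ring
    · calc ‖α • (x.1 : L2) + k • (x.2 : L2)‖ ≤ ‖α‖ * (1 * ‖(x.1 : L2)‖) + ‖k‖ * ‖(x.2 : L2)‖ := by
            refine (norm_add_le _ _).trans ?_
            rw [norm_smul, norm_smul, one_mul]
        _ ≤ ‖α‖ * ((C + C' + 1) * ‖inclSq x‖) + ‖k‖ * ‖inclSq x‖ := by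
            gcongr
            linarith
        _ = _ := by ring
  · have e : opDSadj V α k x = ((twoDz 0 x.1 : L2), (twoDz 0 x.2 : L2)) +
        (conj k • (x.1 : L2) + conj α • (x.2 : L2),
          conj α • mulOp V.conjCont x.1 + conj k • (x.2 : L2)) := by
      rw [opDSadj_apply, Prod.mk_add_mk]
      exact Prod.ext (add_assoc _ _ _) (add_left_comm _ _ _)
    rw [e]
    refine three_mul_norm_le (c := ‖k‖ + ‖α‖ * (C + C' + 1)) t1.2 t2.2 (norm_prod_le_iff.2 ⟨?_, ?_⟩) hR
    · calc ‖conj k • (x.1 : L2) + conj α • (x.2 : L2)‖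
            ≤ ‖k‖ * ‖(x.1 : L2)‖ + ‖α‖ * (1 * ‖(x.2 : L2)‖) := by
            refine (norm_add_le _ _).trans ?_
            rw [norm_smul, norm_smul, one_mul, RCLike.norm_conj, RCLike.norm_conj]
        _ ≤ ‖k‖ * ‖inclSq x‖ + ‖α‖ * ((C + C' + 1) * ‖inclSq x‖) := by
            gcongr
            linarith
        _ = _ := by ring
    · calc ‖conj α • mulOp V.conjCont x.1 + conj k • (x.2 : L2)‖
            ≤ ‖α‖ * (C' * ‖(x.1 : L2)‖) + ‖k‖ * ‖(x.2 : L2)‖ := by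
            refine (norm_add_le _ _).trans ?_
            rw [norm_smul, norm_smul, RCLike.norm_conj, RCLike.norm_conj]
            gcongr
            exact hC' _
        _ ≤ ‖α‖ * ((C + C' + 1) * ‖inclSq x‖) + ‖k‖ * ‖inclSq x‖ := by
            gcongr
            linarith
        _ = _ := by ring

lemma inclSq_injective : Function.Injective inclSq := fun _ _ h =>
  Prod.ext (Subtype.ext (congrArg Prod.fst h)) (Subtype.ext (congrArg Prod.snd h))

instance finite_ker_opDS (V : Potential) (α k : ℂ) : Module.Finite ℂ (LinearMap.ker (opDS V α k)) := by
  obtain ⟨R, hR⟩ := exists_opDS_bound V α k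
  refine Module.Finite.of_injective
    ((lowModes R ∘ₗ inclSq) ∘ₗ (LinearMap.ker (opDS V α k)).subtype) ?_
  rw [← LinearMap.ker_eq_bot, Submodule.eq_bot_iff]
  intro x hx
  have h := (hR R le_rfl x.1 hx).1
  rw [LinearMap.mem_ker.1 x.2, norm_zero] at h
  have h0 : inclSq x.1 = 0 := norm_eq_zero.1 (le_antisymm (by linarith) (norm_nonneg _))
  exact Subtype.ext (inclSq_injective (h0.trans (map_zero _).symm))

/-! ### The Bloch Hamiltonian -/

/-- `L²(ℂ/Λ; ℂ⁴)` with its Hilbert space structure. -/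
def toHilbert : (L2 × L2) × (L2 × L2) →ₗ[ℂ] PiLp 2 fun _ : Fin 4 => L2 where
  toFun y := WithLp.toLp 2 ![y.1.1, y.1.2, y.2.1, y.2.2]
  map_add' x y := by
    ext1 i
    fin_cases i <;> rfl
  map_smul' c x := by
    ext1 i
    fin_cases i <;> rfl

lemma inner_toHilbert (x y : (L2 × L2) × (L2 × L2)) : inner ℂ (toHilbert x) (toHilbert y) =
    inner ℂ x.1.1 y.1.1 + inner ℂ x.1.2 y.1.2 + inner ℂ x.2.1 y.2.1 + inner ℂ x.2.2 y.2.2 := by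
  rw [PiLp.inner_apply, Fin.sum_univ_four]
  rfl

lemma norm_toHilbert_sq (x : (L2 × L2) × (L2 × L2)) : ‖toHilbert x‖ ^ 2 =
    ‖x.1.1‖ ^ 2 + ‖x.1.2‖ ^ 2 + ‖x.2.1‖ ^ 2 + ‖x.2.2‖ ^ 2 := by
  rw [PiLp.norm_sq_eq_of_L2, Fin.sum_univ_four]
  rfl

lemma norm_le_norm_toHilbert (x : (L2 × L2) × (L2 × L2)) : ‖x‖ ≤ ‖toHilbert x‖ := by
  have h := norm_toHilbert_sq x
  refine norm_prod_le_iff.2 ⟨norm_prod_le_iff.2 ⟨?_, ?_⟩, norm_prod_le_iff.2 ⟨?_, ?_⟩⟩ <;>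
    exact le_of_sq_le_sq (by rw [h]; nlinarith [sq_nonneg ‖x.1.1‖, sq_nonneg ‖x.1.2‖, sq_nonneg ‖x.2.1‖, sq_nonneg ‖x.2.2‖]) (norm_nonneg _)

lemma norm_toHilbert_le (x : (L2 × L2) × (L2 × L2)) : ‖toHilbert x‖ ≤ 2 * ‖x‖ := by
  have h := norm_toHilbert_sq x
  refine le_of_sq_le_sq ?_ (by positivity)
  have a1 := pow_le_pow_left₀ (norm_nonneg _) ((norm_fst_le x.1).trans (norm_fst_le x)) 2
  have a2 := pow_le_pow_left₀ (norm_nonneg _) ((norm_snd_le x.1).trans (norm_fst_le x)) 2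
  have a3 := pow_le_pow_left₀ (norm_nonneg _) ((norm_fst_le x.2).trans (norm_snd_le x)) 2
  have a4 := pow_le_pow_left₀ (norm_nonneg _) ((norm_snd_le x.2).trans (norm_snd_le x)) 2
  rw [h]
  linarith

lemma inner_twoDbar (f g : sobolev 1) :
    inner ℂ (twoDbar 0 f : L2) (g : L2) = inner ℂ (f : L2) (twoDz 0 g : L2) := by
  refine (hasSum_inner_fc _ _).unique ?_
  convert hasSum_inner_fc (f : L2) (twoDz 0 g : L2) using 2 with n
  rw [fc_twoDbar, fc_twoDz, map_mul]
  ring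

lemma inner_opDS (a b : H1sq) (k : ℂ) :
    inner ℂ (opDS V α k a).1 (b.1 : L2) + inner ℂ (opDS V α k a).2 (b.2 : L2) =
      inner ℂ (a.1 : L2) (opDSadj V α k b).1 + inner ℂ (a.2 : L2) (opDSadj V α k b).2 := by
  have hV := inner_mulOp_left V.cont a.2 b.1
  change inner ℂ (mulOp V.cont a.2) (b.1 : L2) = inner ℂ (a.2 : L2) (mulOp V.conjCont b.1) at hV
  simp only [opDS_apply, opDSadj_apply, inner_add_left, inner_add_right, inner_smul_left,
    inner_smul_right, inner_twoDbar, hV]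
  ring

lemma inner_opH (x y : H1sq × H1sq) (k : ℂ) :
    inner ℂ (toHilbert (opH V α k x)) (toHilbert (inclH y)) =
      inner ℂ (toHilbert (inclH x)) (toHilbert (opH V α k y)) := by
  have h1 := inner_opDS (V := V) (α := α) x.2 y.1 k
  have h2 := congrArg conj (inner_opDS (V := V) (α := α) y.2 x.1 k)
  simp only [map_add, inner_conj_symm] at h2
  rw [inner_toHilbert, inner_toHilbert]
  change inner ℂ (opDS V α k x.2).1 (y.1.1 : L2) + inner ℂ (opDS V α k x.2).2 (y.1.2 : L2) +
    inner ℂ (opDSadj V α k x.1).1 (y.2.1 : L2) + inner ℂ (opDSadj V α k x.1).2 (y.2.2 : L2) =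
    inner ℂ (x.1.1 : L2) (opDS V α k y.2).1 + inner ℂ (x.1.2 : L2) (opDS V α k y.2).2 +
    inner ℂ (x.2.1 : L2) (opDSadj V α k y.1).1 + inner ℂ (x.2.2 : L2) (opDSadj V α k y.1).2
  linear_combination h1 - h2

lemma inclH_injective : Function.Injective inclH := fun _ _ h =>
  Prod.ext (inclSq_injective (congrArg Prod.fst h)) (inclSq_injective (congrArg Prod.snd h))

lemma mem_eigenspaceH {k : ℂ} {μ : ℝ} {x : H1sq × H1sq} :
    x ∈ eigenspaceH V α k μ ↔ opH V α k x = (μ : ℂ) • inclH x := by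
  rw [eigenspaceH, LinearMap.mem_ker, LinearMap.sub_apply, sub_eq_zero]
  rfl

lemma inner_eq_zero_of_mem_eigenspaceH {k : ℂ} {μ ν : ℝ} (hne : μ ≠ ν) {x y : H1sq × H1sq}
    (hx : x ∈ eigenspaceH V α k μ) (hy : y ∈ eigenspaceH V α k ν) :
    inner ℂ (toHilbert (inclH x)) (toHilbert (inclH y)) = 0 := by
  have h := inner_opH (V := V) (α := α) x y k
  rw [mem_eigenspaceH.1 hx, mem_eigenspaceH.1 hy, map_smul, map_smul, inner_smul_left,
    inner_smul_right, Complex.conj_ofReal, ← sub_eq_zero, ← sub_mul] at h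
  refine (mul_eq_zero.1 h).resolve_left ?_
  exact_mod_cast sub_ne_zero.2 hne

lemma norm_sum_smul_sq {ι E : Type*} [Fintype ι] [NormedAddCommGroup E] [InnerProductSpace ℂ E]
    {v : ι → E} (hv : ∀ i j, i ≠ j → inner ℂ (v i) (v j) = 0) (c : ι → ℂ) :
    ‖∑ i, c i • v i‖ ^ 2 = ∑ i, ‖c i‖ ^ 2 * ‖v i‖ ^ 2 := by
  classical
  have h : inner ℂ (∑ i, c i • v i) (∑ i, c i • v i) =
      ((∑ i, ‖c i‖ ^ 2 * ‖v i‖ ^ 2 : ℝ) : ℂ) := by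
    rw [sum_inner]
    push_cast
    refine Finset.sum_congr rfl fun i _ => ?_
    rw [inner_sum, Finset.sum_eq_single i (fun j _ hj => by
      rw [inner_smul_left, inner_smul_right, hv i j hj.symm, mul_zero, mul_zero]) (by simp),
      inner_smul_left, inner_smul_right, inner_self_eq_norm_sq_to_K, ← mul_assoc,
      Complex.conj_mul']
    rfl
  rw [inner_self_eq_norm_sq_to_K] at h
  exact Complex.ofReal_injective ((Complex.ofReal_pow _ 2).trans h)

/-- The eigenvalues of `H(α,k)` in `[-1, 1]` are finite in number. -/
lemma finite_eigenvalues (V : Potential) (α k : ℂ) :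
    {μ : ℝ | μ ∈ Icc (-1) 1 ∧ eigenspaceH V α k μ ≠ ⊥}.Finite := by
  obtain ⟨R, hR⟩ := exists_opDS_bound V α k
  set L : H1sq × H1sq →ₗ[ℂ] _ := ((lowModes R).prodMap (lowModes R)) ∘ₗ inclH with hL
  by_contra hinf
  -- With more eigenvectors than low modes, some nontrivial combination `x` has no low modes.
  -- Orthogonality bounds `H x` by `x` in Hilbert norm, against the lower bound with constant `3`.
  obtain ⟨t, ht, hcard⟩ := Set.Infinite.exists_subset_card_eq hinf (Module.finrank ℂ
    (({n : ℤ × ℤ // ‖dsym n‖ ≤ R} → ℂ × ℂ) × ({n : ℤ × ℤ // ‖dsym n‖ ≤ R} → ℂ × ℂ)) + 1)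
  choose e he he0 using fun i : t => (Submodule.ne_bot_iff _).1 (ht i.2).2
  have hdep : ¬ LinearIndependent ℂ fun i => L (e i) := by
    intro hli
    have := hli.fintype_card_le_finrank
    rw [Fintype.card_coe, hcard] at this
    omega
  obtain ⟨g, hg, i, hi⟩ := Fintype.not_linearIndependent_iff.1 hdep
  set x := ∑ i, g i • e i with hx
  have hLx : L x = 0 := by rw [hx, map_sum, ← hg]; simp only [map_smul]
  have horth : ∀ i j : t, i ≠ j →
      inner ℂ (toHilbert (inclH (e i))) (toHilbert (inclH (e j))) = 0 := fun i j hij =>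
    inner_eq_zero_of_mem_eigenspaceH (fun h => hij (Subtype.ext h)) (he i) (he j)
  have hn1 : ‖toHilbert (inclH x)‖ ^ 2 = ∑ i, ‖g i‖ ^ 2 * ‖toHilbert (inclH (e i))‖ ^ 2 := by
    rw [← norm_sum_smul_sq horth, hx]
    simp only [map_sum, map_smul]
  have hn2 : ‖toHilbert (opH V α k x)‖ ^ 2 =
      ∑ i : t, ‖g i * (i : ℝ)‖ ^ 2 * ‖toHilbert (inclH (e i))‖ ^ 2 := by
    rw [← norm_sum_smul_sq horth, hx]
    simp only [map_sum, map_smul, mem_eigenspaceH.1 (he _), mul_smul]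
  have hle : ‖toHilbert (opH V α k x)‖ ≤ ‖toHilbert (inclH x)‖ := by
    refine le_of_sq_le_sq ?_ (norm_nonneg _)
    rw [hn1, hn2]
    gcongr with i
    rw [norm_mul]
    have : ‖((i : ℝ) : ℂ)‖ ≤ 1 := by
      rw [Complex.norm_real, Real.norm_eq_abs]
      exact abs_le.2 (ht i.2).1
    exact mul_le_of_le_one_right (norm_nonneg _) this
  have hbound : 3 * ‖inclH x‖ ≤ ‖opH V α k x‖ := by
    have b1 := (hR R le_rfl x.1 (congrArg Prod.fst hLx)).2
    have b2 := (hR R le_rfl x.2 (congrArg Prod.snd hLx)).1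
    have e1 : ‖inclH x‖ = max ‖inclSq x.1‖ ‖inclSq x.2‖ := rfl
    have e2 : ‖opH V α k x‖ = max ‖opDS V α k x.2‖ ‖opDSadj V α k x.1‖ := rfl
    rw [e1, e2]
    rcases max_choice ‖inclSq x.1‖ ‖inclSq x.2‖ with h | h <;> rw [h]
    · exact b1.trans (le_max_right _ _)
    · exact b2.trans (le_max_left _ _)
  have h0 : ‖inclH x‖ = 0 := by
    have c1 := norm_le_norm_toHilbert (opH V α k x)
    have c2 := norm_toHilbert_le (inclH x)
    linarith [norm_nonneg (inclH x)]
  have h1 : ∑ i, ‖g i‖ ^ 2 * ‖toHilbert (inclH (e i))‖ ^ 2 = 0 := by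
    rw [← hn1, norm_eq_zero.1 h0, map_zero, norm_zero]
    norm_num
  have h2 := (Finset.sum_eq_zero_iff_of_nonneg fun _ _ =>
    mul_nonneg (sq_nonneg _) (sq_nonneg _)).1 h1 i (Finset.mem_univ i)
  have h3 : ‖toHilbert (inclH (e i))‖ = 0 := by
    rcases mul_eq_zero.1 h2 with h | h
    · exact absurd (norm_eq_zero.1 (pow_eq_zero_iff two_ne_zero |>.1 h)) hi
    · exact pow_eq_zero_iff two_ne_zero |>.1 h
  have h4 : inclH (e i) = 0 := norm_eq_zero.1
    (le_antisymm (h3 ▸ norm_le_norm_toHilbert _) (norm_nonneg _))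
  exact he0 i (inclH_injective (h4.trans (map_zero _).symm))

/-- The nonzero eigenvalues of `H(α,k)` stay away from `0`. -/
lemma exists_spectral_gap (V : Potential) (α k : ℂ) :
    ∃ r > 0, ∀ μ ∈ Icc (-r) r, μ ≠ 0 → eigenspaceH V α k μ = ⊥ := by
  have hfin : {μ : ℝ | (μ ∈ Icc (-1) 1 ∧ eigenspaceH V α k μ ≠ ⊥) ∧ μ ≠ 0}.Finite :=
    (finite_eigenvalues V α k).subset fun _ h => h.1
  obtain ⟨ε, hε, hball⟩ := Metric.isOpen_iff.1 hfin.isClosed.isOpen_compl 0 fun h => h.2 rfl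
  refine ⟨min 1 (ε / 2), by positivity, fun μ hμ h0 => ?_⟩
  by_contra hne
  have h1 : μ ∈ Metric.ball (0 : ℝ) ε := by
    rw [mem_ball_zero_iff, Real.norm_eq_abs]
    have := (abs_le.2 hμ).trans (min_le_right _ _)
    linarith
  have h2 := (abs_le.2 hμ).trans (min_le_left _ _)
  exact hball h1 ⟨⟨abs_le.1 h2, hne⟩, h0⟩

lemma eigenspaceH_zero (V : Potential) (α k : ℂ) :
    eigenspaceH V α k 0 = LinearMap.ker (opH V α k) := by
  simp [eigenspaceH]

/-- `H` is off-diagonal, so its kernel is the product of the kernels of the two blocks, which have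
equal dimension. -/
lemma rank_ker_opH (V : Potential) (α k : ℂ) : Module.rank ℂ (LinearMap.ker (opH V α k)) =
    Module.rank ℂ (LinearMap.ker (opDS V α k)) + Module.rank ℂ (LinearMap.ker (opDS V α k)) := by
  have e : LinearMap.ker (opH V α k) =
      (LinearMap.ker (opDSadj V α k)).prod (LinearMap.ker (opDS V α k)) := by
    ext x
    rw [LinearMap.mem_ker, Submodule.mem_prod, LinearMap.mem_ker, LinearMap.mem_ker, and_comm]
    exact Prod.mk_eq_zero
  let f : (LinearMap.ker (opDSadj V α k)).prod (LinearMap.ker (opDS V α k)) ≃ₗ[ℂ]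
      LinearMap.ker (opDSadj V α k) × LinearMap.ker (opDS V α k) :=
    { toFun := fun x => (⟨x.1.1, x.2.1⟩, ⟨x.1.2, x.2.2⟩)
      invFun := fun x => ⟨(x.1.1, x.2.1), x.1.2, x.2.2⟩
      map_add' := fun _ _ => rfl
      map_smul' := fun _ _ => rfl }
  rw [e, f.rank_eq, rank_prod', rank_ker_opDSadj]

/-! ### Flat bands -/

/-- The radius `r = 0` is already admissible: the eigenvalue `0` alone has multiplicity `2m ≥ 2j`.
-/
lemma bandPos_eq_zero {k : ℂ} {m j : ℕ} (h : Module.rank ℂ (LinearMap.ker (opH V α k)) = 2 * m)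
    (hj : j ≤ m) : bandPos V α k j = 0 := by
  refine le_antisymm ?_ (le_iInf₂ fun r hr => EReal.coe_nonneg.2 hr.1)
  refine iInf₂_le (0 : ℝ) ⟨le_rfl, ?_⟩
  calc (2 * j : Cardinal) ≤ 2 * m := by gcongr
    _ = Module.rank ℂ (LinearMap.ker (opH V α k)) := h.symm
    _ ≤ _ := by
      rw [← eigenspaceH_zero]
      exact Submodule.rank_mono (le_iSup₂_of_le 0 (by simp) le_rfl)

/-- Inside the spectral gap the only eigenvectors are those of the kernel, too few to reach `2j`; so
the band lies at or above the edge of the gap. -/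
lemma bandPos_ne_zero {k : ℂ} {m j : ℕ} (h : Module.rank ℂ (LinearMap.ker (opH V α k)) = 2 * m)
    (hj : m < j) : bandPos V α k j ≠ 0 := by
  obtain ⟨r, hr, hgap⟩ := exists_spectral_gap V α k
  have : (r : EReal) ≤ bandPos V α k j := by
    refine le_iInf₂ fun r' hr' => EReal.coe_le_coe_iff.2 ?_
    by_contra! hlt
    have h1 : (⨆ μ ∈ Icc (-r') r', eigenspaceH V α k μ) ≤ eigenspaceH V α k 0 := by
      refine iSup₂_le fun μ hμ => ?_
      rcases eq_or_ne μ 0 with rfl | h0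
      · exact le_rfl
      · rw [hgap μ ⟨by linarith [hμ.1], by linarith [hμ.2]⟩ h0]
        exact bot_le
    have h2 := hr'.2.trans (Submodule.rank_mono h1)
    rw [eigenspaceH_zero, h] at h2
    have h3 : 2 * j ≤ 2 * m := by exact_mod_cast h2
    omega
  exact ((EReal.coe_pos.2 hr).trans_le this).ne'

lemma flatBands_encard {m : ℕ}
    (h : ∀ k, Module.rank ℂ (LinearMap.ker (opH V α k)) = 2 * m) :
    (flatBands V α).encard = 2 * m := by
  have e : flatBands V α = ((Finset.Icc (-m : ℤ) m).erase 0 : Finset ℤ) := by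
    ext j
    have hb : ∀ k, band V α k j = 0 ↔ bandPos V α k j.natAbs = 0 := fun k => by
      unfold band
      split_ifs
      · rfl
      · exact EReal.neg_eq_zero_iff
    have hb' : (∀ k, band V α k j = 0) ↔ j.natAbs ≤ m := by
      simp only [hb]
      refine ⟨fun h' => ?_, fun h' k => bandPos_eq_zero (h k) h'⟩
      by_contra! hlt
      -- A single quasi-momentum, here `k = 0`, suffices to show that a band is not flat at `0`.
      exact bandPos_ne_zero (h 0) hlt (h' 0)
    rw [flatBands, Set.mem_ofPred_eq, hb']
    simp only [Finset.coe_erase, Finset.coe_Icc, mem_sdiff, mem_Icc, mem_singleton_iff]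
    omega
  rw [e, Set.encard_coe_eq_coe_finsetCard, Finset.card_erase_of_mem (by simp), Int.card_Icc]
  norm_cast
  omega

end ScalarModel

end

theorem mainTheorem5 (V : ScalarModel.Potential) (α : ℂ) (hα : α ∈ ScalarModel.magicSet V) :
    ∃ m : ℕ,
      (∀ U ∈ LinearMap.ker (ScalarModel.opP V α 0), U ≠ 0 →
        ∃ u : ℂ → ℂ, ContDiff ℝ ∞ u ∧ ScalarModel.IsPeriodic u ∧
          (U : ScalarModel.L2) =ᵐ[ScalarModel.cellMeasure] u ∧
          ScalarModel.zeroCount (ScalarModel.vec u) = m) ∧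
      Module.rank ℂ (LinearMap.ker (ScalarModel.opDS V α 0)) = m ∧
      (∀ k : ℂ, Module.rank ℂ (LinearMap.ker (ScalarModel.opH V α k)) = 2 * m) ∧
      (ScalarModel.flatBands V α).encard = 2 * m := by
  open ScalarModel in
  have h0 := ne_zero_of_mem_magicSet hα
  let E k := LinearEquiv.ofBijective (solToKer V h0 k) (bijective_solToKer V h0 k)
  have : Module.Finite ℂ (PerSol V α 0) := Module.Finite.equiv (E 0).symm
  obtain ⟨m, hm, hrank⟩ := periodic_solutions_structure (PerSol_ne_bot hα)
  have hDS : ∀ k, Module.rank ℂ (LinearMap.ker (opDS V α k)) = m := fun k =>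
    (E k).rank_eq.symm.trans (hrank k)
  have hH : ∀ k, Module.rank ℂ (LinearMap.ker (opH V α k)) = 2 * m := fun k => by
    rw [rank_ker_opH, hDS, two_mul]
  refine ⟨m, fun U hU hne => ?_, hDS 0, hH, flatBands_encard hH⟩
  obtain ⟨u, hu, hp, hae, hsol, hv⟩ := exists_smooth_of_mem_ker_opP h0 hU hne
  exact ⟨u, hu, hp, hae, hm _ hsol hv⟩
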